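/- There is an absolute constant $C$ with the following property. Let $X\ge 2$ be real, and let $u$ be a real, non-negative $C^\infty$ function on $\mathbb{R}$ with $\int u=1$ and support contained in $[e^{1-1/X},e]$. Put $$U(z)=\int_0^\infty u(x)\,E_1(z\log x)\,dx\quad(z\ne 0),\qquad E_1(z)=\int_z^\infty \frac{e^{-w}}{w}\,dw,$$ where $E_1$ is the principal branch of the exponential integral, with cut along the negative real axis. (On the cut $E_1$ takes its limit from above; the choice of side does not affect $e^{-U(z)}$.) Let $q\ge 2$, let $\chi$ be a primitive Dirichlet character modulo $q$, and let $\rho$ run over the non-trivial zeros of $L(s,\chi)$ (those with $0<\operatorname{Re}\rho<1$), counted with multiplicity. Define $$P_X(\chi)=\exp\bigg(\sum_{2\le n\le X}\frac{\Lambda(n)\chi(n)}{n^{1/2}\log n}\bigg),\qquad Z_X(\chi)=\exp\bigg(-\sum_{\rho}U\big((\tfrac12-\rho)\log X\big)\bigg),$$ where $\Lambda$ is the von Mangoldt function and $e^{-U(0)}$ is read as $0$, so that $Z_X(\chi)=0$ if $L(\frac12,\chi)=0$. Then the sum over the zeros $\rho\neq\frac12$ converges absolutely, and $$L(\tfrac12,\chi)=P_X(\chi)\,Z_X(\chi)\,(1+\theta)\quad\text{for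 some }\theta\in\mathbb{C}\text{ with }|\theta|\le C(\log X)^{-2}.$$ -/

import Mathlib

open scoped ContDiff

noncomputable section

/-- The exponential integral `E₁(z) = ∫_z^∞ e^{-w}/w dw` for complex `z ≠ 0` (principal branch, cut
along the negative real axis). The path of integration runs from `z` to `|z|` along the arc
`w = |z| e^{iφ}`, with `φ` going from `arg z ∈ (-π, π]` to `0` (on which `dw / w = i dφ`), and then
from `|z|` to `∞` along the real axis. It does not cross the negative real axis, so by Cauchy's
theorem it gives the same value as every other path from `z` to `+∞` that avoids the cut. -/
def expIntegralE1 (z : ℂ) : ℂ :=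
  (∫ t in Set.Ioi ‖z‖, Complex.exp (-(t : ℂ)) / (t : ℂ)) -
    Complex.I * ∫ φ in (0 : ℝ)..z.arg,
      Complex.exp (-((‖z‖ : ℂ) * Complex.exp ((φ : ℂ) * Complex.I)))

/-- `U(z) = ∫_0^∞ u(x) E₁(z log x) dx`. -/
def smoothedE1 (u : ℝ → ℝ) (z : ℂ) : ℂ :=
  ∫ x in Set.Ioi (0 : ℝ), (u x : ℂ) * expIntegralE1 (z * (Real.log x : ℂ))

/-- `u` is a real, non-negative smooth function of mass `1`, supported on `[e^{1-1/X}, e]`. -/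
structure IsWeight (X : ℝ) (u : ℝ → ℝ) : Prop where
  smooth : ContDiff ℝ ∞ u
  nonneg : ∀ x, 0 ≤ u x
  support_subset : tsupport u ⊆ Set.Icc (Real.exp (1 - 1 / X)) (Real.exp 1)
  mass_one : ∫ x, u x = 1

namespace DirichletCharacter

variable {q : ℕ} [NeZero q]

/-- The non-trivial zeros of `L(s, χ)`: those in the open critical strip. -/
def nontrivialZeros (χ : DirichletCharacter ℂ q) : Set ℂ :=
  {ρ | LFunction χ ρ = 0 ∧ 0 < ρ.re ∧ ρ.re < 1}

/-- The contribution of the zero `ρ`, counted with its multiplicity, to the sum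
`∑_ρ U((1/2 - ρ) log X)`. -/
def zeroTerm (u : ℝ → ℝ) (X : ℝ) (χ : DirichletCharacter ℂ q) (ρ : ℂ) : ℂ :=
  (analyticOrderNatAt (LFunction χ) ρ : ℂ) * smoothedE1 u ((1 / 2 - ρ) * (Real.log X : ℂ))

open Classical in
/-- `Z_X(χ) = exp(-∑_ρ U((1/2 - ρ) log X))`, the sum being over the non-trivial zeros with
multiplicity. As `exp(-U(z)) ~ C z` for `z → 0`, the factor `exp(-U(0))` is read as `0`, so that
`Z_X(χ) = 0` if `1/2` is itself a zero. -/
def ZX (u : ℝ → ℝ) (X : ℝ) (χ : DirichletCharacter ℂ q) : ℂ :=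
  if (1 / 2 : ℂ) ∈ nontrivialZeros χ then 0
  else Complex.exp (-∑' ρ : nontrivialZeros χ, zeroTerm u X χ ρ)

/-- `P_X(χ) = exp(∑_{n ≤ X} Λ(n) χ(n) / (n^{1/2} log n))`; the term `n = 1`, where `Λ(1) = 0`, is
left out. -/
def PX (X : ℝ) (χ : DirichletCharacter ℂ q) : ℂ :=
  Complex.exp (∑ n ∈ Finset.Icc 2 ⌊X⌋₊,
    (ArithmeticFunction.vonMangoldt n : ℂ) * χ (n : ZMod q) /
      ((Real.sqrt n : ℂ) * (Real.log n : ℂ)))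

end DirichletCharacter

end

/-! The core is an exact product formula at every point near 1/2 where L does not vanish. It has a
smoothed finite prime sum on one side and U summed over all zeros, trivial ones included, on the
other. The error term comes only from passing to P_X and Z_X at s = 1/2.

Put a = log X, let F(t) be the mass of u to the left of e^t, and k(y) = F(y/a)/y. Integration by
parts makes U(la) the Laplace transform of k at l (`smoothedE1_mul_eq_integral`). For Re s > 1,
expand L'/L(s) - L'/L(s+w) once in partial fractions over the zeros ρ with multiplicities m_ρ, and
once as a Dirichlet series. Divided by w^2, the two expansions are the Laplace transforms in y of ∑
m_ρ (1 - e^{-(s-ρ)y})/(s-ρ)^2 and of -∑ Λ(n)χ(n) n^{-s} min(y, log n). Both series converge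
absolutely and uniformly, so by uniqueness of the Laplace transform they agree
(`tsum_one_sub_exp_eq_tsum_min`). Integration against k'' gives ∑ m_ρ U((s-ρ)a) = -∑ Λ(n)χ(n) n^{-s}
k(log n), without moving a contour. In log L = ∑ Λ(n)χ(n) n^{-s}/log n this leaves the coefficients
(1 - F(log n/a))/log n, which vanish for n ≥ X. Hence L is the exponential of a finite sum times
exp(-∑ m_ρ U).

The formula continues to a box containing 1/2 (`IsPrimitive.LFunction_eq_of_mem_centralBox`). Zeros
with |ρ| > 3 give a locally uniformly convergent sum, because U(z) is O(d^{-2}) with d the distance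
from 0 to the ray z + [0,∞). The finitely many others enter through e^{-U}, which extends to an
entire function with a simple zero at 0, so the cut plays no role.

At s = 1/2 this reads L = P_X Z_X exp(-δ - T). Here δ is the sum of the prime-power terms weighted
by F, which is supported on X - log X ≤ n ≤ X and so has size O(log X/√X). T is the sum over trivial
zeros, bounded by a geometric series. Bounds depending on q, χ or u serve only convergence and
continuation; those for δ and T are absolute. -/

open scoped ContDiff
open Complex Metric Set Filter Topology MeasureTheory

/-! ### Zeros of entire functions of order at most 3/2. -/

section EntireZeros

/-- An entire function factors through its zero at a point. -/
theorem Differentiable.exists_eq_pow_mul {n : ℕ} {f : ℂ → ℂ} {c : ℂ} (hf : Differentiable ℂ f)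
    (hn : analyticOrderAt f c = n) :
    ∃ g : ℂ → ℂ, Differentiable ℂ g ∧ g c ≠ 0 ∧ ∀ z, f z = (z - c) ^ n * g z := by
  induction n generalizing f with
  | zero =>
    refine ⟨f, hf, ?_, by simp⟩
    exact (hf.analyticAt c).analyticOrderAt_eq_zero.1 (by simpa using hn)
  | succ n ih =>
    have hfc : f c = 0 := by
      apply apply_eq_zero_of_analyticOrderAt_ne_zero
      rw [hn]; exact_mod_cast n.succ_ne_zero
    have hd : Differentiable ℂ (dslope f c) := by
      rw [← differentiableOn_univ]
      exact (Complex.differentiableOn_dslope univ_mem).2 hf.differentiableOn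
    have hmul : ∀ z, f z = (z - c) * dslope f c z := fun z => by
      have := sub_smul_dslope f c z
      simp only [smul_eq_mul, hfc, sub_zero] at this
      exact this.symm
    have hord : analyticOrderAt (dslope f c) c = n := by
      have h1 : analyticOrderAt f c = analyticOrderAt (fun z => z - c) c
          + analyticOrderAt (dslope f c) c := by
        rw [← analyticOrderAt_mul (by fun_prop) (hd.analyticAt c)]
        congr 1
        ext z; exact hmul z
      have h2 : analyticOrderAt (fun z : ℂ => z - c) c = 1 := by
        simp
      rw [hn, h2] at h1
      push_cast at h1
      rw [add_comm] at h1
      exact (ENat.add_left_injective_of_ne_top (n := 1) (by simp)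
        (by simpa [add_comm] using h1)).symm
    obtain ⟨g, hg, hgc, h⟩ := ih hd hord
    refine ⟨g, hg, hgc, fun z => ?_⟩
    rw [hmul, h]; ring

theorem Differentiable.analyticOrderAt_ne_top {f : ℂ → ℂ} (hf : Differentiable ℂ f) {w : ℂ}
    (hw : f w ≠ 0) (c : ℂ) : analyticOrderAt f c ≠ ⊤ := by
  have ha : AnalyticOnNhd ℂ f univ := fun z _ => hf.analyticAt z
  refine ha.analyticOrderAt_ne_top_of_isPreconnected isPreconnected_univ (mem_univ w)
    (mem_univ c) ?_
  rw [(hf.analyticAt w).analyticOrderAt_eq_zero.2 hw]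
  simp

/-- Dividing an entire function by the factors of finitely many of its zeros. -/
theorem Differentiable.exists_eq_prod_mul {f : ℂ → ℂ} (hf : Differentiable ℂ f) (h0 : f 0 ≠ 0)
    (S : Finset ℂ) (hS : ∀ ρ ∈ S, f ρ = 0) :
    ∃ g : ℂ → ℂ, Differentiable ℂ g ∧ (∀ ρ ∈ S, g ρ ≠ 0) ∧
      ∀ z, f z = (∏ ρ ∈ S, (1 - z / ρ) ^ analyticOrderNatAt f ρ) * g z := by
  classical
  induction S using Finset.induction_on with
  | empty => exact ⟨f, hf, by simp, by simp⟩
  | insert c S hc ih =>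
    obtain ⟨g, hg, hgS, h⟩ := ih fun ρ hρ => hS ρ (Finset.mem_insert_of_mem hρ)
    have hc0 : c ≠ 0 := by rintro rfl; exact h0 (hS 0 (Finset.mem_insert_self _ _))
    have hS0 : ∀ ρ ∈ S, ρ ≠ 0 := by
      rintro ρ hρ rfl; exact h0 (hS 0 (Finset.mem_insert_of_mem hρ))
    have hord : analyticOrderAt g c = analyticOrderNatAt f c := by
      rw [Nat.cast_analyticOrderNatAt (hf.analyticOrderAt_ne_top h0 c)]
      have hPd : Differentiable ℂ (fun z => ∏ ρ ∈ S, (1 - z / ρ) ^ analyticOrderNatAt f ρ) := by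
        fun_prop
      have h1 : analyticOrderAt f c =
          analyticOrderAt (fun z => ∏ ρ ∈ S, (1 - z / ρ) ^ analyticOrderNatAt f ρ) c
          + analyticOrderAt g c := by
        rw [← analyticOrderAt_mul (hPd.analyticAt c) (hg.analyticAt c)]
        congr 1
        ext z; exact h z
      -- The factors already removed do not vanish at `c`, so `g` inherits the whole order of `f`
      -- there.
      rw [h1, (hPd.analyticAt c).analyticOrderAt_eq_zero.2, zero_add]
      refine Finset.prod_ne_zero_iff.2 fun ρ hρ => pow_ne_zero _ ?_
      rw [sub_ne_zero, ne_eq, eq_comm, div_eq_one_iff_eq (hS0 ρ hρ)]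
      rintro rfl; exact hc hρ
    obtain ⟨k, hk, hkc, hgk⟩ := hg.exists_eq_pow_mul hord
    -- The power of `-c` passes from the factor z - c to 1 - z/c; with this normalisation the
    -- cofactor has the same value at 0 as `f`.
    refine ⟨fun z => (-c) ^ analyticOrderNatAt f c * k z, by fun_prop, ?_, fun z => ?_⟩
    · intro ρ hρ
      have hc' : (-c) ^ analyticOrderNatAt f c ≠ 0 := pow_ne_zero _ (neg_ne_zero.2 hc0)
      refine mul_ne_zero hc' ?_
      rcases Finset.mem_insert.1 hρ with rfl | hρ
      · exact hkc
      · have := hgS ρ hρ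
        rw [hgk] at this
        exact right_ne_zero_of_mul this
    · rw [Finset.prod_insert hc, h z, hgk z]
      have : (1 - z / c) ^ analyticOrderNatAt f c * (-c) ^ analyticOrderNatAt f c
          = (z - c) ^ analyticOrderNatAt f c := by
        rw [← mul_pow]; congr 1; field_simp; ring
      rw [← this]; ring

variable {f : ℂ → ℂ} {K : ℝ}

/-- Size of an entire function, after removal of its zeros in the closed ball of radius `R`, on the
ball of radius `4 R`. -/
theorem norm_mul_three_pow_le_of_eq_prod_mul (h0 : f 0 ≠ 0)
    (hK : ∀ R ≥ 1, ∀ z, ‖z‖ ≤ R → ‖f z‖ ≤ ‖f 0‖ * Real.exp (K * R ^ (3 / 2 : ℝ)))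
    {R : ℝ} (hR : 1 ≤ R) {S : Finset ℂ} (hS : ∀ ρ ∈ S, f ρ = 0 ∧ ‖ρ‖ ≤ R)
    {g : ℂ → ℂ} (hg : Differentiable ℂ g)
    (h : ∀ z, f z = (∏ ρ ∈ S, (1 - z / ρ) ^ analyticOrderNatAt f ρ) * g z)
    {z : ℂ} (hz : ‖z‖ ≤ 4 * R) :
    ‖g z‖ * 3 ^ (∑ ρ ∈ S, analyticOrderNatAt f ρ) ≤
      ‖f 0‖ * Real.exp (8 * K * R ^ (3 / 2 : ℝ)) := by
  have hR0 : 0 < R := by linarith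
  have key : ‖g z‖ ≤ ‖f 0‖ * Real.exp (8 * K * R ^ (3 / 2 : ℝ)) /
      3 ^ (∑ ρ ∈ S, analyticOrderNatAt f ρ) := by
    refine Complex.norm_le_of_forall_mem_frontier_norm_le (U := ball 0 (4 * R)) isBounded_ball
      hg.diffContOnCl (fun w hw => ?_) ?_
    · rw [frontier_ball _ (by positivity), mem_sphere_zero_iff_norm] at hw
      rw [le_div_iff₀ (by positivity)]
      have h1 := hK (4 * R) (by linarith) w hw.le
      have h2 : K * (4 * R) ^ (3 / 2 : ℝ) = 8 * K * R ^ (3 / 2 : ℝ) := by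
        rw [Real.mul_rpow (by norm_num) hR0.le]
        have : (4 : ℝ) ^ (3 / 2 : ℝ) = 8 := by
          rw [show (4 : ℝ) = 2 ^ (2 : ℝ) by norm_num, ← Real.rpow_mul (by norm_num)]
          norm_num
        rw [this]; ring
      rw [h2, h w, norm_mul] at h1
      refine le_trans ?_ h1
      rw [mul_comm]
      refine mul_le_mul_of_nonneg_right ?_ (norm_nonneg _)
      rw [norm_prod, ← Finset.prod_pow_eq_pow_sum]
      refine Finset.prod_le_prod (fun _ _ => by positivity) fun ρ hρ => ?_
      rw [norm_pow]
      refine pow_le_pow_left₀ (by norm_num) ?_ _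
      have hρ0 : 0 < ‖ρ‖ := by
        rw [norm_pos_iff]; rintro rfl; exact h0 (hS 0 hρ).1
      -- On |w| = 4R each factor with |ρ| ≤ R satisfies |1 - w/ρ| ≥ 3. The maximum principle carries
      -- the resulting bound for `g` inside.
      have h4 : 4 ≤ ‖w / ρ‖ := by
        rw [norm_div, hw, le_div_iff₀ hρ0]
        linarith [(hS ρ hρ).2]
      have := norm_sub_norm_le (w / ρ) 1
      rw [norm_one, norm_sub_rev] at this
      linarith
    · rw [closure_ball _ (by positivity)]
      simpa using hz
  rwa [le_div_iff₀ (by positivity)] at key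

/-- The number of zeros of an entire function of order at most `3 / 2` in a ball. -/
theorem sum_analyticOrderNatAt_le (hf : Differentiable ℂ f) (h0 : f 0 ≠ 0)
    (hK : ∀ R ≥ 1, ∀ z, ‖z‖ ≤ R → ‖f z‖ ≤ ‖f 0‖ * Real.exp (K * R ^ (3 / 2 : ℝ)))
    {R : ℝ} (hR : 1 ≤ R) {S : Finset ℂ} (hS : ∀ ρ ∈ S, f ρ = 0 ∧ ‖ρ‖ ≤ R) :
    ∑ ρ ∈ S, (analyticOrderNatAt f ρ : ℝ) ≤ 8 * K * R ^ (3 / 2 : ℝ) := by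
  obtain ⟨g, hg, -, h⟩ := hf.exists_eq_prod_mul h0 S fun ρ hρ => (hS ρ hρ).1
  have h1 := norm_mul_three_pow_le_of_eq_prod_mul h0 hK hR hS hg h (z := 0)
    (by simp; linarith)
  have h2 : g 0 = f 0 := by rw [h 0]; simp
  rw [h2, mul_le_mul_iff_right₀ (norm_pos_iff.2 h0)] at h1
  -- Since e < 3, replacing the base 3 by e gives the count without a logarithm.
  have h3 : Real.exp (∑ ρ ∈ S, (analyticOrderNatAt f ρ : ℝ)) ≤
      3 ^ (∑ ρ ∈ S, analyticOrderNatAt f ρ) := by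
    rw [← Nat.cast_sum, ← mul_one ((∑ ρ ∈ S, analyticOrderNatAt f ρ : ℕ) : ℝ), Real.exp_nat_mul]
    refine pow_le_pow_left₀ (Real.exp_pos _).le ?_ _
    linarith [Real.exp_one_lt_d9]
  exact Real.exp_le_exp.1 (h3.trans h1)

theorem one_le_analyticOrderNatAt (hf : Differentiable ℂ f) {w : ℂ} (hw : f w ≠ 0) {ρ : ℂ}
    (hρ : f ρ = 0) : 1 ≤ analyticOrderNatAt f ρ := by
  rw [Nat.one_le_iff_ne_zero]
  intro h
  have h1 := Nat.cast_analyticOrderNatAt (hf.analyticOrderAt_ne_top hw ρ)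
  rw [h] at h1
  exact (hf.analyticAt ρ).analyticOrderAt_eq_zero.1 (by simpa using h1.symm) hρ

/-- The least j with x ≤ 2^j alone suffices, because 2^{j-1} < x unless j = 0. This turns counts of
zeros in dyadic balls into a bound for the sum of inverse squares. -/
theorem inv_sq_le_tsum_dyadic (x : ℝ) (hx : 0 ≤ x) :
    1 / (1 + x) ^ 2 ≤ 4 * ∑' j : ℕ, (if x ≤ 2 ^ j then (1 / 4 : ℝ) ^ j else 0) := by
  have hex : ∃ j : ℕ, x ≤ 2 ^ j := by
    obtain ⟨j, hj⟩ := pow_unbounded_of_one_lt x (one_lt_two)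
    exact ⟨j, hj.le⟩
  classical
  have hsum : Summable fun j : ℕ => (if x ≤ 2 ^ j then (1 / 4 : ℝ) ^ j else 0) := by
    refine Summable.of_nonneg_of_le (fun j => by split_ifs <;> positivity) (fun j => ?_)
      (summable_geometric_of_lt_one (r := (1 / 4 : ℝ)) (by norm_num) (by norm_num))
    split_ifs
    · exact le_rfl
    · positivity
  set j := Nat.find hex with hj
  have hjx : x ≤ 2 ^ j := Nat.find_spec hex
  have h1 := hsum.le_tsum j fun i _ => by split_ifs <;> positivity
  rw [if_pos hjx] at h1
  refine le_trans ?_ (mul_le_mul_of_nonneg_left h1 (by norm_num))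
  rw [div_le_iff₀ (by positivity)]
  rcases Nat.eq_zero_or_pos j with h | h
  · rw [h]; nlinarith
  · have h2 : ¬ x ≤ 2 ^ (j - 1) := Nat.find_min hex (by omega)
    push Not at h2
    obtain ⟨i, hi⟩ : ∃ i, j = i + 1 := ⟨j - 1, by omega⟩
    rw [hi, Nat.add_sub_cancel] at h2
    rw [hi, pow_succ]
    have h3 : ((2 : ℝ) ^ i) ^ 2 ≤ (1 + x) ^ 2 :=
      pow_le_pow_left₀ (by positivity) (by linarith) 2
    have h4 : (1 / 4 : ℝ) ^ i * ((2 : ℝ) ^ i) ^ 2 = 1 := by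
      rw [← pow_mul, mul_comm i 2, pow_mul, ← mul_pow]; norm_num
    have := mul_le_mul_of_nonneg_left h3 (show (0 : ℝ) ≤ (1 / 4) ^ i by positivity)
    nlinarith

/-- The zeros of an entire function of order at most `3 / 2` satisfy `∑ 1 / (1 + |ρ|) ^ 2 < ∞`. -/
theorem summable_analyticOrderNatAt_div_sq (hf : Differentiable ℂ f) (h0 : f 0 ≠ 0)
    (hK : ∀ R ≥ 1, ∀ z, ‖z‖ ≤ R → ‖f z‖ ≤ ‖f 0‖ * Real.exp (K * R ^ (3 / 2 : ℝ))) :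
    Summable fun ρ : {z | f z = 0} => (analyticOrderNatAt f ρ : ℝ) * (1 / (1 + ‖(ρ : ℂ)‖) ^ 2) := by
  -- The weight 4^{-j} against the count O(2^{3j/2}) leaves the ratio 2^{-1/2}; any order below 2
  -- would give a convergent series.
  set r : ℝ := 2 ^ (-1 / 2 : ℝ) with hr
  have hr0 : 0 ≤ r := by positivity
  have hr1 : r < 1 := Real.rpow_lt_one_of_one_lt_of_neg (by norm_num) (by norm_num)
  have hpow : ∀ j : ℕ, (1 / 4 : ℝ) ^ j * ((2 : ℝ) ^ j) ^ (3 / 2 : ℝ) = r ^ j := fun j => by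
    rw [← Real.rpow_natCast 2 j, ← Real.rpow_mul (by norm_num), mul_comm (j : ℝ),
      Real.rpow_mul (by norm_num), Real.rpow_natCast, ← mul_pow]
    congr 1
    rw [hr, show (1 / 4 : ℝ) = 2 ^ (-2 : ℝ) by
      rw [Real.rpow_neg (by norm_num)]; norm_num, ← Real.rpow_add (by norm_num)]
    norm_num
  refine summable_of_sum_le (c := 4 * (8 * K * (1 - r)⁻¹)) (fun ρ => by positivity) fun S => ?_
  have hsum : ∀ x : ℝ, Summable fun j : ℕ => (if x ≤ 2 ^ j then (1 / 4 : ℝ) ^ j else 0) := fun x =>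
    Summable.of_nonneg_of_le (fun j => by split_ifs <;> positivity)
      (fun j => by split_ifs; exacts [le_rfl, by positivity])
      (summable_geometric_of_lt_one (r := (1 / 4 : ℝ)) (by norm_num) (by norm_num))
  calc ∑ ρ ∈ S, (analyticOrderNatAt f ρ : ℝ) * (1 / (1 + ‖(ρ : ℂ)‖) ^ 2)
      ≤ ∑ ρ ∈ S, (analyticOrderNatAt f ρ : ℝ) *
          (4 * ∑' j : ℕ, (if ‖(ρ : ℂ)‖ ≤ 2 ^ j then (1 / 4 : ℝ) ^ j else 0)) := by
        gcongr with ρ hρ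
        exact inv_sq_le_tsum_dyadic _ (norm_nonneg _)
    _ = 4 * ∑' j : ℕ, ∑ ρ ∈ S, (analyticOrderNatAt f ρ : ℝ) *
          (if ‖(ρ : ℂ)‖ ≤ 2 ^ j then (1 / 4 : ℝ) ^ j else 0) := by
        rw [Summable.tsum_finsetSum fun ρ _ => (hsum _).mul_left _, Finset.mul_sum]
        refine Finset.sum_congr rfl fun ρ _ => ?_
        rw [tsum_mul_left]; ring
    _ ≤ 4 * ∑' j : ℕ, 8 * K * r ^ j := by
        gcongr with j
        · exact summable_sum fun ρ _ => (hsum _).mul_left _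
        · exact (summable_geometric_of_lt_one hr0 hr1).mul_left _
        · have hle := sum_analyticOrderNatAt_le hf h0 hK (R := 2 ^ j)
            (one_le_pow₀ (by norm_num))
            (S := (S.filter fun ρ : {z | f z = 0} => ‖(ρ : ℂ)‖ ≤ 2 ^ j).map
              ⟨Subtype.val, Subtype.val_injective⟩)
            (by simp; exact fun ρ h _ h' => ⟨h, h'⟩)
          rw [Finset.sum_map, Finset.sum_filter] at hle
          have := mul_le_mul_of_nonneg_right hle (show (0 : ℝ) ≤ (1 / 4) ^ j by positivity)
          rw [mul_assoc (8 * K), mul_comm _ ((1 / 4 : ℝ) ^ j), mul_comm _ ((1 / 4 : ℝ) ^ j),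
            hpow] at this
          refine le_trans (le_of_eq ?_) this
          rw [Finset.mul_sum]
          refine Finset.sum_congr rfl fun ρ _ => ?_
          simp only [Function.Embedding.coeFn_mk]
          split_ifs <;> ring
    _ = _ := by rw [tsum_mul_left, tsum_geometric_of_lt_one hr0 hr1]

end EntireZeros

/-! ### Partial fractions of the logarithmic derivative. -/

section LogDeriv

/-- The logarithmic derivative of a zero-free function varies little if the function is not
large. -/
theorem norm_logDeriv_sub_logDeriv_le {g : ℂ → ℂ} {R M : ℝ} (hR : 0 < R) (hM : 0 < M)
    (hg : Differentiable ℂ g) (hne : ∀ z ∈ ball (0 : ℂ) R, g z ≠ 0)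
    (hle : ∀ z ∈ ball (0 : ℂ) R, ‖g z‖ ≤ ‖g 0‖ * Real.exp M) {z w : ℂ}
    (hz : z ∈ ball (0 : ℂ) (R / 8)) (hw : w ∈ ball (0 : ℂ) (R / 8)) :
    ‖logDeriv g z - logDeriv g w‖ ≤ 64 * M / R ^ 2 * ‖z - w‖ := by
  have hld : DifferentiableOn ℂ (logDeriv g) (ball 0 R) := fun z hz =>
    ((hg.deriv z).div (hg z) (hne z hz)).differentiableWithinAt
  -- `h` is the branch of log(g/g(0)) vanishing at 0: the product g e^{-h} has zero derivative.
  obtain ⟨h, h0, hh⟩ := hld.isExactOn_ball.with_val_at 0 0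
  have h0mem : (0 : ℂ) ∈ ball (0 : ℂ) R := by simpa using hR
  have hhd : DifferentiableOn ℂ h (ball 0 R) := fun z hz =>
    (hh z hz).differentiableAt.differentiableWithinAt
  have hconst : ∀ z ∈ ball (0 : ℂ) R, g z * Complex.exp (-h z) = g 0 := by
    intro z hz
    have hder : ∀ x ∈ ball (0 : ℂ) R, HasDerivAt (fun z => g z * Complex.exp (-h z)) 0 x := by
      intro x hx
      have := (hg x).hasDerivAt.mul ((hh x hx).neg.cexp)
      convert! this using 1
      rw [logDeriv_apply]
      field_simp [hne x hx]
      ring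
    have := isOpen_ball.is_const_of_deriv_eq_zero (convex_ball (0 : ℂ) R).isPreconnected
      (fun x hx => (hder x hx).differentiableAt.differentiableWithinAt)
      (fun x hx => (hder x hx).deriv) hz h0mem
    simpa [h0] using this
  have hre : MapsTo h (ball 0 R) {z | z.re ≤ M} := by
    intro z hz
    have h1 : g z = g 0 * Complex.exp (h z) := by
      rw [← hconst z hz, mul_assoc, ← Complex.exp_add]; simp
    have h2 := hle z hz
    rw [h1, norm_mul, mul_le_mul_iff_right₀ (norm_pos_iff.2 (hne 0 h0mem)), Complex.norm_exp] at h2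
    exact Real.exp_le_exp.1 h2
  -- Borel–Carathéodory turns the upper bound on Re h into a bound on |h|. Cauchy's estimate, with
  -- radii R/4 and then R/8, bounds h' and h''.
  have hbd : ∀ z, ‖z‖ ≤ R / 2 → ‖h z‖ ≤ 2 * M := by
    intro z hz
    have := borelCaratheodory_zero hM hhd hre hR (z := z) (by simp; linarith) h0
    refine this.trans ?_
    rw [div_le_iff₀ (by linarith)]
    nlinarith
  have hder1 : ∀ z, ‖z‖ ≤ R / 4 → ‖logDeriv g z‖ ≤ 8 * M / R := by
    intro z hz
    have hsub : closedBall z (R / 4) ⊆ ball 0 R := by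
      intro x hx
      rw [mem_closedBall, dist_eq_norm] at hx
      have := norm_le_norm_add_norm_sub' x z
      simp only [mem_ball, dist_zero_right]; linarith
    have := Complex.norm_deriv_le_of_forall_mem_sphere_norm_le (c := z) (R := R / 4) (C := 2 * M)
      (by positivity) (hhd.diffContOnCl_ball hsub) (fun x hx => by
        rw [mem_sphere, dist_eq_norm] at hx
        have := norm_le_norm_add_norm_sub' x z
        exact hbd x (by linarith))
    rw [(hh z (hsub (mem_closedBall_self (by positivity)))).deriv] at this
    refine this.trans (le_of_eq ?_)
    field_simp; norm_num
  have hder2 : ∀ z ∈ ball (0 : ℂ) (R / 8), ‖deriv (logDeriv g) z‖ ≤ 64 * M / R ^ 2 := by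
    intro z hz
    rw [mem_ball_zero_iff] at hz
    have hsub : closedBall z (R / 8) ⊆ ball 0 R := by
      intro x hx
      rw [mem_closedBall, dist_eq_norm] at hx
      have := norm_le_norm_add_norm_sub' x z
      simp only [mem_ball, dist_zero_right]; linarith
    have := Complex.norm_deriv_le_of_forall_mem_sphere_norm_le (c := z) (R := R / 8)
      (C := 8 * M / R) (by positivity) (hld.diffContOnCl_ball hsub) (fun x hx => by
        rw [mem_sphere, dist_eq_norm] at hx
        have := norm_le_norm_add_norm_sub' x z
        exact hder1 x (by linarith))
    refine this.trans (le_of_eq ?_)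
    field_simp; norm_num
  refine Convex.norm_image_sub_le_of_norm_deriv_le (fun x hx => ?_) hder2 (convex_ball _ _) hw hz
  have hx' : x ∈ ball (0 : ℂ) R := ball_subset_ball (by linarith) hx
  exact (hld x hx').differentiableAt (isOpen_ball.mem_nhds hx')

variable {f : ℂ → ℂ} {K : ℝ}

/-- A point off the zero set is far from the zeros, relative to their size. -/
theorem exists_one_add_norm_le_mul_norm_sub (hf : Differentiable ℂ f) {z : ℂ} (hz : f z ≠ 0) :
    ∃ C > 0, ∀ ρ, f ρ = 0 → 1 + ‖ρ‖ ≤ C * ‖z - ρ‖ := by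
  obtain ⟨δ, hδ, h⟩ := Metric.eventually_nhds_iff.1
    (hf.continuous.continuousAt.eventually_ne hz)
  refine ⟨(1 + ‖z‖) / δ + 1, by positivity, fun ρ hρ => ?_⟩
  have h1 : δ ≤ ‖z - ρ‖ := by
    by_contra! hlt
    exact h (by rwa [dist_comm, dist_eq_norm]) hρ
  have h2 := norm_le_norm_add_norm_sub z ρ
  have h3 : 1 + ‖z‖ ≤ (1 + ‖z‖) / δ * ‖z - ρ‖ := by
    rw [div_mul_eq_mul_div, le_div_iff₀ hδ]
    gcongr
  linarith

/-- A zero in the ball contributes at least 1/(1+R)^2 to a convergent sum. -/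
theorem finite_zeros_norm_le (hf : Differentiable ℂ f) (h0 : f 0 ≠ 0)
    (hK : ∀ R ≥ 1, ∀ z, ‖z‖ ≤ R → ‖f z‖ ≤ ‖f 0‖ * Real.exp (K * R ^ (3 / 2 : ℝ))) {R : ℝ} :
    {ρ : {z | f z = 0} | ‖(ρ : ℂ)‖ ≤ R}.Finite := by
  by_cases hR : 0 ≤ R
  · have h1 := (summable_analyticOrderNatAt_div_sq hf h0 hK).tendsto_cofinite_zero
    have h2 := h1.eventually_lt_const (show (0 : ℝ) < 1 / (1 + R) ^ 2 by positivity)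
    rw [eventually_cofinite] at h2
    refine h2.subset fun ρ hρ => ?_
    have hm : (1 : ℝ) ≤ analyticOrderNatAt f ρ := by
      exact_mod_cast one_le_analyticOrderNatAt hf h0 ρ.2
    have hρ' : ‖(ρ : ℂ)‖ ≤ R := hρ
    simp only [mem_ofPred_eq, not_lt]
    calc 1 / (1 + R) ^ 2 ≤ 1 / (1 + ‖(ρ : ℂ)‖) ^ 2 := by gcongr
      _ ≤ _ := le_mul_of_one_le_left (by positivity) hm
  · convert! Set.finite_empty
    ext ρ
    simp only [mem_ofPred_eq, mem_empty_iff_false, iff_false, not_le]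
    linarith [norm_nonneg (ρ : ℂ)]

/-- The partial fraction expansion of the logarithmic derivative of an entire function of order at
most `3 / 2`. -/
theorem hasSum_logDeriv_sub_logDeriv (hf : Differentiable ℂ f) (h0 : f 0 ≠ 0)
    (hK : ∀ R ≥ 1, ∀ z, ‖z‖ ≤ R → ‖f z‖ ≤ ‖f 0‖ * Real.exp (K * R ^ (3 / 2 : ℝ)))
    {z w : ℂ} (hz : f z ≠ 0) (hw : f w ≠ 0) :
    HasSum (fun ρ : {z | f z = 0} => (analyticOrderNatAt f ρ : ℂ) * (1 / (z - ρ) - 1 / (w - ρ)))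
      (logDeriv f z - logDeriv f w) := by
  have hKpos : 0 ≤ K := by
    have := hK 1 le_rfl 0 (by simp)
    rw [Real.one_rpow, mul_one] at this
    have h1 : 1 ≤ Real.exp K := by
      by_contra! hlt
      nlinarith [norm_pos_iff.2 h0]
    exact Real.one_le_exp_iff.1 h1
  obtain ⟨C, hC, hCz⟩ := exists_one_add_norm_le_mul_norm_sub hf hz
  obtain ⟨D, hD, hDw⟩ := exists_one_add_norm_le_mul_norm_sub hf hw
  have hsub : ∀ {z : ℂ}, f z ≠ 0 → ∀ ρ : {z | f z = 0}, z - ρ ≠ 0 := fun hz ρ h => hz (by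
    rw [sub_eq_zero.1 h]; exact ρ.2)
  have hsum : Summable fun ρ : {z | f z = 0} =>
      (analyticOrderNatAt f ρ : ℂ) * (1 / (z - ρ) - 1 / (w - ρ)) := by
    refine Summable.of_norm_bounded
      ((summable_analyticOrderNatAt_div_sq hf h0 hK).mul_left (‖w - z‖ * (C * D))) fun ρ => ?_
    -- Taking the difference at two points gains a factor 1/|ρ|, which is what makes the sum over
    -- zeros absolutely convergent.
    have e : 1 / (z - ρ) - 1 / (w - ρ) = (w - z) / ((z - ρ) * (w - ρ)) := by
      field_simp [hsub hz ρ, hsub hw ρ]; ring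
    have hz' : 0 < ‖z - ρ‖ := norm_pos_iff.2 (hsub hz ρ)
    have hw' : 0 < ‖w - ρ‖ := norm_pos_iff.2 (hsub hw ρ)
    rw [e, norm_mul, norm_div, norm_mul, Complex.norm_natCast, mul_left_comm]
    refine mul_le_mul_of_nonneg_left ?_ (by positivity)
    rw [mul_one_div, mul_div_assoc]
    rw [div_eq_mul_one_div]
    refine mul_le_mul_of_nonneg_left ?_ (by positivity)
    rw [div_le_div_iff₀ (by positivity) (by positivity), one_mul]
    calc (1 + ‖(ρ : ℂ)‖) ^ 2 = (1 + ‖(ρ : ℂ)‖) * (1 + ‖(ρ : ℂ)‖) := by ring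
      _ ≤ (C * ‖z - ρ‖) * (D * ‖w - ρ‖) :=
        mul_le_mul (hCz ρ ρ.2) (hDw ρ ρ.2) (by positivity) (by positivity)
      _ = _ := by ring
  have hfin : ∀ n : ℕ, {ρ : {z | f z = 0} | ‖(ρ : ℂ)‖ ≤ n}.Finite := fun n =>
    finite_zeros_norm_le hf h0 hK
  have htop : Tendsto (fun n : ℕ => (hfin n).toFinset) atTop atTop := by
    refine tendsto_atTop_finset_of_monotone ?_ ?_
    · intro m n hmn
      simp only [Finite.toFinset_subset_toFinset, ofPred_subset_ofPred]
      exact fun ρ hρ => hρ.trans (by exact_mod_cast hmn)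
    · intro ρ
      obtain ⟨n, hn⟩ := exists_nat_ge ‖(ρ : ℂ)‖
      exact ⟨n, by simpa using hn⟩
  have hlim := hsum.hasSum.comp htop
  suffices h : Tendsto ((fun s : Finset {z | f z = 0} => ∑ ρ ∈ s, (analyticOrderNatAt f ρ : ℂ) *
      (1 / (z - ρ) - 1 / (w - ρ))) ∘ fun n : ℕ => (hfin n).toFinset) atTop
      (𝓝 (logDeriv f z - logDeriv f w)) by
    rw [tendsto_nhds_unique h hlim]; exact hsum.hasSum
  rw [tendsto_iff_norm_sub_tendsto_zero]
  have hbound : Tendsto (fun n : ℕ => 64 * (8 * (K + 1)) * ‖z - w‖ * (n : ℝ) ^ (-(1 / 2) : ℝ))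
      atTop (𝓝 0) := by
    have := (tendsto_rpow_neg_atTop (show (0 : ℝ) < 1 / 2 by norm_num)).comp
      (tendsto_natCast_atTop_atTop (R := ℝ))
    simpa using this.const_mul (64 * (8 * (K + 1)) * ‖z - w‖)
  refine squeeze_zero' (Eventually.of_forall fun n => norm_nonneg _) ?_ hbound
  -- Beyond `N`, both points lie in the ball of radius n/8 where the variation of the logarithmic
  -- derivative is controlled.
  obtain ⟨N, hN⟩ := exists_nat_gt (8 * (‖z‖ + ‖w‖) + 1)
  filter_upwards [eventually_ge_atTop N] with n hn
  have hnN : (N : ℝ) ≤ n := by exact_mod_cast hn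
  have hn1 : (1 : ℝ) ≤ n := by linarith [norm_nonneg z, norm_nonneg w]
  set S : Finset ℂ := (hfin n).toFinset.map ⟨Subtype.val, Subtype.val_injective⟩ with hSdef
  have hSmem : ∀ ρ, ρ ∈ S ↔ f ρ = 0 ∧ ‖ρ‖ ≤ n := by
    intro ρ
    rw [hSdef, Finset.mem_map]
    constructor
    · rintro ⟨⟨x, hx⟩, h, rfl⟩
      exact ⟨hx, (hfin n).mem_toFinset.1 h⟩
    · exact fun h => ⟨⟨ρ, h.1⟩, (hfin n).mem_toFinset.2 h.2, rfl⟩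
  obtain ⟨g, hg, hgS, hfg⟩ := hf.exists_eq_prod_mul h0 S fun ρ hρ => ((hSmem ρ).1 hρ).1
  have hg0 : g 0 = f 0 := by rw [hfg 0]; simp
  have hS0 : ∀ ρ ∈ S, ρ ≠ 0 := by rintro ρ hρ rfl; exact h0 ((hSmem 0).1 hρ).1
  have hgne : ∀ x ∈ ball (0 : ℂ) n, g x ≠ 0 := by
    intro x hx
    by_cases hx' : f x = 0
    · exact hgS x ((hSmem x).2 ⟨hx', by simpa using (mem_ball_zero_iff.1 hx).le⟩)
    · rw [hfg x] at hx'; exact right_ne_zero_of_mul hx'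
  -- K + 1 in place of K keeps the exponent strictly positive. The variation of the logarithmic
  -- derivative of `g` is then O(n^{3/2}/n^2), which tends to 0.
  have hgle : ∀ x ∈ ball (0 : ℂ) n, ‖g x‖ ≤ ‖g 0‖ *
      Real.exp (8 * (K + 1) * (n : ℝ) ^ (3 / 2 : ℝ)) := by
    intro x hx
    have h1 := norm_mul_three_pow_le_of_eq_prod_mul h0 hK hn1 (fun ρ hρ => (hSmem ρ).1 hρ) hg hfg
      (z := x) (by linarith [(mem_ball_zero_iff.1 hx)])
    rw [hg0]
    refine (le_mul_of_one_le_right (norm_nonneg _) (one_le_pow₀ (by norm_num))).trans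
      (h1.trans ?_)
    gcongr
    linarith
  have hkey := norm_logDeriv_sub_logDeriv_le (R := n) (M := 8 * (K + 1) * (n : ℝ) ^ (3 / 2 : ℝ))
    (z := z) (w := w) (by linarith) (by positivity) hg hgne hgle
    (by rw [mem_ball_zero_iff]; linarith [norm_nonneg w])
    (by rw [mem_ball_zero_iff]; linarith [norm_nonneg z])
  have hfld : ∀ x, f x ≠ 0 → logDeriv f x =
      ∑ ρ ∈ S, (analyticOrderNatAt f ρ : ℂ) * (1 / (x - ρ)) + logDeriv g x := by
    intro x hx
    have hxf := hx
    rw [hfg x] at hx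
    have hP := left_ne_zero_of_mul hx
    have e : f = fun z => (∏ ρ ∈ S, (1 - z / ρ) ^ analyticOrderNatAt f ρ) * g z := funext hfg
    have hxS : ∀ ρ ∈ S, x - ρ ≠ 0 := fun ρ hρ h => hxf (by
      rw [sub_eq_zero.1 h]; exact ((hSmem ρ).1 hρ).1)
    have hfac : ∀ ρ ∈ S, 1 - x / ρ ≠ 0 := fun ρ hρ => by
      have : 1 - x / ρ = -(x - ρ) / ρ := by field_simp [hS0 ρ hρ]; ring
      rw [this]; exact div_ne_zero (neg_ne_zero.2 (hxS ρ hρ)) (hS0 ρ hρ)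
    calc logDeriv f x
        = logDeriv (fun z => (∏ ρ ∈ S, (1 - z / ρ) ^ analyticOrderNatAt f ρ) * g z) x :=
          congrArg (fun F => logDeriv F x) e
      _ = logDeriv (fun z => ∏ ρ ∈ S, (1 - z / ρ) ^ analyticOrderNatAt f ρ) x
          + logDeriv g x := logDeriv_mul x hP (right_ne_zero_of_mul hx) (by fun_prop) (hg x)
      _ = _ := by
        congr 1
        have := logDeriv_prod (s := S) (f := fun ρ z => (1 - z / ρ) ^ analyticOrderNatAt f ρ)
          (x := x) (fun ρ hρ => pow_ne_zero _ (hfac ρ hρ)) (fun ρ hρ => by fun_prop)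
        refine Eq.trans ?_ (this.trans (Finset.sum_congr rfl fun ρ hρ => ?_))
        · rfl
        · rw [logDeriv_fun_pow (by fun_prop), logDeriv_apply]
          congr 1
          have hd : deriv (fun z : ℂ => 1 - z / ρ) x = -(1 / ρ) := by
            simp
          rw [hd]
          have h1 := hS0 ρ hρ
          have h2 := hxS ρ hρ
          have h3 := hfac ρ hρ
          rw [div_eq_div_iff h3 h2]
          field_simp
          ring
  have hsumS : ∑ ρ ∈ (hfin n).toFinset, (analyticOrderNatAt f ρ : ℂ) *
      (1 / (z - ρ) - 1 / (w - ρ)) = ∑ ρ ∈ S, (analyticOrderNatAt f ρ : ℂ) * (1 / (z - ρ)) -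
      ∑ ρ ∈ S, (analyticOrderNatAt f ρ : ℂ) * (1 / (w - ρ)) := by
    rw [hSdef, Finset.sum_map, Finset.sum_map, ← Finset.sum_sub_distrib]
    refine Finset.sum_congr rfl fun ρ _ => ?_
    simp only [Function.Embedding.coeFn_mk]
    ring
  rw [Function.comp_apply, hsumS, hfld z hz, hfld w hw]
  rw [norm_sub_rev]
  refine le_trans (le_of_eq ?_) (hkey.trans (le_of_eq ?_))
  · congr 1; ring
  · have : (n : ℝ) ^ (-(1 / 2) : ℝ) = (n : ℝ) ^ (3 / 2 : ℝ) / (n : ℝ) ^ 2 := by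
      rw [← Real.rpow_natCast, ← Real.rpow_sub (by linarith)]
      norm_num
    rw [this]; ring

end LogDeriv

/-! ### Growth of L(s, χ): Abel summation to the right, the functional equation to the left. -/

namespace DirichletCharacter

variable {q : ℕ} {χ : DirichletCharacter ℂ q}

/-- The summatory function of `χ`, cut off below `1`. -/
noncomputable def summatory (χ : DirichletCharacter ℂ q) (t : ℝ) : ℂ :=
  (Ioi (1 : ℝ)).indicator (fun t => ∑ k ∈ Finset.Icc 1 ⌊t⌋₊, χ (k : ZMod q)) t

theorem measurable_summatory (χ : DirichletCharacter ℂ q) : Measurable χ.summatory := by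
  refine Measurable.indicator ?_ measurableSet_Ioi
  exact (measurable_from_top (f := fun n : ℕ => ∑ k ∈ Finset.Icc 1 n, χ (k : ZMod q))).comp
    Nat.measurable_floor

/-- Writing the integral of Abel summation as a Mellin transform makes its holomorphy in s an
instance of the general theory. -/
theorem mellin_summatory (s : ℂ) : mellin χ.summatory (-s) =
    ∫ t in Ioi (1 : ℝ), (∑ k ∈ Finset.Icc 1 ⌊t⌋₊, χ (k : ZMod q)) * (t : ℂ) ^ (-(s + 1)) := by
  have : ∀ t : ℝ, (t : ℂ) ^ (-s - 1) • χ.summatory t = (Ioi (1 : ℝ)).indicator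
      (fun t : ℝ => (∑ k ∈ Finset.Icc 1 ⌊t⌋₊, χ (k : ZMod q)) * (t : ℂ) ^ (-(s + 1))) t := by
    intro t
    unfold summatory
    by_cases h : t ∈ Ioi (1 : ℝ)
    · rw [indicator_of_mem h, indicator_of_mem h, smul_eq_mul, mul_comm, neg_add']
    · rw [indicator_of_notMem h, indicator_of_notMem h, smul_zero]
  simp only [mellin, this]
  rw [setIntegral_indicator measurableSet_Ioi]
  congr 2
  ext t
  simp only [mem_inter_iff, mem_Ioi]
  exact ⟨fun h => h.2, fun h => ⟨by linarith, h⟩⟩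

variable [NeZero q]

theorem IsPrimitive.ne_one (hχ : χ.IsPrimitive) (hq : 1 < q) : χ ≠ 1 := by
  rintro rfl
  rw [IsPrimitive, conductor_one] at hχ
  omega

theorem sum_range_eq_zero (hχ : χ ≠ 1) : ∑ k ∈ Finset.range q, χ (k : ZMod q) = 0 := by
  rw [← χ.sum_eq_zero_of_ne_one hχ]
  obtain ⟨n, rfl⟩ := Nat.exists_eq_succ_of_ne_zero (NeZero.ne q)
  rw [Finset.sum_range]
  refine Fintype.sum_congr _ _ fun i => ?_
  congr 1
  exact Fin.cast_val_eq_self i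

/-- A full period sums to zero, so only an incomplete period of fewer than q terms remains. -/
theorem norm_sum_range_le (hχ : χ ≠ 1) (n : ℕ) :
    ‖∑ k ∈ Finset.range n, χ (k : ZMod q)‖ ≤ q := by
  have hper : Function.Periodic (fun n : ℕ => ∑ k ∈ Finset.range n, χ (k : ZMod q)) q := by
    intro n
    beta_reduce
    rw [add_comm, Finset.sum_range_add, sum_range_eq_zero hχ, zero_add]
    simp
  have h : ∑ k ∈ Finset.range (n % q), χ (k : ZMod q) = ∑ k ∈ Finset.range n, χ (k : ZMod q) :=
    hper.map_mod_nat n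
  rw [← h]
  refine (norm_sum_le _ _).trans ?_
  calc ∑ k ∈ Finset.range (n % q), ‖χ (k : ZMod q)‖ ≤ ∑ k ∈ Finset.range (n % q), (1 : ℝ) :=
        Finset.sum_le_sum fun k _ => χ.norm_le_one _
    _ = ((n % q : ℕ) : ℝ) := by simp
    _ ≤ q := by exact_mod_cast (Nat.mod_lt _ (NeZero.pos q)).le

theorem norm_sum_Icc_le (hχ : χ ≠ 1) (n : ℕ) :
    ‖∑ k ∈ Finset.Icc 1 n, χ (k : ZMod q)‖ ≤ q := by
  have hq : q ≠ 1 := by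
    rintro rfl
    exact hχ (Subsingleton.elim _ _)
  have : ∑ k ∈ Finset.Icc 1 n, χ (k : ZMod q) = ∑ k ∈ Finset.range (n + 1), χ (k : ZMod q) := by
    -- The extra index 0 is harmless because χ(0) = 0 for modulus other than 1.
    rw [Finset.range_eq_Ico, Finset.sum_eq_sum_Ico_succ_bot (by omega)]
    simp only [Nat.cast_zero, χ.map_zero' hq, zero_add]
    rfl
  rw [this]
  exact norm_sum_range_le hχ _

theorem norm_summatory_le (hχ : χ ≠ 1) (t : ℝ) : ‖χ.summatory t‖ ≤ q := by
  unfold summatory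
  by_cases h : t ∈ Ioi (1 : ℝ)
  · rw [indicator_of_mem h]; exact norm_sum_Icc_le hχ _
  · rw [indicator_of_notMem h]; simp

theorem differentiableAt_mellin_summatory (hχ : χ ≠ 1) {s : ℂ} (hs : s.re < 0) :
    DifferentiableAt ℂ (mellin χ.summatory) s := by
  have hint : LocallyIntegrable χ.summatory := by
    intro x
    refine ⟨Icc (x - 1) (x + 1), Icc_mem_nhds (by linarith) (by linarith), ?_⟩
    exact Measure.integrableOn_of_bounded (M := q) (by simp)
      χ.measurable_summatory.aestronglyMeasurable
      (Eventually.of_forall fun t => norm_summatory_le hχ t)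
  refine mellin_differentiableAt_of_isBigO_rpow (a := 0) (b := s.re - 1)
    (hint.locallyIntegrableOn _) ?_ hs ?_ (by linarith)
  · refine Asymptotics.IsBigO.of_bound q (Eventually.of_forall fun t => ?_)
    simpa using norm_summatory_le hχ t
  · refine Asymptotics.IsBigO.of_bound 0 ?_
    filter_upwards [Ioo_mem_nhdsGT (show (0 : ℝ) < 1 by norm_num)] with t ht
    rw [summatory, indicator_of_notMem (by simpa using ht.2.le)]
    simp

/-- The integral representation of `L(s, χ)` in the half-plane `Re s > 0`. -/
theorem LFunction_eq_mul_mellin (hχ : χ ≠ 1) {s : ℂ} (hs : 0 < s.re) :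
    LFunction χ s = s * mellin χ.summatory (-s) := by
  have hopen : IsOpen {s : ℂ | 0 < s.re} := isOpen_lt continuous_const continuous_re
  have hconv : Convex ℝ {s : ℂ | 0 < s.re} := convex_halfSpace_re_gt 0
  have h1 : AnalyticOnNhd ℂ (LFunction χ) {s : ℂ | 0 < s.re} := fun z _ =>
    (differentiable_LFunction hχ).analyticAt z
  have h2 : AnalyticOnNhd ℂ (fun s => s * mellin χ.summatory (-s)) {s : ℂ | 0 < s.re} := by
    refine DifferentiableOn.analyticOnNhd (fun z hz => ?_) hopen
    refine (differentiableAt_id.mul ?_).differentiableWithinAt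
    have hz' : (-z).re < 0 := by simpa using hz
    exact (differentiableAt_mellin_summatory hχ hz').comp z (differentiable_neg z)
  refine h1.eqOn_of_preconnected_of_eventuallyEq h2 hconv.isPreconnected
    (z₀ := 2) (by simp) ?_ hs
  have hnhds : {s : ℂ | 1 < s.re} ∈ 𝓝 (2 : ℂ) :=
    (isOpen_lt continuous_const continuous_re).mem_nhds (by simp)
  filter_upwards [hnhds] with z hz
  have hz : 1 < z.re := hz
  rw [LFunction_eq_LSeries χ hz, mellin_summatory]
  refine LSeries_eq_mul_integral _ le_rfl (by linarith) (χ.LSeriesSummable_of_one_lt_re hz) ?_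
  refine Asymptotics.IsBigO.of_bound q (Eventually.of_forall fun n => ?_)
  simpa using norm_sum_Icc_le hχ n

theorem norm_LFunction_le_of_half_le_re (hχ : χ ≠ 1) {s : ℂ} (hs : 1 / 2 ≤ s.re) :
    ‖LFunction χ s‖ ≤ 2 * q * ‖s‖ := by
  have hs0 : 0 < s.re := by linarith
  rw [LFunction_eq_mul_mellin hχ hs0, norm_mul, mul_comm]
  refine mul_le_mul_of_nonneg_right ?_ (norm_nonneg _)
  rw [mellin_summatory]
  have hint : IntegrableOn (fun t : ℝ => (q : ℝ) * t ^ (-(s.re + 1))) (Ioi 1) :=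
    (integrableOn_Ioi_rpow_of_lt (by linarith) one_pos).const_mul _
  refine (norm_integral_le_of_norm_le hint ?_).trans ?_
  · filter_upwards [ae_restrict_mem measurableSet_Ioi] with t ht
    have ht0 : 0 < t := by linarith [mem_Ioi.1 ht]
    rw [norm_mul, norm_cpow_eq_rpow_re_of_pos ht0]
    simp only [neg_re, add_re, one_re]
    gcongr
    exact norm_sum_Icc_le hχ _
  · rw [integral_const_mul, integral_Ioi_rpow_of_lt (by linarith) one_pos, Real.one_rpow]
    have h : -(1 : ℝ) / (-(s.re + 1) + 1) = 1 / s.re := by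
      rw [show -(s.re + 1) + 1 = -s.re by ring, neg_div_neg_eq]
    rw [h, mul_comm 2 (q : ℝ)]
    gcongr
    rw [div_le_iff₀ hs0]; linarith

/-- The functional equation of the `L`-function of a primitive character, in asymmetric form. -/
theorem IsPrimitive.LFunction_one_sub (hχ : χ.IsPrimitive) (hq : 1 < q) {s : ℂ} (hs : 0 < s.re) :
    LFunction χ (1 - s) = (q : ℂ) ^ (s - 1) * (2 * Real.pi : ℂ) ^ (-s) * Complex.Gamma s *
      gaussSum χ ZMod.stdAddChar *
      (χ (-1) * Complex.exp (Real.pi * I * s / 2) + Complex.exp (-Real.pi * I * s / 2)) *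
      LFunction χ⁻¹ s := by
  have hχ0 : χ 0 = 0 := χ.map_zero' (by omega)
  have hinv : χ⁻¹ (-1) = χ (-1) := by
    rcases χ.even_or_odd with h | h
    · have h : χ (-1) = 1 := h
      rw [MulChar.inv_apply_eq_inv', h, inv_one]
    · have h : χ (-1) = -1 := h
      rw [MulChar.inv_apply_eq_inv', h]; norm_num
  have hF : ZMod.dft (fun x => χ x) = fun k => (χ (-1) * gaussSum χ ZMod.stdAddChar) * χ⁻¹ k := by
    ext k
    have := hχ.fourierTransform_eq_inv_mul_gaussSum k
    refine this.trans ?_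
    rw [← neg_one_mul k, map_mul, hinv]; ring
  have hF' : ZMod.dft (fun x => χ (-x)) = fun k => gaussSum χ ZMod.stdAddChar * χ⁻¹ k := by
    rw [ZMod.dft_comp_neg]
    ext k
    have := hχ.fourierTransform_eq_inv_mul_gaussSum (-k)
    refine this.trans ?_
    rw [neg_neg, mul_comm]
  have hmul : ∀ c : ℂ, ZMod.LFunction (fun k => c * χ⁻¹ k) s = c * LFunction χ⁻¹ s := fun c => by
    simp only [LFunction, ZMod.LFunction, mul_assoc, ← Finset.mul_sum]
    ring
  have h := ZMod.LFunction_one_sub (fun x => χ x) (s := s) (fun n hn => by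
    rw [hn] at hs; simp at hs; linarith [n.cast_nonneg (α := ℝ)]) (Or.inl hχ0)
  rw [hF, hF', hmul, hmul] at h
  refine h.trans ?_
  ring

/-- Compare Γ(x+2) with a factorial, hence with (x+3)^{x+3}, and absorb the logarithm by log y ≤ 2
y^{1/2}. This is where the exponent 3/2 arises. Dividing by x(x+1) ≥ 3/4 returns to Γ(x). -/
theorem _root_.Real.Gamma_le_exp_rpow {x : ℝ} (hx : 1 / 2 ≤ x) :
    Real.Gamma x ≤ 2 * Real.exp (2 * (x + 3) ^ (3 / 2 : ℝ)) := by
  have hx0 : 0 < x := by linarith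
  have h1 : Real.Gamma (x + 2) = (x + 1) * (x * Real.Gamma x) := by
    rw [← Real.Gamma_add_one hx0.ne', ← Real.Gamma_add_one (by linarith)]
    ring_nf
  have h2 : Real.Gamma (x + 2) ≤ Real.exp (2 * (x + 3) ^ (3 / 2 : ℝ)) := by
    set n := ⌈x⌉₊ with hn
    have hxn : x ≤ n := Nat.le_ceil x
    have hnx : (n : ℝ) < x + 1 := Nat.ceil_lt_add_one hx0.le
    calc Real.Gamma (x + 2) ≤ Real.Gamma ((n + 1 : ℕ) + 1) := by
          refine Real.Gamma_strictMonoOn_Ici.monotoneOn ?_ ?_ ?_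
          · simp; linarith
          · simp only [Nat.cast_add, Nat.cast_one, mem_Ici]; linarith
          · push_cast; linarith
      _ = ((n + 1).factorial : ℝ) := Real.Gamma_nat_eq_factorial _
      _ ≤ ((n + 1 : ℕ) : ℝ) ^ (n + 1) := by exact_mod_cast Nat.factorial_le_pow _
      _ ≤ (x + 3) ^ (n + 1) := by
          refine pow_le_pow_left₀ (by positivity) ?_ _
          push_cast; linarith
      _ = (x + 3) ^ ((n + 1 : ℕ) : ℝ) := (Real.rpow_natCast _ _).symm
      _ ≤ (x + 3) ^ (x + 3) := by
          refine Real.rpow_le_rpow_of_exponent_le (by linarith) ?_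
          push_cast; linarith
      _ = Real.exp (Real.log (x + 3) * (x + 3)) := Real.rpow_def_of_pos (by linarith) _
      _ ≤ _ := by
          refine Real.exp_le_exp.2 ?_
          have := Real.log_le_rpow_div (x := x + 3) (ε := 1 / 2) (by linarith) (by norm_num)
          calc Real.log (x + 3) * (x + 3) ≤ ((x + 3) ^ (1 / 2 : ℝ) / (1 / 2)) * (x + 3) := by
                gcongr
            _ = 2 * ((x + 3) ^ (1 / 2 : ℝ) * (x + 3) ^ (1 : ℝ)) := by rw [Real.rpow_one]; ring
            _ = _ := by rw [← Real.rpow_add (by linarith)]; norm_num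
  have h3 : 0 < Real.Gamma x := Real.Gamma_pos_of_pos hx0
  have h4 : 3 / 4 ≤ (x + 1) * x := by nlinarith
  have h5 := mul_le_mul_of_nonneg_right h4 h3.le
  linarith [mul_assoc (x + 1) x (Real.Gamma x), Real.exp_pos (2 * (x + 3) ^ (3 / 2 : ℝ))]

/-- `L(s, χ)` has order at most `3 / 2`. -/
theorem IsPrimitive.exists_norm_LFunction_le (hχ : χ.IsPrimitive) (hq : 1 < q) :
    ∃ A B : ℝ, 0 ≤ A ∧ 0 ≤ B ∧ ∀ R ≥ 1, ∀ z : ℂ, ‖z‖ ≤ R →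
      ‖LFunction χ (2 + z)‖ ≤ A * Real.exp (B * R ^ (3 / 2 : ℝ)) := by
  have hne := hχ.ne_one hq
  have hne' : χ⁻¹ ≠ 1 := by simpa using hne
  set τ := ‖gaussSum χ ZMod.stdAddChar‖ with hτ
  set lq := Real.log q with hlq
  have hq1 : (1 : ℝ) < q := by exact_mod_cast hq
  have hlq0 : 0 ≤ lq := Real.log_nonneg hq1.le
  refine ⟨6 * q + 2 * τ * 2 * (4 * q), 2 * lq + 32 + 4 + 1, by positivity, by positivity,
    fun R hR z hz => ?_⟩
  set r := R ^ (3 / 2 : ℝ) with hr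
  have hRr : R ≤ r := by
    calc R = R ^ (1 : ℝ) := (Real.rpow_one R).symm
      _ ≤ r := Real.rpow_le_rpow_of_exponent_le hR (by norm_num)
  have hRe : R ≤ Real.exp r := hRr.trans ((le_add_of_nonneg_right zero_le_one).trans
    (Real.add_one_le_exp r))
  by_cases hs : 1 / 2 ≤ (2 + z).re
  · calc ‖LFunction χ (2 + z)‖ ≤ 2 * q * ‖2 + z‖ := norm_LFunction_le_of_half_le_re hne hs
      _ ≤ 2 * q * (3 * Real.exp r) := by
          gcongr
          have := norm_add_le (2 : ℂ) z
          rw [Complex.norm_ofNat] at this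
          linarith
      _ = (6 * q) * Real.exp r := by ring
      _ ≤ (6 * q + 2 * τ * 2 * (4 * q)) * Real.exp ((2 * lq + 32 + 4 + 1) * r) := by
          gcongr
          · exact le_add_of_nonneg_right (by positivity)
          · nlinarith
  · push Not at hs
    -- `w` is the reflection 1 - (2 + z) of the point considered, and lies in Re w ≥ 1/2, where both
    -- the Gamma bound and the bound for L(w, χ⁻¹) hold.
    set w : ℂ := -1 - z with hw
    have hzw : 2 + z = 1 - w := by rw [hw]; ring
    have hwre : 1 / 2 ≤ w.re := by
      have : (2 + z).re = 1 - w.re := by rw [hzw]; simp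
      linarith
    have hwn : ‖w‖ ≤ 2 * R := by
      have := norm_sub_le (-1 : ℂ) z
      rw [norm_neg, norm_one] at this
      linarith
    have hwre2 : w.re ≤ 2 * R := (Complex.re_le_norm w).trans hwn
    have hwim : |w.im| ≤ 2 * R := (Complex.abs_im_le_norm w).trans hwn
    rw [hzw, hχ.LFunction_one_sub hq (by linarith)]
    simp only [norm_mul]
    have b1 : ‖(q : ℂ) ^ (w - 1)‖ ≤ Real.exp (2 * lq * r) := by
      rw [Complex.norm_natCast_cpow_of_pos (by omega), Real.rpow_def_of_pos (by linarith)]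
      refine Real.exp_le_exp.2 ?_
      simp only [sub_re, one_re]
      rw [← hlq]
      nlinarith
    have b2 : ‖(2 * Real.pi : ℂ) ^ (-w)‖ ≤ 1 := by
      have h2 : (2 * Real.pi : ℂ) = ((2 * Real.pi : ℝ) : ℂ) := by push_cast; ring
      rw [h2, norm_cpow_eq_rpow_re_of_pos (by positivity)]
      refine Real.rpow_le_one_of_one_le_of_nonpos ?_ ?_
      · linarith [Real.pi_gt_three]
      · simp only [neg_re]; linarith
    have b3 : ‖Complex.Gamma w‖ ≤ 2 * Real.exp (32 * r) := by
      have h1 : ‖Complex.Gamma w‖ ≤ Real.Gamma w.re := by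
        rw [Complex.Gamma_eq_integral (by linarith), Real.Gamma_eq_integral (by linarith)]
        refine (norm_integral_le_integral_norm _).trans (le_of_eq ?_)
        refine setIntegral_congr_fun measurableSet_Ioi fun t ht => ?_
        rw [norm_mul, norm_cpow_eq_rpow_re_of_pos ht, Complex.norm_real, Real.norm_of_nonneg
          (Real.exp_pos _).le]
        simp
      refine h1.trans ((Real.Gamma_le_exp_rpow hwre).trans ?_)
      gcongr 2 * Real.exp ?_
      -- Since 6.25 = 2.5^2, its 3/2 power is 15.625, and twice that is below 32.
      have h4 : (w.re + 3) ^ (3 / 2 : ℝ) ≤ (6.25 * R) ^ (3 / 2 : ℝ) :=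
        Real.rpow_le_rpow (by linarith) (by linarith) (by norm_num)
      have h5 : (6.25 * R) ^ (3 / 2 : ℝ) = 15.625 * r := by
        rw [Real.mul_rpow (by norm_num) (by linarith)]
        congr 1
        rw [show (6.25 : ℝ) = 2.5 ^ (2 : ℝ) by norm_num, ← Real.rpow_mul (by norm_num)]
        norm_num
      nlinarith
    have b4 : ‖χ (-1) * Complex.exp (Real.pi * I * w / 2) + Complex.exp (-Real.pi * I * w / 2)‖
        ≤ 2 * Real.exp (4 * r) := by
      have hle : ∀ x : ℝ, |x| ≤ 2 * R → Real.exp (Real.pi / 2 * x) ≤ Real.exp (4 * r) := by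
        intro x hx
        refine Real.exp_le_exp.2 ?_
        have h1 : Real.pi / 2 * x ≤ Real.pi / 2 * (2 * R) :=
          mul_le_mul_of_nonneg_left ((le_abs_self x).trans hx) (by positivity)
        nlinarith [Real.pi_lt_four]
      refine (norm_add_le _ _).trans ?_
      rw [norm_mul, Complex.norm_exp, Complex.norm_exp, two_mul]
      refine add_le_add ?_ ?_
      · refine (mul_le_of_le_one_left (Real.exp_pos _).le (χ.norm_le_one _)).trans ?_
        have e : (Real.pi * I * w / 2).re = Real.pi / 2 * (-w.im) := by
          simp; ring
        rw [e]; exact hle _ (by rwa [abs_neg])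
      · have e : (-Real.pi * I * w / 2).re = Real.pi / 2 * (w.im) := by
          simp; ring
        rw [e]; exact hle _ hwim
    have b5 : ‖LFunction χ⁻¹ w‖ ≤ 4 * q * Real.exp r := by
      refine (norm_LFunction_le_of_half_le_re hne' hwre).trans ?_
      calc 2 * (q : ℝ) * ‖w‖ ≤ 2 * q * (2 * Real.exp r) := by gcongr; linarith
        _ = _ := by ring
    calc _ ≤ Real.exp (2 * lq * r) * 1 * (2 * Real.exp (32 * r)) * τ * (2 * Real.exp (4 * r)) *
          (4 * q * Real.exp r) := by gcongr
      _ = (2 * τ * 2 * (4 * q)) * (Real.exp (2 * lq * r) * Real.exp (32 * r) * Real.exp (4 * r)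
          * Real.exp r) := by ring
      _ = (2 * τ * 2 * (4 * q)) * Real.exp ((2 * lq + 32 + 4 + 1) * r) := by
          rw [← Real.exp_add, ← Real.exp_add, ← Real.exp_add]; congr 2; ring
      _ ≤ _ := by
          gcongr
          exact le_add_of_nonneg_left (by positivity)

theorem LFunction_two_ne_zero (χ : DirichletCharacter ℂ q) : LFunction χ 2 ≠ 0 :=
  LFunction_ne_zero_of_one_le_re χ (Or.inr (by norm_num)) (by norm_num)

/-- The centre is moved to 2, where L does not vanish, to match the normalisation by |f(0)| used for
entire functions. -/
theorem IsPrimitive.exists_growth (hχ : χ.IsPrimitive) (hq : 1 < q) :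
    ∃ K : ℝ, ∀ R ≥ 1, ∀ z : ℂ, ‖z‖ ≤ R →
      ‖LFunction χ (2 + z)‖ ≤ ‖LFunction χ (2 + 0)‖ * Real.exp (K * R ^ (3 / 2 : ℝ)) := by
  obtain ⟨A, B, hA, hB, h⟩ := hχ.exists_norm_LFunction_le hq
  rw [add_zero]
  set l := ‖LFunction χ 2‖ with hl
  have hl0 : 0 < l := norm_pos_iff.2 χ.LFunction_two_ne_zero
  -- As R ≥ 1, the factor A/l is absorbed by y ≤ e^y into the exponent.
  refine ⟨A / l + B, fun R hR z hz => (h R hR z hz).trans ?_⟩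
  have hR1 : 1 ≤ R ^ (3 / 2 : ℝ) := Real.one_le_rpow hR (by norm_num)
  rw [add_mul, Real.exp_add, ← mul_assoc]
  refine mul_le_mul_of_nonneg_right ?_ (Real.exp_pos _).le
  have h1 : A / l ≤ Real.exp (A / l * R ^ (3 / 2 : ℝ)) := by
    have h2 : A / l ≤ A / l * R ^ (3 / 2 : ℝ) := le_mul_of_one_le_right (by positivity) hR1
    linarith [Real.add_one_le_exp (A / l * R ^ (3 / 2 : ℝ))]
  rw [mul_comm, ← div_le_iff₀ hl0]
  exact h1

end DirichletCharacter

/-! ### The Dirichlet series of L'/L, the trivial zeros, and the partial fractions of L'/L. -/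

namespace DirichletCharacter

variable {q : ℕ} {χ : DirichletCharacter ℂ q}

/-- The coefficients `Λ(n) χ(n)`. -/
noncomputable def mangoldtCoeff (χ : DirichletCharacter ℂ q) (n : ℕ) : ℂ :=
  (ArithmeticFunction.vonMangoldt n : ℂ) * χ (n : ZMod q)

theorem norm_mangoldtCoeff_le (χ : DirichletCharacter ℂ q) (n : ℕ) :
    ‖χ.mangoldtCoeff n‖ ≤ ArithmeticFunction.vonMangoldt n := by
  rw [mangoldtCoeff, norm_mul, Complex.norm_real,
    Real.norm_of_nonneg ArithmeticFunction.vonMangoldt_nonneg]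
  exact mul_le_of_le_one_right ArithmeticFunction.vonMangoldt_nonneg (χ.norm_le_one _)

theorem mangoldtCoeff_of_le_one (χ : DirichletCharacter ℂ q) {n : ℕ} (hn : n ≤ 1) :
    χ.mangoldtCoeff n = 0 := by
  interval_cases n <;> simp [mangoldtCoeff]

theorem LSeries_term_mangoldtCoeff (χ : DirichletCharacter ℂ q) (s : ℂ) (n : ℕ) :
    LSeries.term χ.mangoldtCoeff s n = χ.mangoldtCoeff n * (n : ℂ) ^ (-s) := by
  rcases eq_or_ne n 0 with rfl | hn
  · simp [mangoldtCoeff]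
  · rw [LSeries.term_of_ne_zero hn, Complex.cpow_neg, div_eq_mul_inv]

theorem summable_mangoldtCoeff (χ : DirichletCharacter ℂ q) {s : ℂ} (hs : 1 < s.re) :
    Summable fun n : ℕ => χ.mangoldtCoeff n * (n : ℂ) ^ (-s) := by
  have := ArithmeticFunction.LSeriesSummable_vonMangoldt hs
  have h2 := χ.LSeriesSummable_mul this
  rw [LSeriesSummable] at h2
  refine h2.congr fun n => ?_
  rw [← LSeries_term_mangoldtCoeff]
  congr 1
  ext n
  simp only [mangoldtCoeff, Pi.mul_apply]
  ring

theorem norm_mangoldtCoeff_mul_cpow (χ : DirichletCharacter ℂ q) (n : ℕ) (s : ℂ) :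
    ‖χ.mangoldtCoeff n * (n : ℂ) ^ (-s)‖ = ‖χ.mangoldtCoeff n‖ * (n : ℝ) ^ (-s.re) := by
  rcases Nat.eq_zero_or_pos n with rfl | hn
  · simp [mangoldtCoeff]
  · rw [norm_mul, Complex.norm_natCast_cpow_of_pos hn, neg_re]

/-- The logarithm costs n^ε with ε = (Re s - 1)/2, which leaves the exponent 1 + ε, still inside the
region of absolute convergence. -/
theorem summable_mangoldtCoeff_log (χ : DirichletCharacter ℂ q) {s : ℂ} (hs : 1 < s.re) :
    Summable fun n : ℕ => ‖χ.mangoldtCoeff n * (n : ℂ) ^ (-s)‖ * Real.log n := by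
  set ε := (s.re - 1) / 2 with hε
  have hε0 : 0 < ε := by rw [hε]; linarith
  have h1 := (χ.summable_mangoldtCoeff (s := ((1 + ε : ℝ) : ℂ)) (by simpa using hε0)).norm
  refine Summable.of_nonneg_of_le (fun n => mul_nonneg (norm_nonneg _) (Real.log_natCast_nonneg n))
    (fun n => ?_) (h1.mul_left (1 / ε))
  rcases Nat.eq_zero_or_pos n with rfl | hn
  · simp [mangoldtCoeff]
  have hn' : (0 : ℝ) < n := by exact_mod_cast hn
  rw [norm_mangoldtCoeff_mul_cpow, norm_mangoldtCoeff_mul_cpow, Complex.ofReal_re, mul_assoc,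
    mul_left_comm (1 / ε)]
  refine mul_le_mul_of_nonneg_left ?_ (norm_nonneg _)
  have h2 := Real.log_le_rpow_div hn'.le hε0
  calc (n : ℝ) ^ (-s.re) * Real.log n ≤ (n : ℝ) ^ (-s.re) * ((n : ℝ) ^ ε / ε) := by gcongr
    _ = 1 / ε * ((n : ℝ) ^ (-s.re) * (n : ℝ) ^ ε) := by ring
    _ = _ := by
      rw [← Real.rpow_add hn']
      congr 2
      rw [hε]; ring

variable [NeZero q]

theorem tsum_mangoldtCoeff (χ : DirichletCharacter ℂ q) {s : ℂ} (hs : 1 < s.re) :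
    ∑' n : ℕ, χ.mangoldtCoeff n * (n : ℂ) ^ (-s) = -logDeriv (LFunction χ) s := by
  have h := χ.LSeries_twist_vonMangoldt_eq hs
  rw [logDeriv_apply, deriv_LFunction_eq_deriv_LSeries χ hs, LFunction_eq_LSeries χ hs,
    ← neg_div, ← h, LSeries]
  refine tsum_congr fun n => ?_
  rw [← LSeries_term_mangoldtCoeff]
  congr 1
  ext n
  simp only [mangoldtCoeff, Pi.mul_apply]
  ring

/-- All the zeros of `L(s, χ)`. -/
def zeros (χ : DirichletCharacter ℂ q) : Set ℂ := {ρ | LFunction χ ρ = 0}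

theorem zeros_re_lt_one (hχ : χ ≠ 1) (ρ : χ.zeros) : (ρ : ℂ).re < 1 := by
  by_contra! h
  exact LFunction_ne_zero_of_one_le_re χ (Or.inl hχ) h ρ.2

theorem analyticOrderAt_LFunction_ne_top (hχ : χ ≠ 1) (s : ℂ) :
    analyticOrderAt (LFunction χ) s ≠ ⊤ :=
  (differentiable_LFunction hχ).analyticOrderAt_ne_top χ.LFunction_two_ne_zero s

/-- The zeros of `L(s, χ)` outside the critical strip are simple and lie at non-positive
integers. -/
theorem IsPrimitive.trivial_zero (hχ : χ.IsPrimitive) (hq : 1 < q) {ρ : ℂ}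
    (hρ : LFunction χ ρ = 0) (hre : ρ.re ≤ 0) :
    (∃ n : ℕ, ρ = -n) ∧ analyticOrderNatAt (LFunction χ) ρ = 1 := by
  have hne := hχ.ne_one hq
  have hne' : χ⁻¹ ≠ 1 := by simpa using hne
  set e : ℂ → ℂ := fun s => χ (-1) * Complex.exp (Real.pi * I * (1 - s) / 2) +
    Complex.exp (-Real.pi * I * (1 - s) / 2) with he
  set h : ℂ → ℂ := fun s => (q : ℂ) ^ (1 - s - 1) * (2 * Real.pi : ℂ) ^ (-(1 - s)) *
    Complex.Gamma (1 - s) * gaussSum χ ZMod.stdAddChar * LFunction χ⁻¹ (1 - s) with hh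
  have hfe : ∀ s : ℂ, s.re < 1 → LFunction χ s = h s * e s := fun s hs => by
    have := hχ.LFunction_one_sub hq (s := 1 - s) (by simpa using hs)
    rw [sub_sub_cancel] at this
    rw [this]; ring
  have hnhds : ∀ s : ℂ, s.re < 1 → {s : ℂ | s.re < 1} ∈ 𝓝 s := fun s hs =>
    (isOpen_lt continuous_re continuous_const).mem_nhds hs
  have hq0 : (q : ℂ) ≠ 0 := NeZero.ne _
  have hpi : (2 * Real.pi : ℂ) ≠ 0 := by
    simp
  -- If the Gauss sum vanished, the functional equation would make L vanish identically near 0.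
  have hgauss : gaussSum χ ZMod.stdAddChar ≠ 0 := by
    intro h0
    refine analyticOrderAt_LFunction_ne_top hne 0 (analyticOrderAt_eq_top.2 ?_)
    filter_upwards [hnhds 0 (by simp)] with s hs
    rw [hfe s hs, hh]
    simp [h0]
  have hgam : ∀ s : ℂ, s.re < 1 → ∀ m : ℕ, 1 - s ≠ -m := fun s hs m hm => by
    have := congrArg Complex.re hm
    simp at this
    linarith [m.cast_nonneg (α := ℝ)]
  have hρ1 : ρ.re < 1 := by linarith
  have hhρ : h ρ ≠ 0 := by
    refine mul_ne_zero (mul_ne_zero (mul_ne_zero (mul_ne_zero ?_ ?_) ?_) hgauss) ?_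
    · simp [cpow_eq_zero_iff, hq0]
    · simp [cpow_eq_zero_iff]
    · exact Complex.Gamma_ne_zero (hgam ρ hρ1)
    · exact LFunction_ne_zero_of_one_le_re _ (Or.inl hne') (by simpa using hre)
  have heρ : e ρ = 0 := by
    have := hfe ρ hρ1
    rw [hρ] at this
    exact (mul_eq_zero.1 this.symm).resolve_left hhρ
  have hε : χ (-1) = 1 ∨ χ (-1) = -1 := χ.even_or_odd
  -- The derivative is simplified with e(ρ) = 0: the two exponential terms are opposite there, so
  -- their derivatives add up and cannot cancel.
  have heder : HasDerivAt e (Real.pi * I * Complex.exp (-Real.pi * I * (1 - ρ) / 2)) ρ := by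
    have h1 : HasDerivAt (fun s : ℂ => Real.pi * I * (1 - s) / 2) (-(Real.pi * I / 2)) ρ := by
      have := (((hasDerivAt_id ρ).const_sub 1).const_mul (Real.pi * I)).div_const 2
      convert! this using 1; ring
    have h2 : HasDerivAt (fun s : ℂ => -Real.pi * I * (1 - s) / 2) (Real.pi * I / 2) ρ := by
      have := (((hasDerivAt_id ρ).const_sub 1).const_mul (-Real.pi * I)).div_const 2
      convert! this using 1; ring
    have h3 := (h1.cexp.const_mul (χ (-1))).add h2.cexp
    convert! h3 using 1
    have h4 : χ (-1) * Complex.exp (Real.pi * I * (1 - ρ) / 2) =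
        -Complex.exp (-Real.pi * I * (1 - ρ) / 2) := eq_neg_of_add_eq_zero_left heρ
    rw [← mul_assoc, h4]; ring
  constructor
  · have h1 : Complex.exp (Real.pi * I * (1 - ρ)) = 1 ∨
        Complex.exp (Real.pi * I * (1 - ρ)) = -1 := by
      have h4 : χ (-1) * Complex.exp (Real.pi * I * (1 - ρ) / 2) =
        -Complex.exp (-Real.pi * I * (1 - ρ) / 2) := eq_neg_of_add_eq_zero_left heρ
      have h5 : Complex.exp (Real.pi * I * (1 - ρ)) =
          Complex.exp (Real.pi * I * (1 - ρ) / 2) * Complex.exp (Real.pi * I * (1 - ρ) / 2) := by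
        rw [← Complex.exp_add]; congr 1; ring
      have h6 : Complex.exp (-Real.pi * I * (1 - ρ) / 2) *
          Complex.exp (Real.pi * I * (1 - ρ) / 2) = 1 := by
        rw [← Complex.exp_add, ← Complex.exp_zero]; congr 1; ring
      have h7 : χ (-1) * Complex.exp (Real.pi * I * (1 - ρ)) = -1 := by
        rw [h5, ← mul_assoc, h4, neg_mul, h6]
      rcases hε with h8 | h8
      · right; rwa [h8, one_mul] at h7
      · left; rw [h8, neg_one_mul, neg_inj] at h7; exact h7
    -- Squaring forgets the parity of 1 - ρ; only its integrality is needed.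
    have h2 : Complex.exp (2 * Real.pi * I * (1 - ρ)) = 1 := by
      have : 2 * Real.pi * I * (1 - ρ) = Real.pi * I * (1 - ρ) + Real.pi * I * (1 - ρ) := by ring
      rw [this, Complex.exp_add]
      rcases h1 with h1 | h1 <;> rw [h1] <;> norm_num
    obtain ⟨n, hn⟩ := Complex.exp_eq_one_iff.1 h2
    have h3 : 1 - ρ = n := by
      have h2pi : (2 * Real.pi * I : ℂ) ≠ 0 := mul_ne_zero hpi I_ne_zero
      have : (2 * Real.pi * I) * (1 - ρ) = (2 * Real.pi * I) * n := by rw [hn]; ring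
      exact mul_left_cancel₀ h2pi this
    have h4 : (1 : ℝ) ≤ n := by
      have := congrArg Complex.re h3
      simp at this
      linarith
    have h5 : (1 : ℤ) ≤ n := by exact_mod_cast h4
    refine ⟨(n - 1).toNat, ?_⟩
    have h6 : (((n - 1).toNat : ℤ) : ℂ) = n - 1 := by
      rw [Int.toNat_of_nonneg (by omega)]; push_cast; ring
    rw [Int.cast_natCast] at h6
    rw [h6, ← h3]; ring
  · have hhan : AnalyticAt ℂ h ρ := by
      refine DifferentiableOn.analyticAt (s := {s : ℂ | s.re < 1}) (fun s hs => ?_) (hnhds ρ hρ1)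
      refine DifferentiableAt.differentiableWithinAt ?_
      have hg : DifferentiableAt ℂ (fun s => Complex.Gamma (1 - s)) s :=
        DifferentiableAt.comp (g := Complex.Gamma) (f := fun s : ℂ => 1 - s) s
          (Complex.differentiableAt_Gamma _ (hgam s hs)) (by fun_prop)
      have hL : DifferentiableAt ℂ (fun s => LFunction χ⁻¹ (1 - s)) s :=
        DifferentiableAt.comp (g := LFunction χ⁻¹) (f := fun s : ℂ => 1 - s) s
          (differentiable_LFunction hne' _) (by fun_prop)
      have h1 : DifferentiableAt ℂ (fun s : ℂ => (q : ℂ) ^ (1 - s - 1)) s :=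
        DifferentiableAt.const_cpow (by fun_prop) (Or.inl hq0)
      have h2 : DifferentiableAt ℂ (fun s : ℂ => (2 * Real.pi : ℂ) ^ (-(1 - s))) s :=
        DifferentiableAt.const_cpow (by fun_prop) (Or.inl hpi)
      exact (((h1.mul h2).mul hg).mul_const _).mul hL
    have hean : AnalyticAt ℂ e ρ := by
      have : Differentiable ℂ e := by fun_prop
      exact this.analyticAt ρ
    have h1 : analyticOrderAt (LFunction χ) ρ = 1 := by
      have : LFunction χ =ᶠ[𝓝 ρ] h * e := by
        filter_upwards [hnhds ρ hρ1] with s hs using hfe s hs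
      rw [analyticOrderAt_congr this, analyticOrderAt_mul hhan hean,
        hhan.analyticOrderAt_eq_zero.2 hhρ, zero_add]
      refine hean.analyticOrderAt_eq_one_of_zero_deriv_ne_zero heρ ?_
      rw [heder.deriv]
      refine mul_ne_zero (mul_ne_zero ?_ I_ne_zero) (Complex.exp_ne_zero _)
      exact_mod_cast Real.pi_ne_zero
    simp [analyticOrderNatAt, h1]

theorem analyticOrderNatAt_LFunction_add (χ : DirichletCharacter ℂ q) (z : ℂ) :
    analyticOrderNatAt (fun z => LFunction χ (2 + z)) z =
      analyticOrderNatAt (LFunction χ) (2 + z) := by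
  unfold analyticOrderNatAt
  congr 1
  have h1 : HasDerivAt (fun z : ℂ => 2 + z) 1 z := (hasDerivAt_id z).const_add 2
  exact analyticOrderAt_comp_of_deriv_ne_zero (f := LFunction χ) (g := fun z : ℂ => 2 + z)
    (by fun_prop) (by rw [h1.deriv]; exact one_ne_zero)

/-- Translation identifies the zeros of `L(2 + z, χ)` with those of `L(s, χ)`. -/
def zerosEquiv (χ : DirichletCharacter ℂ q) : {z | LFunction χ (2 + z) = 0} ≃ χ.zeros where
  toFun z := ⟨2 + z, z.2⟩
  invFun ρ := ⟨ρ - 2, by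
    have := ρ.2
    simp only [zeros, mem_ofPred_eq] at this
    simpa using this⟩
  left_inv z := by simp
  right_inv ρ := by simp

theorem differentiable_LFunction_two_add (hχ : χ ≠ 1) :
    Differentiable ℂ fun z => LFunction χ (2 + z) :=
  (differentiable_LFunction hχ).comp (differentiable_id.const_add 2)

/-- `∑_ρ 1 / (1 + |ρ|) ^ 2` converges, zeros being counted with multiplicity. -/
theorem IsPrimitive.summable_zeros (hχ : χ.IsPrimitive) (hq : 1 < q) :
    Summable fun ρ : χ.zeros =>
      (analyticOrderNatAt (LFunction χ) ρ : ℝ) * (1 / (1 + ‖(ρ : ℂ)‖) ^ 2) := by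
  have hne := hχ.ne_one hq
  obtain ⟨K, hK⟩ := hχ.exists_growth hq
  have h := summable_analyticOrderNatAt_div_sq (differentiable_LFunction_two_add hne)
    (by simpa using χ.LFunction_two_ne_zero) hK
  rw [← χ.zerosEquiv.summable_iff]
  refine Summable.of_nonneg_of_le (fun z => by dsimp; positivity) (fun z => ?_) (h.mul_left 9)
  simp only [Function.comp_apply, zerosEquiv, Equiv.coe_fn_mk]
  rw [analyticOrderNatAt_LFunction_add χ, mul_left_comm]
  refine mul_le_mul_of_nonneg_left ?_ (by positivity)
  rw [mul_one_div, div_le_div_iff₀ (by positivity) (by positivity)]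
  have h1 : ‖(z : ℂ)‖ ≤ ‖2 + (z : ℂ)‖ + 2 := by
    have := norm_sub_le (2 + (z : ℂ)) 2
    simpa using this
  have h2 : 1 + ‖(z : ℂ)‖ ≤ 3 * (1 + ‖2 + (z : ℂ)‖) := by
    linarith [norm_nonneg (2 + (z : ℂ))]
  nlinarith [norm_nonneg (z : ℂ)]

/-- The partial fraction expansion of the logarithmic derivative of `L(s, χ)`. -/
theorem IsPrimitive.hasSum_logDeriv_LFunction_sub (hχ : χ.IsPrimitive) (hq : 1 < q) {s t : ℂ}
    (hs : 1 < s.re) (ht : 1 < t.re) :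
    HasSum (fun ρ : χ.zeros =>
        (analyticOrderNatAt (LFunction χ) ρ : ℂ) * (1 / (s - ρ) - 1 / (t - ρ)))
      (logDeriv (LFunction χ) s - logDeriv (LFunction χ) t) := by
  have hne := hχ.ne_one hq
  obtain ⟨K, hK⟩ := hχ.exists_growth hq
  have hL : ∀ {s : ℂ}, 1 < s.re → LFunction χ (2 + (s - 2)) ≠ 0 := fun hs => by
    rw [add_sub_cancel]; exact LFunction_ne_zero_of_one_le_re χ (Or.inl hne) hs.le
  have h := hasSum_logDeriv_sub_logDeriv (differentiable_LFunction_two_add hne)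
    (by simpa using χ.LFunction_two_ne_zero) hK (hL hs) (hL ht)
  have hld : ∀ s, logDeriv (fun z => LFunction χ (2 + z)) (s - 2) = logDeriv (LFunction χ) s := by
    intro s
    rw [logDeriv_apply, logDeriv_apply, deriv_comp_const_add, add_sub_cancel]
  rw [hld, hld] at h
  rw [← χ.zerosEquiv.hasSum_iff]
  convert! h using 1
  ext z
  simp only [Function.comp_apply, zerosEquiv, Equiv.coe_fn_mk]
  rw [analyticOrderNatAt_LFunction_add χ]
  congr 3 <;> ring

end DirichletCharacter

/-! ### The explicit formula through uniqueness of Laplace transforms. -/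

section Laplace

theorem hasSum_setIntegral_mul {ι : Type*} [Countable ι] {S : Set ℝ} {k : ℝ → ℂ}
    (hk : IntegrableOn k S) {F : ι → ℝ → ℂ} (hF : ∀ i, Continuous (F i)) {b : ι → ℝ}
    (hb : ∀ i y, ‖F i y‖ ≤ b i) (hsum : Summable b) :
    HasSum (fun i => ∫ y in S, k y * F i y) (∫ y in S, k y * ∑' i, F i y) := by
  have hint : ∀ i, IntegrableOn (fun y => k y * F i y) S := fun i =>
    Integrable.mul_bdd (c := b i) hk (hF i).aestronglyMeasurable
      (Eventually.of_forall fun y => hb i y)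
  have h := hasSum_integral_of_summable_integral_norm (μ := volume.restrict S)
    (F := fun i y => k y * F i y) hint ?_
  · simpa only [tsum_mul_left] using h
  · refine Summable.of_nonneg_of_le (fun i => integral_nonneg fun y => norm_nonneg _) (fun i => ?_)
      (hsum.mul_left (∫ y in S, ‖k y‖))
    rw [← integral_mul_const]
    refine integral_mono (hint i).norm (hk.norm.mul_const _) fun y => ?_
    simp only [norm_mul]
    gcongr
    exact hb i y

theorem integrableOn_exp_neg_mul {w : ℂ} (hw : 0 < w.re) (c : ℝ) :
    IntegrableOn (fun y : ℝ => Complex.exp (-w * y)) (Ioi c) :=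
  integrableOn_exp_mul_complex_Ioi (by simpa using hw) c

theorem integral_exp_neg_mul {w : ℂ} (hw : 0 < w.re) (c : ℝ) :
    ∫ y : ℝ in Ioi c, Complex.exp (-w * y) = Complex.exp (-w * c) / w := by
  rw [integral_exp_mul_complex_Ioi (by simpa using hw)]
  rw [neg_div_neg_eq]

/-- The factor 1/w^2 makes each partial fraction term the transform of a continuous bounded
function. Writing max(y, 0) makes that function vanish for y ≤ 0, so it is continuous on the whole
line. -/
theorem integral_exp_mul_one_sub_exp {w l : ℂ} (hw : 0 < w.re) (hl : 0 < l.re) :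
    ∫ y : ℝ in Ioi 0, Complex.exp (-w * y) * ((1 - Complex.exp (-l * (max y 0 : ℝ))) / l ^ 2) =
      1 / w ^ 2 * (1 / l - 1 / (l + w)) := by
  have hw0 := ne_zero_of_re_pos hw
  have hl0 := ne_zero_of_re_pos hl
  have hlw : 0 < (l + w).re := by simpa using add_pos hl hw
  have hlw0 := ne_zero_of_re_pos hlw
  have h1 : ∀ y ∈ Ioi (0 : ℝ),
      Complex.exp (-w * y) * ((1 - Complex.exp (-l * (max y 0 : ℝ))) / l ^ 2) =
      1 / l ^ 2 * (Complex.exp (-w * y) - Complex.exp (-(l + w) * y)) := by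
    intro y hy
    rw [max_eq_left (le_of_lt hy), show -(l + w) * (y : ℂ) = -w * y + -l * y by ring,
      Complex.exp_add]
    ring
  rw [setIntegral_congr_fun measurableSet_Ioi h1, integral_const_mul,
    integral_sub (integrableOn_exp_neg_mul hw 0) (integrableOn_exp_neg_mul hlw 0),
    integral_exp_neg_mul hw, integral_exp_neg_mul hlw]
  simp only [ofReal_zero, mul_zero, Complex.exp_zero]
  field_simp
  ring

/-- The prime side of the same normalisation: a term 1 - n^{-w}, divided by w^2, is the transform of
a ramp stopped at l = log n. -/
theorem integral_exp_mul_min {w : ℂ} (hw : 0 < w.re) {l : ℝ} (hl : 0 ≤ l) :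
    ∫ y : ℝ in Ioi 0, Complex.exp (-w * y) * ((min (max y 0) l : ℝ) : ℂ) =
      1 / w ^ 2 * (1 - Complex.exp (-w * l)) := by
  have hw0 := ne_zero_of_re_pos hw
  have hcont : Continuous fun y : ℝ => Complex.exp (-w * y) * ((min (max y 0) l : ℝ) : ℂ) := by
    fun_prop
  have e2 : EqOn (fun y : ℝ => Complex.exp (-w * y) * ((min (max y 0) l : ℝ) : ℂ))
      (fun y : ℝ => l * Complex.exp (-w * y)) (Ioi l) := by
    intro y hy
    have hy : l < y := hy
    simp only
    rw [max_eq_left (by linarith), min_eq_right hy.le, mul_comm]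
  rw [← Ioc_union_Ioi_eq_Ioi hl, setIntegral_union (Ioc_disjoint_Ioi le_rfl) measurableSet_Ioi
    (hcont.integrableOn_Ioc)
    (IntegrableOn.congr_fun ((integrableOn_exp_neg_mul hw l).const_mul _) e2.symm measurableSet_Ioi),
    setIntegral_congr_fun measurableSet_Ioi e2, integral_const_mul, integral_exp_neg_mul hw,
    ← intervalIntegral.integral_of_le hl]
  have h1 : ∀ y ∈ uIcc 0 l, HasDerivAt
      (fun y : ℝ => -((y : ℂ) / w + 1 / w ^ 2) * Complex.exp (-w * y))
      (Complex.exp (-w * y) * ((min (max y 0) l : ℝ) : ℂ)) y := by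
    intro y hy
    rw [uIcc_of_le hl] at hy
    rw [max_eq_left hy.1, min_eq_left hy.2]
    have hid : HasDerivAt (fun y : ℝ => (y : ℂ)) 1 y := Complex.ofRealCLM.hasDerivAt
    have := (((hid.div_const w).add_const (1 / w ^ 2)).neg).mul ((hid.const_mul (-w)).cexp)
    convert! this using 1
    simp only [Pi.neg_apply]
    field_simp
    ring
  rw [intervalIntegral.integral_eq_sub_of_hasDerivAt h1 (hcont.intervalIntegrable _ _)]
  simp only [ofReal_zero, mul_zero, Complex.exp_zero]
  field_simp
  ring

/-- A continuous function that vanishes on the negative half-line, is bounded, and has zero Laplace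
transform, is zero. -/
theorem eq_zero_of_laplace_eq_zero {D : ℝ → ℂ} (hc : Continuous D) {B : ℝ}
    (hB : ∀ y, ‖D y‖ ≤ B) (hneg : ∀ y ≤ 0, D y = 0)
    (hL : ∀ w : ℂ, 0 < w.re → ∫ y : ℝ in Ioi 0, Complex.exp (-w * y) * D y = 0) (y : ℝ) :
    D y = 0 := by
  -- Damping by e^{-y} gives an integrable function whose Fourier transform at ξ is the Laplace
  -- transform at 1 + 2πiξ; Fourier inversion then applies.
  set h : ℝ → ℂ := fun y => Complex.exp (-(1 : ℂ) * y) * D y with hh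
  have hcont : Continuous h := by fun_prop
  have hind : ∀ g : ℝ → ℂ, (fun y => g y * D y) = (Ioi (0 : ℝ)).indicator (fun y => g y * D y) := by
    intro g
    ext y
    by_cases hy : y ∈ Ioi (0 : ℝ)
    · rw [indicator_of_mem hy]
    · rw [indicator_of_notMem hy, hneg y (by simpa using hy), mul_zero]
  have hint : Integrable h := by
    rw [hh, hind, integrable_indicator_iff measurableSet_Ioi]
    exact Integrable.mul_bdd (c := B) (integrableOn_exp_neg_mul (w := 1) (by simp) 0)
      hc.aestronglyMeasurable (Eventually.of_forall hB)
  have hF : FourierTransform.fourier h = 0 := by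
    ext ξ
    rw [Real.fourier_real_eq_integral_exp_smul]
    have e : ∀ v : ℝ, Complex.exp (((-2 * Real.pi * v * ξ : ℝ) : ℂ) * I) • h v =
        Complex.exp (-(1 + 2 * Real.pi * ξ * I) * v) * D v := by
      intro v
      rw [hh, smul_eq_mul, ← mul_assoc, ← Complex.exp_add]
      congr 2
      push_cast; ring
    simp only [e]
    rw [hind, integral_indicator measurableSet_Ioi]
    exact hL _ (by simp)
  have := hcont.fourierInv_fourier_eq hint (by rw [hF]; exact integrable_zero _ _ _)
  rw [hF] at this
  have h0 : h y = 0 := by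
    rw [← this, Real.fourierInv_eq]
    simp
  exact (mul_eq_zero.1 h0).resolve_left (Complex.exp_ne_zero _)

theorem norm_mul_one_sub_exp_div_le (m : ℂ) {l : ℂ} (hl : 0 < l.re) (y : ℝ) :
    ‖m * ((1 - Complex.exp (-l * (max y 0 : ℝ))) / l ^ 2)‖ ≤ 2 * (‖m‖ / ‖l‖ ^ 2) := by
  rw [norm_mul, norm_div, norm_pow, mul_comm 2, div_mul_eq_mul_div, mul_div_assoc]
  gcongr
  refine (norm_sub_le _ _).trans ?_
  rw [norm_one, Complex.norm_exp]
  have : Real.exp ((-l * (max y 0 : ℝ)).re) ≤ 1 := by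
    rw [Real.exp_le_one_iff, neg_mul, neg_re, re_mul_ofReal, neg_nonpos]
    exact mul_nonneg hl.le (le_max_right _ _)
  linarith

theorem norm_mul_min_le (c : ℂ) {x : ℝ} (hx : 0 ≤ x) (y : ℝ) :
    ‖c * ((min (max y 0) x : ℝ) : ℂ)‖ ≤ ‖c‖ * x := by
  rw [norm_mul, Complex.norm_real, Real.norm_of_nonneg (le_min (le_max_right _ _) hx)]
  gcongr
  exact min_le_right _ _

/-- If `∑ mᵢ (1 / λᵢ - 1 / (λᵢ + w)) = ∑ cₙ (1 - e^{-w lₙ})` for all `w`, then the inverse Laplace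
transforms agree. -/
theorem tsum_one_sub_exp_eq_tsum_min {ι κ : Type*} [Countable ι] [Countable κ]
    {m : ι → ℂ} {l : ι → ℂ} (hl : ∀ i, 0 < (l i).re) (hm : Summable fun i => ‖m i‖ / ‖l i‖ ^ 2)
    {c : κ → ℂ} {x : κ → ℝ} (hx : ∀ n, 0 ≤ x n) (hc : Summable fun n => ‖c n‖ * x n)
    (h : ∀ w : ℂ, 0 < w.re → ∑' i, m i * (1 / l i - 1 / (l i + w)) =
      ∑' n, c n * (1 - Complex.exp (-w * x n))) (y : ℝ) :
    ∑' i, m i * ((1 - Complex.exp (-l i * (max y 0 : ℝ))) / l i ^ 2) =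
      ∑' n, c n * ((min (max y 0) (x n) : ℝ) : ℂ) := by
  have hb1 : ∀ i y, ‖m i * ((1 - Complex.exp (-l i * (max y 0 : ℝ))) / l i ^ 2)‖ ≤
      2 * (‖m i‖ / ‖l i‖ ^ 2) := fun i y => norm_mul_one_sub_exp_div_le (m i) (hl i) y
  have hb2 : ∀ n y, ‖c n * ((min (max y 0) (x n) : ℝ) : ℂ)‖ ≤ ‖c n‖ * x n :=
    fun n y => norm_mul_min_le (c n) (hx n) y
  have hc1 : ∀ i, Continuous fun y : ℝ =>
      m i * ((1 - Complex.exp (-l i * (max y 0 : ℝ))) / l i ^ 2) := fun i => by fun_prop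
  have hc2 : ∀ n, Continuous fun y : ℝ => c n * ((min (max y 0) (x n) : ℝ) : ℂ) :=
    fun n => by fun_prop
  have hm2 := hm.mul_left 2
  set Φ : ℝ → ℂ := fun y => ∑' i, m i * ((1 - Complex.exp (-l i * (max y 0 : ℝ))) / l i ^ 2)
  set Ψ : ℝ → ℂ := fun y => ∑' n, c n * ((min (max y 0) (x n) : ℝ) : ℂ)
  have hΦ : Continuous Φ := continuous_tsum hc1 hm2 hb1
  have hΨ : Continuous Ψ := continuous_tsum hc2 hc hb2
  have hΦb : ∀ y, ‖Φ y‖ ≤ ∑' i, 2 * (‖m i‖ / ‖l i‖ ^ 2) := fun y =>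
    tsum_of_norm_bounded hm2.hasSum fun i => hb1 i y
  have hΨb : ∀ y, ‖Ψ y‖ ≤ ∑' n, ‖c n‖ * x n := fun y =>
    tsum_of_norm_bounded hc.hasSum fun n => hb2 n y
  have hzero := eq_zero_of_laplace_eq_zero (D := fun y => Φ y - Ψ y) (hΦ.sub hΨ)
    (fun y => (norm_sub_le _ _).trans (add_le_add (hΦb y) (hΨb y))) (fun y hy => ?_)
    (fun w hw => ?_) y
  · exact sub_eq_zero.1 hzero
  · have h1 : Φ y = 0 := by simp [Φ, max_eq_right hy]
    have h2 : Ψ y = 0 := by simp [Ψ, max_eq_right hy, hx]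
    rw [h1, h2, sub_zero]
  · have hk := integrableOn_exp_neg_mul hw 0
    have i1 := Integrable.mul_bdd hk hΦ.aestronglyMeasurable (Eventually.of_forall hΦb)
    have i2 := Integrable.mul_bdd hk hΨ.aestronglyMeasurable (Eventually.of_forall hΨb)
    simp only [mul_sub]
    rw [integral_sub i1 i2, ← (hasSum_setIntegral_mul hk hc1 hb1 hm2).tsum_eq,
      ← (hasSum_setIntegral_mul hk hc2 hb2 hc).tsum_eq]
    have e1 : ∀ i, ∫ y : ℝ in Ioi 0, Complex.exp (-w * y) *
        (m i * ((1 - Complex.exp (-l i * (max y 0 : ℝ))) / l i ^ 2)) =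
        1 / w ^ 2 * (m i * (1 / l i - 1 / (l i + w))) := fun i => by
      simp only [mul_left_comm _ (m i)]
      rw [integral_const_mul, integral_exp_mul_one_sub_exp hw (hl i)]
    have e2 : ∀ n, ∫ y : ℝ in Ioi 0, Complex.exp (-w * y) *
        (c n * ((min (max y 0) (x n) : ℝ) : ℂ)) =
        1 / w ^ 2 * (c n * (1 - Complex.exp (-w * x n))) := fun n => by
      simp only [mul_left_comm _ (c n)]
      rw [integral_const_mul, integral_exp_mul_min hw (hx n)]
    simp only [e1, e2]
    rw [tsum_mul_left, tsum_mul_left, h w hw, sub_self]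

variable {k k₁ k₂ : ℝ → ℂ}

/-- Integration by parts up to l gives l k'(l) - k(l), and the constant tail contributes -l k'(l).
-/
theorem integral_deriv_deriv_mul_min (h1 : ∀ y, HasDerivAt k (k₁ y) y)
    (h2 : ∀ y, HasDerivAt k₁ (k₂ y) y) (hk₂ : Continuous k₂) (hi : IntegrableOn k₂ (Ioi 0))
    (h0 : k 0 = 0) (hlim : Tendsto k₁ atTop (𝓝 0)) {l : ℝ} (hl : 0 ≤ l) :
    ∫ y : ℝ in Ioi 0, k₂ y * ((min (max y 0) l : ℝ) : ℂ) = -k l := by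
  have hcont : Continuous fun y : ℝ => k₂ y * ((min (max y 0) l : ℝ) : ℂ) := by fun_prop
  have hi' : IntegrableOn k₂ (Ioi l) := hi.mono_set (Ioi_subset_Ioi hl)
  have e2 : EqOn (fun y : ℝ => k₂ y * ((min (max y 0) l : ℝ) : ℂ))
      (fun y : ℝ => l * k₂ y) (Ioi l) := by
    intro y hy
    have hy : l < y := hy
    simp only
    rw [max_eq_left (by linarith), min_eq_right hy.le, mul_comm]
  rw [← Ioc_union_Ioi_eq_Ioi hl, setIntegral_union (Ioc_disjoint_Ioi le_rfl) measurableSet_Ioi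
    (hcont.integrableOn_Ioc) (IntegrableOn.congr_fun (hi'.const_mul _) e2.symm measurableSet_Ioi),
    setIntegral_congr_fun measurableSet_Ioi e2, integral_const_mul,
    integral_Ioi_of_hasDerivAt_of_tendsto (h2 l).continuousAt.continuousWithinAt
      (fun y _ => h2 y) hi' hlim, ← intervalIntegral.integral_of_le hl]
  have h3 : ∀ y ∈ uIcc 0 l, HasDerivAt (fun y : ℝ => k₁ y * y - k y)
      (k₂ y * ((min (max y 0) l : ℝ) : ℂ)) y := by
    intro y hy
    rw [uIcc_of_le hl] at hy
    rw [max_eq_left hy.1, min_eq_left hy.2]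
    have hid : HasDerivAt (fun y : ℝ => (y : ℂ)) 1 y := Complex.ofRealCLM.hasDerivAt
    convert! ((h2 y).mul hid).sub (h1 y) using 1
    ring
  rw [intervalIntegral.integral_eq_sub_of_hasDerivAt h3 (hcont.intervalIntegrable _ _), h0]
  simp only [ofReal_zero, mul_zero]
  ring

theorem integral_deriv_deriv_mul_one_sub_exp (h1 : ∀ y, HasDerivAt k (k₁ y) y)
    (h2 : ∀ y, HasDerivAt k₁ (k₂ y) y) (hi : IntegrableOn k₂ (Ioi 0))
    (h0 : k 0 = 0) (h0' : k₁ 0 = 0) (hlim : Tendsto k₁ atTop (𝓝 0)) {B : ℝ} (hB : ∀ y, ‖k y‖ ≤ B)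
    {l : ℂ} (hl : 0 < l.re) :
    ∫ y : ℝ in Ioi 0, k₂ y * ((1 - Complex.exp (-l * (max y 0 : ℝ))) / l ^ 2) =
      -∫ y : ℝ in Ioi 0, k y * Complex.exp (-l * y) := by
  have hl0 := ne_zero_of_re_pos hl
  have hk : Continuous k := continuous_iff_continuousAt.2 fun y => (h1 y).continuousAt
  have hexp : Tendsto (fun y : ℝ => Complex.exp (-l * y)) atTop (𝓝 0) := by
    rw [tendsto_zero_iff_norm_tendsto_zero]
    simp only [Complex.norm_exp, neg_mul, neg_re, re_mul_ofReal]
    exact Real.tendsto_exp_neg_atTop_nhds_zero.comp (tendsto_id.const_mul_atTop hl)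
  have e1 : EqOn (fun y : ℝ => k₂ y * ((1 - Complex.exp (-l * (max y 0 : ℝ))) / l ^ 2))
      (fun y : ℝ => k₂ y * ((1 - Complex.exp (-l * y)) / l ^ 2)) (Ioi 0) := by
    intro y hy
    simp only
    rw [max_eq_left (le_of_lt hy)]
  have i1 : IntegrableOn (fun y : ℝ => k₂ y * ((1 - Complex.exp (-l * (max y 0 : ℝ))) / l ^ 2))
      (Ioi 0) := by
    refine Integrable.mul_bdd (c := 2 * (‖(1 : ℂ)‖ / ‖l‖ ^ 2)) hi
      (Continuous.aestronglyMeasurable (by fun_prop)) (Eventually.of_forall fun y => ?_)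
    simpa only [one_mul] using norm_mul_one_sub_exp_div_le 1 hl y
  have i1' := i1.congr_fun e1 measurableSet_Ioi
  have i2 : IntegrableOn (fun y : ℝ => k y * Complex.exp (-l * y)) (Ioi 0) := by
    refine Integrable.bdd_mul (c := B) (integrableOn_exp_neg_mul hl 0) hk.aestronglyMeasurable
      (Eventually.of_forall hB)
  rw [setIntegral_congr_fun measurableSet_Ioi e1, ← add_eq_zero_iff_eq_neg, ← integral_add i1' i2]
  -- This primitive encodes both integrations by parts; it vanishes at 0 because k and k' do, and at
  -- infinity because k' and e^{-ly} decay.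
  have hder : ∀ y : ℝ, HasDerivAt (fun y : ℝ => k₁ y * ((1 - Complex.exp (-l * y)) / l ^ 2) -
      k y * Complex.exp (-l * y) / l)
      (k₂ y * ((1 - Complex.exp (-l * y)) / l ^ 2) + k y * Complex.exp (-l * y)) y := by
    intro y
    have hid : HasDerivAt (fun y : ℝ => (y : ℂ)) 1 y := Complex.ofRealCLM.hasDerivAt
    have he : HasDerivAt (fun y : ℝ => Complex.exp (-l * y)) (Complex.exp (-l * y) * (-l * 1)) y :=
      (hid.const_mul (-l)).cexp
    convert! ((h2 y).mul ((he.const_sub 1).div_const (l ^ 2))).sub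
      (((h1 y).mul he).div_const l) using 1
    field_simp
    ring
  rw [integral_Ioi_of_hasDerivAt_of_tendsto (m := 0) (hder 0).continuousAt.continuousWithinAt
      (fun y _ => hder y) (i1'.add i2) ?_]
  · simp [h0, h0']
  · have t1 : Tendsto (fun y : ℝ => k₁ y * ((1 - Complex.exp (-l * y)) / l ^ 2)) atTop (𝓝 0) := by
      have := hlim.mul ((hexp.const_sub 1).div_const (l ^ 2))
      simpa using this
    have t2 : Tendsto (fun y : ℝ => k y * Complex.exp (-l * y) / l) atTop (𝓝 0) := by
      have : Tendsto (fun y : ℝ => k y * Complex.exp (-l * y)) atTop (𝓝 0) := by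
        refine hexp.zero_mul_isBoundedUnder_le ?_ |>.congr fun y => mul_comm _ _
        exact isBoundedUnder_of ⟨B, hB⟩
      simpa using this.div_const l
    simpa using t1.sub t2

/-- The explicit formula for a test function `k`. -/
theorem hasSum_integral_mul_exp {ι κ : Type*} [Countable ι] [Countable κ]
    {m : ι → ℂ} {l : ι → ℂ} (hl : ∀ i, 0 < (l i).re) (hm : Summable fun i => ‖m i‖ / ‖l i‖ ^ 2)
    {c : κ → ℂ} {x : κ → ℝ} (hx : ∀ n, 0 ≤ x n) (hc : Summable fun n => ‖c n‖ * x n)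
    (h : ∀ w : ℂ, 0 < w.re → ∑' i, m i * (1 / l i - 1 / (l i + w)) =
      ∑' n, c n * (1 - Complex.exp (-w * x n)))
    (h1 : ∀ y, HasDerivAt k (k₁ y) y)
    (h2 : ∀ y, HasDerivAt k₁ (k₂ y) y) (hk₂ : Continuous k₂) (hi : IntegrableOn k₂ (Ioi 0))
    (h0 : k 0 = 0) (h0' : k₁ 0 = 0) (hlim : Tendsto k₁ atTop (𝓝 0))
    {B : ℝ} (hB : ∀ y, ‖k y‖ ≤ B) :
    HasSum (fun i => m i * ∫ y : ℝ in Ioi 0, k y * Complex.exp (-l i * y))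
      (∑' n, c n * k (x n)) := by
  have hb1 : ∀ i y, ‖m i * ((1 - Complex.exp (-l i * (max y 0 : ℝ))) / l i ^ 2)‖ ≤
      2 * (‖m i‖ / ‖l i‖ ^ 2) := fun i y => norm_mul_one_sub_exp_div_le (m i) (hl i) y
  have hb2 : ∀ n y, ‖c n * ((min (max y 0) (x n) : ℝ) : ℂ)‖ ≤ ‖c n‖ * x n :=
    fun n y => norm_mul_min_le (c n) (hx n) y
  have s1 := hasSum_setIntegral_mul hi
    (F := fun i (y : ℝ) => m i * ((1 - Complex.exp (-l i * (max y 0 : ℝ))) / l i ^ 2))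
    (fun i => by fun_prop) hb1 (hm.mul_left 2)
  have s2 := hasSum_setIntegral_mul hi
    (F := fun n (y : ℝ) => c n * ((min (max y 0) (x n) : ℝ) : ℂ))
    (fun n => by fun_prop) hb2 hc
  -- After this the zero side and the prime side are expansions of one and the same integral against
  -- k''.
  simp only [tsum_one_sub_exp_eq_tsum_min hl hm hx hc h] at s1
  have e1 : ∀ i, ∫ y : ℝ in Ioi 0, k₂ y *
      (m i * ((1 - Complex.exp (-l i * (max y 0 : ℝ))) / l i ^ 2)) =
      -(m i * ∫ y : ℝ in Ioi 0, k y * Complex.exp (-l i * y)) := fun i => by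
    simp only [mul_left_comm _ (m i)]
    rw [integral_const_mul, integral_deriv_deriv_mul_one_sub_exp h1 h2 hi h0 h0' hlim hB (hl i)]
    ring
  have e2 : ∀ n, ∫ y : ℝ in Ioi 0, k₂ y * (c n * ((min (max y 0) (x n) : ℝ) : ℂ)) =
      -(c n * k (x n)) := fun n => by
    simp only [mul_left_comm _ (c n)]
    rw [integral_const_mul, integral_deriv_deriv_mul_min h1 h2 hk₂ hi h0 hlim (hx n)]
    ring
  simp only [e1] at s1
  simp only [e2] at s2
  rw [← s2.tsum_eq, tsum_neg] at s1
  simpa using s1.neg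

end Laplace

/-! ### The exponential integral: behaviour at the origin and decay to the right. -/

section ExpIntegral

/-- The entire function `(1 - e^{-z}) / z`. -/
noncomputable def oneSubExpDiv : ℂ → ℂ := dslope (fun z => 1 - Complex.exp (-z)) 0

theorem oneSubExpDiv_of_ne_zero {z : ℂ} (hz : z ≠ 0) :
    oneSubExpDiv z = (1 - Complex.exp (-z)) / z := by
  rw [oneSubExpDiv, dslope_of_ne _ hz, slope_def_field]
  simp

theorem differentiable_oneSubExpDiv : Differentiable ℂ oneSubExpDiv := by
  rw [← differentiableOn_univ]
  refine (Complex.differentiableOn_dslope univ_mem).2 (Differentiable.differentiableOn ?_)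
  fun_prop

theorem exists_primitive_oneSubExpDiv : ∃ E : ℂ → ℂ, ∀ z, HasDerivAt E (oneSubExpDiv z) z := by
  obtain ⟨E, hE⟩ := differentiable_oneSubExpDiv.isExactOn_univ
  exact ⟨E, fun z => hE z (mem_univ z)⟩

/-- A primitive of `(1 - e^{-z}) / z`: the entire part of the exponential integral, up to a
constant. -/
noncomputable def entireEin : ℂ → ℂ := exists_primitive_oneSubExpDiv.choose

theorem hasDerivAt_entireEin (z : ℂ) : HasDerivAt entireEin (oneSubExpDiv z) z :=
  exists_primitive_oneSubExpDiv.choose_spec z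

theorem differentiable_entireEin : Differentiable ℂ entireEin := fun z =>
  (hasDerivAt_entireEin z).differentiableAt

theorem continuous_entireEin : Continuous entireEin := differentiable_entireEin.continuous

theorem integrableOn_exp_neg_div {r : ℝ} (hr : 0 < r) :
    IntegrableOn (fun t : ℝ => Complex.exp (-(t : ℂ)) / (t : ℂ)) (Ioi r) := by
  have h1 : IntegrableOn (fun t : ℝ => Complex.exp (-(1 : ℂ) * t)) (Ioi r) :=
    integrableOn_exp_neg_mul (by simp) r
  have h2 := Integrable.bdd_mul (c := 1 / r) (f := fun t : ℝ => 1 / (t : ℂ)) h1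
    (Measurable.aestronglyMeasurable (by fun_prop)) ?_
  · refine h2.congr (Eventually.of_forall fun t => ?_)
    simp only [neg_mul, one_mul]
    ring
  · filter_upwards [ae_restrict_mem measurableSet_Ioi] with t ht
    have ht : r < t := ht
    rw [norm_div, norm_one, Complex.norm_real, Real.norm_of_nonneg (by linarith)]
    gcongr

theorem integral_exp_neg_div {r : ℝ} (hr : 0 < r) :
    ∫ t : ℝ in Ioi r, Complex.exp (-(t : ℂ)) / (t : ℂ) =
      (∫ t : ℝ in Ioi 1, Complex.exp (-(t : ℂ)) / (t : ℂ)) - entireEin 1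
        - (Real.log r : ℂ) + entireEin r := by
  have h1 : (∫ t : ℝ in Ioi r, Complex.exp (-(t : ℂ)) / (t : ℂ)) -
      ∫ t : ℝ in Ioi 1, Complex.exp (-(t : ℂ)) / (t : ℂ) =
      ∫ t : ℝ in r..1, Complex.exp (-(t : ℂ)) / (t : ℂ) := by
    rw [← intervalIntegral.integral_interval_add_Ioi (integrableOn_exp_neg_div hr)
      (integrableOn_exp_neg_div one_pos)]
    ring
  have h2 : ∀ t ∈ uIcc r 1, HasDerivAt (fun t : ℝ => (Real.log t : ℂ) - entireEin t)
      (Complex.exp (-(t : ℂ)) / (t : ℂ)) t := by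
    intro t ht
    have ht0 : 0 < t := lt_of_lt_of_le (lt_min hr one_pos) (by simpa [uIcc] using ht.1)
    have ht0' : (t : ℂ) ≠ 0 := by exact_mod_cast ht0.ne'
    have h3 : HasDerivAt (fun t : ℝ => entireEin t) (oneSubExpDiv t) t := by
      simpa using (hasDerivAt_entireEin t).comp_ofReal
    have h4 := ((Real.hasDerivAt_log ht0.ne').ofReal_comp).sub h3
    convert! h4 using 1
    rw [oneSubExpDiv_of_ne_zero ht0']
    push_cast
    field_simp
    ring
  rw [intervalIntegral.integral_eq_sub_of_hasDerivAt h2] at h1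
  · rw [sub_eq_iff_eq_add] at h1
    rw [h1]
    simp
    ring
  · refine ContinuousOn.intervalIntegrable fun t ht => ContinuousAt.continuousWithinAt ?_
    have ht0 : 0 < t := lt_of_lt_of_le (lt_min hr one_pos) (by simpa [uIcc] using ht.1)
    have ht0' : (t : ℂ) ≠ 0 := by exact_mod_cast ht0.ne'
    fun_prop (disch := exact ht0')

/-- The constant term of the expansion of `E₁` at the origin. -/
noncomputable def expIntegralConst : ℂ :=
  (∫ t : ℝ in Ioi 1, Complex.exp (-(t : ℂ)) / (t : ℂ)) - entireEin 1

/-- `E₁(z) + log z` extends to an entire function. -/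
theorem expIntegralE1_eq {z : ℂ} (hz : z ≠ 0) :
    expIntegralE1 z = expIntegralConst - Complex.log z + entireEin z := by
  have hr : 0 < ‖z‖ := norm_pos_iff.2 hz
  rw [expIntegralE1, integral_exp_neg_div hr]
  -- On the arc dw/w = i dφ, and e^{-w}/w = 1/w - (1 - e^{-w})/w; the term 1/w accounts for the
  -- angle and completes log z.
  have h1 : ∀ φ : ℝ, HasDerivAt
      (fun φ : ℝ => entireEin ((‖z‖ : ℂ) * Complex.exp ((φ : ℂ) * I)) - I * φ)
      (-I * Complex.exp (-((‖z‖ : ℂ) * Complex.exp ((φ : ℂ) * I)))) φ := by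
    intro φ
    have hid : HasDerivAt (fun y : ℝ => (y : ℂ)) 1 φ := Complex.ofRealCLM.hasDerivAt
    have hw := ((hid.mul_const I).cexp).const_mul (‖z‖ : ℂ)
    have hne : (‖z‖ : ℂ) * Complex.exp ((φ : ℂ) * I) ≠ 0 :=
      mul_ne_zero (by exact_mod_cast hr.ne') (Complex.exp_ne_zero _)
    have h2 := ((hasDerivAt_entireEin _).comp φ hw).sub (hid.const_mul I)
    convert! h2 using 1
    rw [oneSubExpDiv_of_ne_zero hne, one_mul, ← mul_assoc (‖z‖ : ℂ), ← mul_assoc _ _ I,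
      div_mul_cancel₀ _ hne]
    ring
  have h2 : ∫ φ in (0 : ℝ)..z.arg, -I * Complex.exp (-((‖z‖ : ℂ) * Complex.exp ((φ : ℂ) * I))) =
      entireEin z - I * z.arg - entireEin ‖z‖ := by
    rw [intervalIntegral.integral_eq_sub_of_hasDerivAt (fun φ _ => h1 φ)
      (Continuous.intervalIntegrable (by fun_prop) _ _), Complex.norm_mul_exp_arg_mul_I]
    simp
  rw [intervalIntegral.integral_const_mul, neg_mul] at h2
  rw [expIntegralConst, Complex.log]
  linear_combination h2

theorem hasDerivAt_expIntegralE1 {z : ℂ} (hz : z ∈ slitPlane) :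
    HasDerivAt expIntegralE1 (-(Complex.exp (-z) / z)) z := by
  have hz0 := slitPlane_ne_zero hz
  have h := ((Complex.hasDerivAt_log hz).const_sub expIntegralConst).add (hasDerivAt_entireEin z)
  have h2 : expIntegralE1 =ᶠ[𝓝 z] fun z => expIntegralConst - Complex.log z + entireEin z := by
    filter_upwards [isOpen_slitPlane.mem_nhds hz] with w hw
    exact expIntegralE1_eq (slitPlane_ne_zero hw)
  refine (h.congr_of_eventuallyEq h2).congr_deriv ?_
  rw [oneSubExpDiv_of_ne_zero hz0]
  field_simp
  ring

/-- On the arc from z to |z| the real part is at least Re z, as the cosine decreases away from 0.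
The arc has angle at most π/2 < 4, and the real half-line contributes one more e^{-Re z}. The bound
serves mainly to give the limit 0 along rays. -/
theorem norm_expIntegralE1_le_of_one_le {z : ℂ} (hz : 0 < z.re) (hz1 : 1 ≤ ‖z‖) :
    ‖expIntegralE1 z‖ ≤ 5 * Real.exp (-z.re) := by
  have hr : 0 < ‖z‖ := by linarith
  have hz0 : z ≠ 0 := norm_pos_iff.1 hr
  have h1 : ‖∫ t : ℝ in Ioi ‖z‖, Complex.exp (-(t : ℂ)) / (t : ℂ)‖ ≤ Real.exp (-z.re) := by
    refine (norm_integral_le_of_norm_le (integrableOn_exp_neg_Ioi ‖z‖) ?_).trans ?_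
    · filter_upwards [ae_restrict_mem measurableSet_Ioi] with t ht
      have ht : ‖z‖ < t := ht
      rw [norm_div, Complex.norm_exp, Complex.norm_real, Real.norm_of_nonneg (by linarith)]
      simp only [neg_re, ofReal_re]
      exact div_le_self (Real.exp_pos _).le (by linarith)
    · rw [integral_exp_neg_Ioi]
      exact Real.exp_le_exp.2 (neg_le_neg (Complex.re_le_norm z))
  have harg : |z.arg| ≤ Real.pi / 2 := Complex.abs_arg_le_pi_div_two_iff.2 hz.le
  have h2 : ‖∫ φ in (0 : ℝ)..z.arg,
      Complex.exp (-((‖z‖ : ℂ) * Complex.exp ((φ : ℂ) * I)))‖ ≤ Real.exp (-z.re) * |z.arg - 0| := by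
    refine intervalIntegral.norm_integral_le_of_norm_le_const fun φ hφ => ?_
    rw [Complex.norm_exp]
    refine Real.exp_le_exp.2 ?_
    have hφ' : |φ| ≤ |z.arg| := by
      rw [uIoc_eq_union] at hφ
      rcases hφ with h | h
      · rw [abs_of_pos h.1]; exact h.2.trans (le_abs_self _)
      · rw [abs_of_nonpos h.2, abs_of_neg (h.1.trans_le h.2)]; linarith [h.1]
    have hcos : Real.cos z.arg ≤ Real.cos φ := by
      rw [← Real.cos_abs z.arg, ← Real.cos_abs φ]
      exact Real.cos_le_cos_of_nonneg_of_le_pi (abs_nonneg _)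
        (harg.trans (by linarith [Real.pi_pos])) hφ'
    have hre : z.re = ‖z‖ * Real.cos z.arg := (Complex.norm_mul_cos_arg z).symm
    rw [neg_re, re_ofReal_mul, Complex.exp_ofReal_mul_I_re, neg_le_neg_iff]
    calc z.re = ‖z‖ * Real.cos z.arg := hre
      _ ≤ _ := mul_le_mul_of_nonneg_left hcos hr.le
  rw [expIntegralE1]
  refine (norm_sub_le _ _).trans ?_
  rw [norm_mul, Complex.norm_I, one_mul]
  rw [sub_zero] at h2
  have h3 : Real.exp (-z.re) * |z.arg| ≤ Real.exp (-z.re) * 4 := by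
    gcongr
    linarith [Real.pi_lt_four, Real.pi_pos]
  linarith

theorem tendsto_expIntegralE1_mul {z : ℂ} (hz : 0 < z.re) :
    Tendsto (fun t : ℝ => expIntegralE1 (z * t)) atTop (𝓝 0) := by
  have h1 : Tendsto (fun t : ℝ => 5 * Real.exp (-(z.re * t))) atTop (𝓝 0) := by
    have := (Real.tendsto_exp_neg_atTop_nhds_zero.comp
      (tendsto_id.const_mul_atTop hz)).const_mul 5
    simpa using this
  refine squeeze_zero_norm' ?_ h1
  filter_upwards [eventually_ge_atTop (1 / z.re)] with t ht
  have ht0 : 0 < t := lt_of_lt_of_le (by positivity) ht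
  have hre : (z * t).re = z.re * t := re_mul_ofReal z t
  have := norm_expIntegralE1_le_of_one_le (z := z * t) (by rw [hre]; positivity) (by
    refine le_trans ?_ (Complex.re_le_norm _)
    rw [hre]
    rw [div_le_iff₀ hz] at ht
    linarith)
  rwa [hre] at this

theorem hasDerivAt_expIntegralE1_mul {z : ℂ} (hz : 0 < z.re) {t : ℝ} (ht : 0 < t) :
    HasDerivAt (fun t : ℝ => expIntegralE1 (z * t)) (-(Complex.exp (-z * t) / t)) t := by
  have hid : HasDerivAt (fun y : ℝ => (y : ℂ)) 1 t := Complex.ofRealCLM.hasDerivAt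
  have hz0 := Complex.ne_zero_of_re_pos hz
  have ht0 : (t : ℂ) ≠ 0 := by exact_mod_cast ht.ne'
  have hmem : z * t ∈ slitPlane := Or.inl (by rw [re_mul_ofReal]; positivity)
  have := (hasDerivAt_expIntegralE1 hmem).comp t (hid.const_mul z)
  convert! this using 1
  rw [neg_mul]
  field_simp

theorem integrableOn_exp_neg_mul_div {z : ℂ} (hz : 0 < z.re) {r : ℝ} (hr : 0 < r) :
    IntegrableOn (fun t : ℝ => Complex.exp (-z * t) / t) (Ioi r) := by
  have h2 := Integrable.bdd_mul (c := 1 / r) (f := fun t : ℝ => 1 / (t : ℂ))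
    (integrableOn_exp_neg_mul hz r) (Measurable.aestronglyMeasurable (by fun_prop)) ?_
  · refine h2.congr (Eventually.of_forall fun t => ?_)
    ring
  · filter_upwards [ae_restrict_mem measurableSet_Ioi] with t ht
    have ht : r < t := ht
    rw [norm_div, norm_one, Complex.norm_real, Real.norm_of_nonneg (by linarith)]
    gcongr

/-- Along the ray t ↦ zt, E₁(z) = ∫_1^∞ e^{-zt}/t dt, and 1/t ≤ 1. -/
theorem norm_expIntegralE1_le {z : ℂ} (hz : 0 < z.re) :
    ‖expIntegralE1 z‖ ≤ Real.exp (-z.re) / z.re := by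
  have h1 : ∫ t : ℝ in Ioi 1, -(Complex.exp (-z * t) / t) = 0 - expIntegralE1 (z * (1 : ℝ)) :=
    integral_Ioi_of_hasDerivAt_of_tendsto'
      (fun t ht => hasDerivAt_expIntegralE1_mul hz (lt_of_lt_of_le one_pos ht))
      (integrableOn_exp_neg_mul_div hz one_pos).neg (tendsto_expIntegralE1_mul hz)
  rw [integral_neg, zero_sub, neg_inj, ofReal_one, mul_one] at h1
  rw [← h1]
  have hint : IntegrableOn (fun t : ℝ => Real.exp (-z.re * t)) (Ioi 1) :=
    integrableOn_exp_mul_Ioi (by linarith) 1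
  refine (norm_integral_le_of_norm_le hint ?_).trans (le_of_eq ?_)
  · filter_upwards [ae_restrict_mem measurableSet_Ioi] with t ht
    have ht : 1 < t := ht
    rw [norm_div, Complex.norm_exp, re_mul_ofReal, Complex.norm_real,
      Real.norm_of_nonneg (by linarith), neg_re]
    exact div_le_self (Real.exp_pos _).le ht.le
  · rw [integral_exp_mul_Ioi (by linarith)]
    rw [mul_one, neg_div_neg_eq]

end ExpIntegral

/-! ### The function U: entire extension of e^{-U} and decay. -/

section Smoothed

variable {X : ℝ} {u : ℝ → ℝ}

namespace IsWeight

theorem eq_zero (hu : IsWeight X u) {x : ℝ}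
    (hx : x ∉ Icc (Real.exp (1 - 1 / X)) (Real.exp 1)) : u x = 0 :=
  image_eq_zero_of_notMem_tsupport fun h => hx (hu.support_subset h)

theorem support_subset_half (hu : IsWeight X u) (hX : 2 ≤ X) :
    tsupport u ⊆ Icc (Real.exp (1 / 2)) (Real.exp 1) := by
  refine hu.support_subset.trans (Icc_subset_Icc_left (Real.exp_le_exp.2 ?_))
  have : 1 / X ≤ 1 / 2 := one_div_le_one_div_of_le (by norm_num) hX
  linarith

theorem eq_zero_half (hu : IsWeight X u) (hX : 2 ≤ X) {x : ℝ}
    (hx : x ∉ Icc (Real.exp (1 / 2)) (Real.exp 1)) : u x = 0 :=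
  image_eq_zero_of_notMem_tsupport fun h => hx (hu.support_subset_half hX h)

theorem continuous (hu : IsWeight X u) : Continuous u := hu.smooth.continuous

end IsWeight

theorem pos_of_mem {x : ℝ} (hx : x ∈ Icc (Real.exp (1 / 2)) (Real.exp 1)) : 0 < x :=
  (Real.exp_pos _).trans_le hx.1

theorem half_le_log {x : ℝ} (hx : x ∈ Icc (Real.exp (1 / 2)) (Real.exp 1)) :
    1 / 2 ≤ Real.log x :=
  (Real.le_log_iff_exp_le (pos_of_mem hx)).2 hx.1

theorem log_le_one {x : ℝ} (hx : x ∈ Icc (Real.exp (1 / 2)) (Real.exp 1)) : Real.log x ≤ 1 :=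
  (Real.log_le_iff_le_exp (pos_of_mem hx)).2 hx.2

theorem continuousOn_log_Icc :
    ContinuousOn (fun x : ℝ => (Real.log x : ℂ)) (Icc (Real.exp (1 / 2)) (Real.exp 1)) :=
  Complex.continuous_ofReal.comp_continuousOn
    (Real.continuousOn_log.mono fun _ hx => (pos_of_mem hx).ne')

theorem setIntegral_weight_mul (hu : IsWeight X u) (hX : 2 ≤ X) {S : Set ℝ}
    (hS : Icc (Real.exp (1 / 2)) (Real.exp 1) ⊆ S) (hSm : MeasurableSet S) (F : ℝ → ℂ) :
    ∫ x in S, (u x : ℂ) * F x = ∫ x in Icc (Real.exp (1 / 2)) (Real.exp 1), (u x : ℂ) * F x := by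
  refine setIntegral_eq_of_subset_of_forall_sdiff_eq_zero hSm hS fun x hx => ?_
  rw [hu.eq_zero_half hX hx.2]; simp

theorem integral_weight_real (hu : IsWeight X u) (hX : 2 ≤ X) :
    ∫ x in Icc (Real.exp (1 / 2)) (Real.exp 1), u x = 1 := by
  refine Eq.trans ?_ hu.mass_one
  exact setIntegral_eq_integral_of_forall_compl_eq_zero fun x hx => hu.eq_zero_half hX hx

theorem integral_weight (hu : IsWeight X u) (hX : 2 ≤ X) :
    ∫ x in Icc (Real.exp (1 / 2)) (Real.exp 1), (u x : ℂ) = 1 := by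
  refine (integral_ofReal (𝕜 := ℂ)).trans ?_
  rw [integral_weight_real hu hX]
  simp

theorem smoothedE1_eq_setIntegral (hu : IsWeight X u) (hX : 2 ≤ X) (z : ℂ) :
    smoothedE1 u z = ∫ x in Icc (Real.exp (1 / 2)) (Real.exp 1),
      (u x : ℂ) * expIntegralE1 (z * (Real.log x : ℂ)) :=
  setIntegral_weight_mul hu hX (fun _ hx => pos_of_mem hx) measurableSet_Ioi _

theorem norm_smoothedE1_le (hu : IsWeight X u) (hX : 2 ≤ X) {z : ℂ} (hz : 0 < z.re) :
    ‖smoothedE1 u z‖ ≤ Real.exp (-z.re / 2) / (z.re / 2) := by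
  rw [smoothedE1_eq_setIntegral hu hX]
  have hint : IntegrableOn (fun x => u x * (Real.exp (-z.re / 2) / (z.re / 2)))
      (Icc (Real.exp (1 / 2)) (Real.exp 1)) :=
    (hu.continuous.mul continuous_const).continuousOn.integrableOn_Icc
  refine (norm_integral_le_of_norm_le hint ?_).trans (le_of_eq ?_)
  · filter_upwards [ae_restrict_mem measurableSet_Icc] with x hx
    rw [norm_mul, Complex.norm_real, Real.norm_of_nonneg (hu.nonneg x)]
    refine mul_le_mul_of_nonneg_left ?_ (hu.nonneg x)
    have hl := half_le_log hx
    have hre : (z * (Real.log x : ℂ)).re = z.re * Real.log x := re_mul_ofReal _ _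
    have h1 : z.re / 2 ≤ z.re * Real.log x := by nlinarith
    refine (norm_expIntegralE1_le (by rw [hre]; nlinarith)).trans ?_
    rw [hre]
    gcongr
    linarith
  · rw [integral_mul_const, integral_weight_real hu hX, one_mul]

/-- The average of the entire part of the exponential integral. -/
noncomputable def smoothedEin (u : ℝ → ℝ) (z : ℂ) : ℂ :=
  ∫ x in Icc (Real.exp (1 / 2)) (Real.exp 1), (u x : ℂ) * entireEin (z * (Real.log x : ℂ))

theorem hasDerivAt_smoothedEin (hu : IsWeight X u) (z : ℂ) :
    HasDerivAt (smoothedEin u) (∫ x in Icc (Real.exp (1 / 2)) (Real.exp 1),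
      (u x : ℂ) * (oneSubExpDiv (z * (Real.log x : ℂ)) * (Real.log x : ℂ))) z := by
  have hcu : ContinuousOn (fun x : ℝ => (u x : ℂ)) (Icc (Real.exp (1 / 2)) (Real.exp 1)) :=
    (Complex.continuous_ofReal.comp hu.continuous).continuousOn
  have hc : ∀ {F : ℂ → ℂ}, Continuous F → ∀ w : ℂ, ContinuousOn
      (fun x : ℝ => (u x : ℂ) * F (w * (Real.log x : ℂ)))
      (Icc (Real.exp (1 / 2)) (Real.exp 1)) := fun hF w =>
    hcu.mul (hF.comp_continuousOn (continuousOn_const.mul continuousOn_log_Icc))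
  have hg := differentiable_oneSubExpDiv.continuous
  have hc' : ∀ w : ℂ, ContinuousOn
      (fun x : ℝ => (u x : ℂ) * (oneSubExpDiv (w * (Real.log x : ℂ)) * (Real.log x : ℂ)))
      (Icc (Real.exp (1 / 2)) (Real.exp 1)) := fun w =>
    hcu.mul ((hg.comp_continuousOn (continuousOn_const.mul continuousOn_log_Icc)).mul
      continuousOn_log_Icc)
  obtain ⟨M, hM⟩ := ((isCompact_closedBall z 1).prod
    (isCompact_Icc (a := Real.exp (1 / 2)) (b := Real.exp 1))).exists_bound_of_continuousOn
    (f := fun p : ℂ × ℝ => (u p.2 : ℂ) *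
      (oneSubExpDiv (p.1 * (Real.log p.2 : ℂ)) * (Real.log p.2 : ℂ))) (by
      have hl : ContinuousOn (fun p : ℂ × ℝ => (Real.log p.2 : ℂ))
          (closedBall z 1 ×ˢ Icc (Real.exp (1 / 2)) (Real.exp 1)) :=
        continuousOn_log_Icc.comp continuousOn_snd fun p hp => hp.2
      refine ContinuousOn.mul ?_ (ContinuousOn.mul ?_ hl)
      · exact hcu.comp continuousOn_snd fun p hp => hp.2
      · exact hg.comp_continuousOn (continuousOn_fst.mul hl))
  refine (hasDerivAt_integral_of_dominated_loc_of_deriv_le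
    (μ := volume.restrict (Icc (Real.exp (1 / 2)) (Real.exp 1)))
    (F := fun w (x : ℝ) => (u x : ℂ) * entireEin (w * (Real.log x : ℂ)))
    (F' := fun w (x : ℝ) => (u x : ℂ) * (oneSubExpDiv (w * (Real.log x : ℂ)) * (Real.log x : ℂ)))
    (bound := fun _ => M) (ball_mem_nhds z one_pos) ?_ ?_ ?_ ?_ ?_ ?_).2
  · exact Eventually.of_forall fun w =>
      (hc continuous_entireEin w).aestronglyMeasurable measurableSet_Icc
  · exact (hc continuous_entireEin z).integrableOn_Icc
  · exact (hc' z).aestronglyMeasurable measurableSet_Icc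
  · filter_upwards [ae_restrict_mem measurableSet_Icc] with x hx w hw
    exact hM (w, x) ⟨ball_subset_closedBall hw, hx⟩
  · exact integrable_const _
  · refine Eventually.of_forall fun x w _ => ?_
    have hid : HasDerivAt (fun w : ℂ => w * (Real.log x : ℂ)) (Real.log x : ℂ) w := by
      simpa using (hasDerivAt_id w).mul_const (Real.log x : ℂ)
    exact ((hasDerivAt_entireEin _).comp w hid).const_mul _

theorem differentiable_smoothedEin (hu : IsWeight X u) : Differentiable ℂ (smoothedEin u) :=
  fun z => (hasDerivAt_smoothedEin hu z).differentiableAt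

/-- The constant term in the expansion of `U` at the origin. -/
noncomputable def smoothedConst (u : ℝ → ℝ) : ℂ :=
  expIntegralConst - ∫ x in Icc (Real.exp (1 / 2)) (Real.exp 1),
    (u x : ℂ) * (Real.log (Real.log x) : ℂ)

theorem smoothedE1_eq (hu : IsWeight X u) (hX : 2 ≤ X) {z : ℂ} (hz : z ≠ 0) :
    smoothedE1 u z = smoothedConst u - Complex.log z + smoothedEin u z := by
  have hcu : ContinuousOn (fun x : ℝ => (u x : ℂ)) (Icc (Real.exp (1 / 2)) (Real.exp 1)) :=
    (Complex.continuous_ofReal.comp hu.continuous).continuousOn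
  have e : ∀ x ∈ Icc (Real.exp (1 / 2)) (Real.exp 1),
      (u x : ℂ) * expIntegralE1 (z * (Real.log x : ℂ)) =
      ((u x : ℂ) * (expIntegralConst - Complex.log z) -
        (u x : ℂ) * (Real.log (Real.log x) : ℂ)) +
        (u x : ℂ) * entireEin (z * (Real.log x : ℂ)) := by
    intro x hx
    have hl : 0 < Real.log x := by linarith [half_le_log hx]
    have hl' : (Real.log x : ℂ) ≠ 0 := by exact_mod_cast hl.ne'
    -- Multiplication by log x > 0 does not change the argument, so the logarithms add with no
    -- branch correction, even on the cut.
    rw [expIntegralE1_eq (mul_ne_zero hz hl'), Complex.log_mul_ofReal _ hl _ hz]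
    ring
  have i1 : IntegrableOn (fun x : ℝ => (u x : ℂ) * (expIntegralConst - Complex.log z))
      (Icc (Real.exp (1 / 2)) (Real.exp 1)) := (hcu.mul continuousOn_const).integrableOn_Icc
  have i2 : IntegrableOn (fun x : ℝ => (u x : ℂ) * (Real.log (Real.log x) : ℂ))
      (Icc (Real.exp (1 / 2)) (Real.exp 1)) := by
    refine ContinuousOn.integrableOn_Icc (hcu.mul ?_)
    refine Complex.continuous_ofReal.comp_continuousOn ?_
    refine Real.continuousOn_log.comp
      (Real.continuousOn_log.mono fun x hx => (pos_of_mem hx).ne') fun x hx => ?_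
    have := half_le_log hx
    simp only [mem_compl_iff, mem_singleton_iff]
    linarith
  have i12 : IntegrableOn (fun x : ℝ => (u x : ℂ) * (expIntegralConst - Complex.log z) -
      (u x : ℂ) * (Real.log (Real.log x) : ℂ)) (Icc (Real.exp (1 / 2)) (Real.exp 1)) := i1.sub i2
  have i3 : IntegrableOn (fun x : ℝ => (u x : ℂ) * entireEin (z * (Real.log x : ℂ)))
      (Icc (Real.exp (1 / 2)) (Real.exp 1)) :=
    (hcu.mul (continuous_entireEin.comp_continuousOn
      (continuousOn_const.mul continuousOn_log_Icc))).integrableOn_Icc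
  rw [smoothedE1_eq_setIntegral hu hX, setIntegral_congr_fun measurableSet_Icc e,
    integral_add i12 i3, integral_sub i1 i2, integral_mul_const, integral_weight hu hX,
    smoothedConst, smoothedEin]
  ring

/-- `e^{-U(z)}` extends to an entire function. -/
theorem exp_neg_smoothedE1 (hu : IsWeight X u) (hX : 2 ≤ X) {z : ℂ} (hz : z ≠ 0) :
    Complex.exp (-smoothedE1 u z) = z * Complex.exp (-smoothedConst u - smoothedEin u z) := by
  rw [smoothedE1_eq hu hX hz, show -(smoothedConst u - Complex.log z + smoothedEin u z) =
    Complex.log z + (-smoothedConst u - smoothedEin u z) by ring, Complex.exp_add,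
    Complex.exp_log hz]

/-- The transform `∫ u(x) x^{-z} dx`. -/
noncomputable def weightMellin (u : ℝ → ℝ) (z : ℂ) : ℂ :=
  ∫ x in Icc (Real.exp (1 / 2)) (Real.exp 1), (u x : ℂ) * Complex.exp (-(z * (Real.log x : ℂ)))

/-- Differentiation removes the logarithm: only a transform of u over z is left, and the smoothness
of u then gives decay. -/
theorem hasDerivAt_smoothedE1 (hu : IsWeight X u) (hX : 2 ≤ X) {z : ℂ} (hz : z ∈ slitPlane) :
    HasDerivAt (smoothedE1 u) (-(weightMellin u z / z)) z := by
  have hz0 := slitPlane_ne_zero hz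
  have hcu : ContinuousOn (fun x : ℝ => (u x : ℂ)) (Icc (Real.exp (1 / 2)) (Real.exp 1)) :=
    (Complex.continuous_ofReal.comp hu.continuous).continuousOn
  have h := ((Complex.hasDerivAt_log hz).const_sub (smoothedConst u)).add
    (hasDerivAt_smoothedEin hu z)
  have h2 : smoothedE1 u =ᶠ[𝓝 z] fun z => smoothedConst u - Complex.log z + smoothedEin u z := by
    filter_upwards [isOpen_slitPlane.mem_nhds hz] with w hw
    exact smoothedE1_eq hu hX (slitPlane_ne_zero hw)
  refine (h.congr_of_eventuallyEq h2).congr_deriv ?_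
  have e : ∀ x ∈ Icc (Real.exp (1 / 2)) (Real.exp 1),
      (u x : ℂ) * (oneSubExpDiv (z * (Real.log x : ℂ)) * (Real.log x : ℂ)) =
      ((u x : ℂ) - (u x : ℂ) * Complex.exp (-(z * (Real.log x : ℂ)))) / z := by
    intro x hx
    have hl : 0 < Real.log x := by linarith [half_le_log hx]
    have hl' : (Real.log x : ℂ) ≠ 0 := by exact_mod_cast hl.ne'
    rw [oneSubExpDiv_of_ne_zero (mul_ne_zero hz0 hl')]
    field_simp
  have i1 : IntegrableOn (fun x : ℝ => (u x : ℂ)) (Icc (Real.exp (1 / 2)) (Real.exp 1)) :=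
    hcu.integrableOn_Icc
  have i2 : IntegrableOn (fun x : ℝ => (u x : ℂ) * Complex.exp (-(z * (Real.log x : ℂ))))
      (Icc (Real.exp (1 / 2)) (Real.exp 1)) :=
    (hcu.mul (Complex.continuous_exp.comp_continuousOn
      (continuousOn_const.mul continuousOn_log_Icc).neg)).integrableOn_Icc
  rw [setIntegral_congr_fun measurableSet_Icc e, integral_div, integral_sub i1 i2,
    integral_weight hu hX, weightMellin]
  field_simp
  ring

/-- One integration by parts in x gains a factor 1/|w|. The constant depends on u through u', which
is harmless as only convergence rests on it. -/
theorem exists_norm_weightMellin_le (hu : IsWeight X u) (hX : 2 ≤ X) {B : ℝ} (hB : 0 ≤ B) :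
    ∃ C, 0 ≤ C ∧ ∀ w : ℂ, -B ≤ w.re →
      ‖w‖ * ‖weightMellin u w‖ ≤ C * Real.exp (-w.re / 2) := by
  have hdiff : Differentiable ℝ u := hu.smooth.differentiable (by simp)
  have hdc : Continuous (deriv u) := hu.smooth.continuous_deriv (by simp)
  -- The interval [1, 3] contains [√e, e] in its interior, so the boundary terms vanish.
  obtain ⟨M, hM⟩ := (isCompact_Icc (a := (1 : ℝ)) (b := 3)).exists_bound_of_continuousOn
    (f := fun x => u x + x * deriv u x)
    (hu.continuous.add (continuous_id.mul hdc)).continuousOn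
  have hM0 : 0 ≤ M := (norm_nonneg _).trans (hM 1 (by simp))
  have hJ1 : 1 < Real.exp (1 / 2) := by
    rw [Real.one_lt_exp_iff]; norm_num
  have hJ3 : Real.exp 1 < 3 := by linarith [Real.exp_one_lt_d9]
  have hz1 : u 1 = 0 := hu.eq_zero_half hX fun h => by linarith [h.1]
  have hz3 : u 3 = 0 := hu.eq_zero_half hX fun h => by linarith [h.2]
  refine ⟨2 * (M * Real.exp (B / 2)), by positivity, fun w hw => ?_⟩
  have hlogc : ContinuousOn (fun x : ℝ => Complex.exp (-(w * (Real.log x : ℂ)))) (uIcc 1 3) := by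
    refine Complex.continuous_exp.comp_continuousOn
      (continuousOn_const.mul (Complex.continuous_ofReal.comp_continuousOn
        (Real.continuousOn_log.mono fun x hx => ?_))).neg
    rw [uIcc_of_le (by norm_num)] at hx
    have : x ≠ 0 := by linarith [hx.1]
    simpa using this
  have hcu : Continuous fun x : ℝ => (u x : ℂ) := Complex.continuous_ofReal.comp hu.continuous
  have hcd : Continuous fun x : ℝ => ((u x + x * deriv u x : ℝ) : ℂ) :=
    Complex.continuous_ofReal.comp (hu.continuous.add (continuous_id.mul hdc))
  have hder : ∀ x ∈ uIcc (1 : ℝ) 3, HasDerivAt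
      (fun x : ℝ => ((x * u x : ℝ) : ℂ) * Complex.exp (-(w * (Real.log x : ℂ))))
      (((u x + x * deriv u x : ℝ) : ℂ) * Complex.exp (-(w * (Real.log x : ℂ))) -
        w * ((u x : ℂ) * Complex.exp (-(w * (Real.log x : ℂ))))) x := by
    intro x hx
    rw [uIcc_of_le (by norm_num)] at hx
    have hx0 : x ≠ 0 := by linarith [hx.1]
    have hx0' : (x : ℂ) ≠ 0 := by exact_mod_cast hx0
    have h1 : HasDerivAt (fun x : ℝ => ((x * u x : ℝ) : ℂ)) ((u x + x * deriv u x : ℝ) : ℂ) x := by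
      have := ((hasDerivAt_id x).mul (hdiff x).hasDerivAt).ofReal_comp
      simpa using! this
    have h2 := (((Real.hasDerivAt_log hx0).ofReal_comp.const_mul w).neg).cexp
    convert! h1.mul h2 using 1
    simp only [Pi.neg_apply]
    push_cast
    field_simp
    ring
  have hI := intervalIntegral.integral_eq_sub_of_hasDerivAt hder
    ((((hcd.continuousOn).mul hlogc).sub
      (continuousOn_const.mul (hcu.continuousOn.mul hlogc))).intervalIntegrable)
  have i1 : IntervalIntegrable (fun x : ℝ => ((u x + x * deriv u x : ℝ) : ℂ) *
      Complex.exp (-(w * (Real.log x : ℂ)))) volume 1 3 :=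
    (hcd.continuousOn.mul hlogc).intervalIntegrable
  have i2 : IntervalIntegrable (fun x : ℝ => w * ((u x : ℂ) *
      Complex.exp (-(w * (Real.log x : ℂ))))) volume 1 3 :=
    (continuousOn_const.mul (hcu.continuousOn.mul hlogc)).intervalIntegrable
  rw [hz1, hz3, intervalIntegral.integral_sub i1 i2,
    intervalIntegral.integral_const_mul] at hI
  simp only [mul_zero, ofReal_zero, zero_mul, sub_zero] at hI
  have hmel : ∫ x in (1 : ℝ)..3, (u x : ℂ) * Complex.exp (-(w * (Real.log x : ℂ))) =
      weightMellin u w := by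
    rw [intervalIntegral.integral_of_le (by norm_num)]
    exact setIntegral_weight_mul hu hX (S := Ioc 1 3)
      (fun x hx => ⟨by linarith [hx.1], by linarith [hx.2]⟩)
      measurableSet_Ioc _
  rw [hmel, sub_eq_zero] at hI
  rw [← norm_mul, ← hI]
  refine (intervalIntegral.norm_integral_le_of_norm_le_const
    (C := M * Real.exp (B / 2) * Real.exp (-w.re / 2)) fun x hx => ?_).trans (le_of_eq ?_)
  · rw [uIoc_of_le (by norm_num)] at hx
    by_cases hxJ : x ∈ Icc (Real.exp (1 / 2)) (Real.exp 1)
    · rw [norm_mul, Complex.norm_real, mul_assoc]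
      refine mul_le_mul (hM x ⟨hx.1.le, hx.2⟩) ?_ (norm_nonneg _) hM0
      rw [Complex.norm_exp, ← Real.exp_add]
      -- With 1/2 ≤ log x ≤ 1 and Re w ≥ -B, the excess -Re w (log x - 1/2) is at most B/2.
      refine Real.exp_le_exp.2 ?_
      rw [neg_re, re_mul_ofReal]
      have h1 := half_le_log hxJ
      have h2 := log_le_one hxJ
      nlinarith
    · have h0 : u x = 0 := hu.eq_zero_half hX hxJ
      have h1 : deriv u x = 0 := by
        have hx' : x ∉ tsupport u := fun h => hxJ (hu.support_subset_half hX h)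
        rw [(notMem_tsupport_iff_eventuallyEq.1 hx').deriv_eq]
        simp
      rw [h0, h1]
      simp only [mul_zero, add_zero, ofReal_zero, zero_mul, norm_zero]
      positivity
  · rw [abs_of_pos (by norm_num)]; ring

/-- `U(z) ≪ d ^ {-2}`, where `d` is the distance from `0` to the horizontal ray issuing from `z` to
the right. -/
theorem exists_norm_smoothedE1_le (hu : IsWeight X u) (hX : 2 ≤ X) {B : ℝ} (hB : 0 ≤ B) :
    ∃ C, 0 ≤ C ∧ ∀ (z : ℂ) (d : ℝ), 0 < d → -B ≤ z.re → (∀ t : ℝ, 0 ≤ t → d ≤ ‖z + t‖) →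
      ‖smoothedE1 u z‖ ≤ C / d ^ 2 := by
  obtain ⟨C, hC, hCw⟩ := exists_norm_weightMellin_le hu hX hB
  refine ⟨2 * (C * Real.exp (B / 2)), by positivity, fun z d hd hz hdist => ?_⟩
  set A := C * Real.exp (B / 2) / d ^ 2 with hA
  have hA0 : 0 ≤ A := by positivity
  -- A point of the cut would be carried to 0 by moving right, against the distance condition.
  have hslit : ∀ t : ℝ, 0 ≤ t → z + t ∈ slitPlane := by
    intro t ht
    by_contra hmem
    rw [mem_slitPlane_iff, not_or, not_lt, not_not] at hmem
    simp only [add_re, ofReal_re, add_im, ofReal_im, add_zero] at hmem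
    have h1 := hdist (-z.re) (by linarith)
    have h2 : z + ((-z.re : ℝ) : ℂ) = 0 := by
      apply Complex.ext <;> simp [hmem.2]
    rw [h2, norm_zero] at h1
    linarith
  have hder : ∀ t : ℝ, 0 ≤ t → HasDerivAt (fun t : ℝ => smoothedE1 u (z + t))
      (-(weightMellin u (z + t) / (z + t))) t := by
    intro t ht
    have hid : HasDerivAt (fun y : ℝ => z + (y : ℂ)) 1 t :=
      Complex.ofRealCLM.hasDerivAt.const_add z
    convert! (hasDerivAt_smoothedE1 hu hX (hslit t ht)).comp t hid using 1
    rw [mul_one]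
  have hbd : ∀ t : ℝ, 0 ≤ t → ‖-(weightMellin u (z + t) / (z + t))‖ ≤ A * Real.exp (-t / 2) := by
    intro t ht
    have h1 := hCw (z + t) (by simp; linarith)
    have h2 := hdist t ht
    have h3 : 0 < ‖z + t‖ := by linarith
    rw [norm_neg, norm_div, div_le_iff₀ h3]
    have h4 : Real.exp (-(z + t).re / 2) ≤ Real.exp (B / 2) * Real.exp (-t / 2) := by
      rw [← Real.exp_add]
      refine Real.exp_le_exp.2 ?_
      simp only [add_re, ofReal_re]
      linarith
    have h5 : ‖weightMellin u (z + t)‖ ≤ C * (Real.exp (B / 2) * Real.exp (-t / 2)) / ‖z + t‖ := by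
      rw [le_div_iff₀ h3, mul_comm]
      exact h1.trans (mul_le_mul_of_nonneg_left h4 hC)
    refine h5.trans ?_
    rw [div_le_iff₀ h3, hA]
    have h6 : d ^ 2 ≤ ‖z + t‖ ^ 2 := pow_le_pow_left₀ hd.le h2 2
    calc C * (Real.exp (B / 2) * Real.exp (-t / 2)) =
        C * Real.exp (B / 2) / d ^ 2 * Real.exp (-t / 2) * d ^ 2 := by field_simp
      _ ≤ C * Real.exp (B / 2) / d ^ 2 * Real.exp (-t / 2) * ‖z + t‖ ^ 2 := by gcongr
      _ = _ := by ring
  -- U is recovered by integrating its derivative in from +∞ along the ray, with ∫_0^∞ e^{-t/2} dt =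
  -- 2.
  have hmv : ∀ T : ℝ, 0 ≤ T → ‖smoothedE1 u (z + T) - smoothedE1 u (z + (0 : ℝ))‖ ≤ 2 * A := by
    intro T hT
    have hBd : ∀ x : ℝ, HasDerivAt (fun t : ℝ => 2 * A * (1 - Real.exp (-t / 2)))
        (A * Real.exp (-x / 2)) x := by
      intro x
      have := ((((hasDerivAt_id x).neg.div_const 2).exp).const_sub 1).const_mul (2 * A)
      convert! this using 1
      simp only [id, Pi.neg_apply]
      ring
    have := image_norm_le_of_norm_deriv_right_le_deriv_boundary
      (f := fun t : ℝ => smoothedE1 u (z + t) - smoothedE1 u (z + (0 : ℝ))) (a := 0) (b := T)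
      (f' := fun t => -(weightMellin u (z + t) / (z + t)))
      (fun t ht => ((hder t ht.1).sub_const _).continuousAt.continuousWithinAt)
      (fun t ht => ((hder t ht.1).sub_const _).hasDerivWithinAt)
      (by simp) hBd (fun t ht => hbd t ht.1) (right_mem_Icc.2 hT)
    refine this.trans ?_
    have h1 := Real.exp_pos (-T / 2)
    nlinarith
  have hlim : Tendsto (fun T : ℝ => smoothedE1 u (z + T)) atTop (𝓝 0) := by
    have h1 : Tendsto (fun T : ℝ => Real.exp (-((z.re + T) / 2))) atTop (𝓝 0) :=
      Real.tendsto_exp_neg_atTop_nhds_zero.comp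
        ((tendsto_atTop_add_const_left atTop z.re tendsto_id).atTop_div_const (by norm_num))
    refine squeeze_zero_norm' ?_ h1
    filter_upwards [eventually_ge_atTop (2 - z.re)] with T hT
    have hre : (z + T).re = z.re + T := by simp
    refine (norm_smoothedE1_le hu hX (z := z + T) (by rw [hre]; linarith)).trans ?_
    rw [hre, neg_div]
    exact div_le_self (Real.exp_pos _).le (by linarith)
  have hfin : Tendsto (fun T : ℝ => ‖smoothedE1 u (z + T) - smoothedE1 u (z + (0 : ℝ))‖) atTop
      (𝓝 ‖0 - smoothedE1 u (z + (0 : ℝ))‖) := (hlim.sub_const _).norm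
  have hle := le_of_tendsto hfin (eventually_atTop.2 ⟨0, fun T hT => hmv T hT⟩)
  rw [zero_sub, norm_neg, ofReal_zero, add_zero] at hle
  refine hle.trans (le_of_eq ?_)
  rw [hA]; ring

end Smoothed

/-! ### The test function k(y) = F(y/a)/y. -/

section Cutoff

variable {X : ℝ} {u : ℝ → ℝ}

/-- The mass of the weight `u` to the left of `e ^ t`. -/
noncomputable def weightCDF (u : ℝ → ℝ) (t : ℝ) : ℝ := ∫ x in (0 : ℝ)..Real.exp t, u x

theorem hasDerivAt_weightCDF (hu : IsWeight X u) (t : ℝ) :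
    HasDerivAt (weightCDF u) (u (Real.exp t) * Real.exp t) t := by
  have h := (hu.continuous.integral_hasStrictDerivAt 0 (Real.exp t)).hasDerivAt
  exact h.comp t (Real.hasDerivAt_exp t)

theorem contDiff_weightCDF (hu : IsWeight X u) : ContDiff ℝ ∞ (weightCDF u) := by
  rw [contDiff_infty_iff_deriv]
  refine ⟨fun t => (hasDerivAt_weightCDF hu t).differentiableAt, ?_⟩
  rw [funext fun t => (hasDerivAt_weightCDF hu t).deriv]
  exact (hu.smooth.comp Real.contDiff_exp).mul Real.contDiff_exp

theorem weightCDF_of_le (hu : IsWeight X u) {t : ℝ} (ht : t ≤ 1 - 1 / X) : weightCDF u t = 0 := by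
  rw [weightCDF]
  have h : ∀ x ∈ Ioo 0 (Real.exp t), u x = 0 := fun x hx => hu.eq_zero fun h => by
    have := Real.exp_le_exp.2 ht
    linarith [hx.2, h.1]
  rw [intervalIntegral.integral_of_le (Real.exp_pos t).le, ← integral_Ioc_eq_integral_Ioo.symm]
  rw [setIntegral_congr_fun measurableSet_Ioo h]
  simp

theorem weightCDF_of_one_le (hu : IsWeight X u) (hX : 2 ≤ X) {t : ℝ} (ht : 1 ≤ t) :
    weightCDF u t = 1 := by
  rw [weightCDF, intervalIntegral.integral_of_le (Real.exp_pos t).le, ← hu.mass_one]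
  refine setIntegral_eq_integral_of_forall_compl_eq_zero fun x hx => ?_
  refine image_eq_zero_of_notMem_tsupport fun h => hx ?_
  have h' := hu.support_subset_half hX h
  exact ⟨(Real.exp_pos _).trans_le h'.1, h'.2.trans (Real.exp_le_exp.2 ht)⟩

theorem weightCDF_nonneg (hu : IsWeight X u) (t : ℝ) : 0 ≤ weightCDF u t :=
  intervalIntegral.integral_nonneg (Real.exp_pos t).le fun x _ => hu.nonneg x

theorem weightCDF_le_one (hu : IsWeight X u) (hX : 2 ≤ X) (t : ℝ) : weightCDF u t ≤ 1 := by
  have hmono : Monotone (weightCDF u) := monotone_of_deriv_nonneg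
    (fun t => (hasDerivAt_weightCDF hu t).differentiableAt) fun t => by
      rw [(hasDerivAt_weightCDF hu t).deriv]
      exact mul_nonneg (hu.nonneg _) (Real.exp_pos _).le
  rw [← weightCDF_of_one_le hu hX (le_max_right t 1)]
  exact hmono (le_max_left t 1)

theorem weightCDF_of_le_half (hu : IsWeight X u) (hX : 2 ≤ X) {t : ℝ} (ht : t ≤ 1 / 2) :
    weightCDF u t = 0 := by
  refine weightCDF_of_le hu (ht.trans ?_)
  have : 1 / X ≤ 1 / 2 := one_div_le_one_div_of_le (by norm_num) hX
  linarith

/-- The test function whose Laplace transform is `U`. -/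
noncomputable def cutoffKernel (u : ℝ → ℝ) (a y : ℝ) : ℝ := weightCDF u (y / a) / y

variable {a : ℝ}

theorem cutoffKernel_of_le (hu : IsWeight X u) (hX : 2 ≤ X) (ha : 0 < a) {y : ℝ}
    (hy : y ≤ a / 2) : cutoffKernel u a y = 0 := by
  rw [cutoffKernel, weightCDF_of_le_half hu hX, zero_div]
  rw [div_le_iff₀ ha]; linarith

theorem cutoffKernel_of_ge (hu : IsWeight X u) (hX : 2 ≤ X) (ha : 0 < a) {y : ℝ}
    (hy : a ≤ y) : cutoffKernel u a y = y⁻¹ := by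
  rw [cutoffKernel, weightCDF_of_one_le hu hX, one_div]
  rwa [one_le_div ha]

/-- The pole of 1/y is invisible because F(y/a) vanishes for y ≤ a/2. -/
theorem contDiff_cutoffKernel (hu : IsWeight X u) (hX : 2 ≤ X) (ha : 0 < a) :
    ContDiff ℝ ∞ (cutoffKernel u a) := by
  rw [contDiff_iff_contDiffAt]
  intro y
  by_cases hy : y < a / 2
  · refine (contDiffAt_const (c := (0 : ℝ))).congr_of_eventuallyEq ?_
    filter_upwards [Iio_mem_nhds hy] with x hx
    exact cutoffKernel_of_le hu hX ha (le_of_lt hx)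
  · have hy0 : y ≠ 0 := by linarith
    have h1 : ContDiff ℝ ∞ fun y => weightCDF u (y / a) :=
      (contDiff_weightCDF hu).comp (contDiff_id.div_const a)
    exact h1.contDiffAt.div contDiffAt_id hy0

theorem norm_cutoffKernel_le (hu : IsWeight X u) (hX : 2 ≤ X) (ha : 0 < a) (y : ℝ) :
    ‖cutoffKernel u a y‖ ≤ 2 / a := by
  by_cases hy : y ≤ a / 2
  · rw [cutoffKernel_of_le hu hX ha hy, norm_zero]; positivity
  · push Not at hy
    have hy0 : 0 < y := by linarith
    rw [cutoffKernel, norm_div, Real.norm_of_nonneg (weightCDF_nonneg hu _),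
      Real.norm_of_nonneg hy0.le, div_le_div_iff₀ hy0 ha]
    have := weightCDF_le_one hu hX (y / a)
    nlinarith

theorem deriv_cutoffKernel_of_gt (hu : IsWeight X u) (hX : 2 ≤ X) (ha : 0 < a) {y : ℝ}
    (hy : a < y) : deriv (cutoffKernel u a) y = -(y ^ 2)⁻¹ := by
  have h : cutoffKernel u a =ᶠ[𝓝 y] fun y => y⁻¹ := by
    filter_upwards [Ioi_mem_nhds hy] with x hx
    exact cutoffKernel_of_ge hu hX ha (le_of_lt hx)
  rw [h.deriv_eq, deriv_inv]

theorem deriv_deriv_cutoffKernel_of_gt (hu : IsWeight X u) (hX : 2 ≤ X) (ha : 0 < a) {y : ℝ}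
    (hy : a < y) : deriv (deriv (cutoffKernel u a)) y = 2 * y ^ (-3 : ℝ) := by
  have h : deriv (cutoffKernel u a) =ᶠ[𝓝 y] fun y => -(y ^ 2)⁻¹ := by
    filter_upwards [Ioi_mem_nhds hy] with x hx
    exact deriv_cutoffKernel_of_gt hu hX ha hx
  have hy0 : y ≠ 0 := by linarith
  have hd := ((hasDerivAt_pow 2 y).inv (pow_ne_zero 2 hy0)).neg
  rw [h.deriv_eq]
  refine Eq.trans (HasDerivAt.deriv hd) ?_
  rw [Real.rpow_neg (by linarith), show (3 : ℝ) = (3 : ℕ) by norm_num, Real.rpow_natCast]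
  field_simp
  norm_num
  ring

theorem integrableOn_deriv_deriv_cutoffKernel (hu : IsWeight X u) (hX : 2 ≤ X) (ha : 0 < a) :
    IntegrableOn (deriv (deriv (cutoffKernel u a))) (Ioi 0) := by
  have hc : Continuous (deriv (deriv (cutoffKernel u a))) :=
    ((contDiff_infty_iff_deriv.1
      (contDiff_infty_iff_deriv.1 (contDiff_cutoffKernel hu hX ha)).2).2).continuous
  rw [← Ioc_union_Ioi_eq_Ioi ha.le]
  refine hc.integrableOn_Ioc.union ?_
  refine IntegrableOn.congr_fun
    ((integrableOn_Ioi_rpow_of_lt (show (-3 : ℝ) < -1 by norm_num) ha).const_mul 2)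
    (fun y hy => (deriv_deriv_cutoffKernel_of_gt hu hX ha hy).symm) measurableSet_Ioi

/-- `U` is a Laplace transform. -/
theorem smoothedE1_mul_eq_integral (hu : IsWeight X u) (hX : 2 ≤ X) (ha : 0 < a) {l : ℂ}
    (hl : 0 < l.re) :
    smoothedE1 u (l * a) =
      ∫ y : ℝ in Ioi 0, (cutoffKernel u a y : ℂ) * Complex.exp (-l * y) := by
  set f : ℝ → ℂ := fun y =>
    ((u (Real.exp (y / a)) * Real.exp (y / a) * (1 / a) : ℝ) : ℂ) * expIntegralE1 (l * y) with hf
  -- Starting at a/4, strictly inside the region where F(y/a) = 0, avoids the singularity of E₁ at 0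
  -- and kills the boundary term.
  have ha4 : 0 < a / 4 := by linarith
  have hder : ∀ y : ℝ, y ∈ Ici (a / 4) → HasDerivAt
      (fun y : ℝ => (weightCDF u (y / a) : ℂ) * expIntegralE1 (l * y))
      (f y - (cutoffKernel u a y : ℂ) * Complex.exp (-l * y)) y := by
    intro y hy
    have hy0 : 0 < y := ha4.trans_le hy
    have h1 : HasDerivAt (fun y : ℝ => (weightCDF u (y / a) : ℂ))
        ((u (Real.exp (y / a)) * Real.exp (y / a) * (1 / a) : ℝ) : ℂ) y :=
      (HasDerivAt.comp (h₂ := weightCDF u) (h := fun y => y / a) y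
        (hasDerivAt_weightCDF hu (y / a)) ((hasDerivAt_id y).div_const a)).ofReal_comp
    convert! h1.mul (hasDerivAt_expIntegralE1_mul hl hy0) using 1
    rw [hf, cutoffKernel]
    push_cast
    ring
  have hEc : ContinuousOn (fun y : ℝ => expIntegralE1 (l * y)) (Ici (a / 4)) := fun y hy =>
    (hasDerivAt_expIntegralE1_mul hl (ha4.trans_le hy)).continuousAt.continuousWithinAt
  have hgc : Continuous fun y : ℝ =>
      ((u (Real.exp (y / a)) * Real.exp (y / a) * (1 / a) : ℝ) : ℂ) := by
    have := hu.continuous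
    fun_prop
  have hfz : ∀ y : ℝ, a < y → f y = 0 := by
    intro y hy
    have : u (Real.exp (y / a)) = 0 := hu.eq_zero_half hX fun h => by
      have h1 := Real.exp_le_exp.1 h.2
      rw [div_le_one ha] at h1
      linarith
    rw [hf]
    simp [this]
  have hfc : ContinuousOn f (Icc (a / 4) a) :=
    (hgc.continuousOn).mul (hEc.mono Icc_subset_Ici_self)
  have if1 : IntegrableOn f (Ioc (a / 4) a) := hfc.integrableOn_Icc.mono_set Ioc_subset_Icc_self
  have if2 : IntegrableOn f (Ioi a) :=
    IntegrableOn.congr_fun integrableOn_zero (fun y hy => (hfz y hy).symm) measurableSet_Ioi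
  have hfi : IntegrableOn f (Ioi (a / 4)) := by
    rw [← Ioc_union_Ioi_eq_Ioi (show a / 4 ≤ a by linarith)]
    exact if1.union if2
  have hkc : Continuous (fun y : ℝ => (cutoffKernel u a y : ℂ)) :=
    Complex.continuous_ofReal.comp (contDiff_cutoffKernel hu hX ha).continuous
  have hki : ∀ c : ℝ, IntegrableOn
      (fun y : ℝ => (cutoffKernel u a y : ℂ) * Complex.exp (-l * y)) (Ioi c) := fun c =>
    Integrable.bdd_mul (c := 2 / a) (integrableOn_exp_neg_mul hl c) hkc.aestronglyMeasurable
      (Eventually.of_forall fun y => by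
        rw [Complex.norm_real]; exact norm_cutoffKernel_le hu hX ha y)
  have hlim : Tendsto (fun y : ℝ => (weightCDF u (y / a) : ℂ) * expIntegralE1 (l * y)) atTop
      (𝓝 0) := by
    refine (tendsto_expIntegralE1_mul hl).congr' ?_
    filter_upwards [eventually_ge_atTop a] with y hy
    rw [weightCDF_of_one_le hu hX (by rwa [one_le_div ha]), ofReal_one, one_mul]
  have hI := integral_Ioi_of_hasDerivAt_of_tendsto' hder (hfi.sub (hki _)) hlim
  have h0 : weightCDF u (a / 4 / a) = 0 := weightCDF_of_le_half hu hX (by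
    rw [div_le_iff₀ ha]; linarith)
  rw [h0, ofReal_zero, zero_mul, sub_zero, integral_sub hfi (hki _), sub_eq_zero] at hI
  have hk0 : ∫ y : ℝ in Ioi 0, (cutoffKernel u a y : ℂ) * Complex.exp (-l * y) =
      ∫ y : ℝ in Ioi (a / 4), (cutoffKernel u a y : ℂ) * Complex.exp (-l * y) := by
    refine setIntegral_eq_of_subset_of_forall_sdiff_eq_zero measurableSet_Ioi
      (Ioi_subset_Ioi ha4.le) fun y hy => ?_
    have : y ≤ a / 4 := by simpa using hy.2
    rw [cutoffKernel_of_le hu hX ha (by linarith), ofReal_zero, zero_mul]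
  rw [hk0, ← hI, ← Ioc_union_Ioi_eq_Ioi (show a / 4 ≤ a by linarith),
    setIntegral_union (Ioc_disjoint_Ioi le_rfl) measurableSet_Ioi if1 if2,
    setIntegral_congr_fun measurableSet_Ioi hfz]
  simp only [integral_zero, add_zero]
  rw [← intervalIntegral.integral_of_le (by linarith)]
  -- The substitution x = e^{y/a} turns the integral of F' against E₁(ly) into U(la).
  have hsub := intervalIntegral.integral_deriv_smul_comp_of_deriv_nonneg (a := a / 4) (b := a)
    (f := fun y => Real.exp (y / a)) (f' := fun y => Real.exp (y / a) * (1 / a))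
    (g := fun x => (u x : ℂ) * expIntegralE1 (l * a * (Real.log x : ℂ)))
    (by fun_prop)
    (fun y _ => ((hasDerivAt_id y).div_const a).exp)
    (fun y _ => by positivity)
  have hsub' : ∫ y in (a / 4)..a, f y = ∫ x in Real.exp (a / 4 / a)..Real.exp (a / a),
      (u x : ℂ) * expIntegralE1 (l * a * (Real.log x : ℂ)) := by
    rw [← hsub]
    congr 1
    funext y
    have hac : (a : ℂ) ≠ 0 := ofReal_ne_zero.2 ha.ne'
    have e : l * (a : ℂ) * ((y / a : ℝ) : ℂ) = l * y := by push_cast; field_simp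
    simp only [hf, Function.comp, Real.log_exp, e, Complex.real_smul]
    push_cast
    ring
  have hq : a / 4 / a = 1 / 4 := by field_simp
  rw [hsub', div_self ha.ne', hq, intervalIntegral.integral_of_le
      (Real.exp_le_exp.2 (by norm_num)), setIntegral_weight_mul hu hX _ measurableSet_Ioc,
    smoothedE1_eq_setIntegral hu hX]
  exact fun x hx => ⟨(Real.exp_lt_exp.2 (by norm_num)).trans_le hx.1, hx.2⟩

end Cutoff

/-! ### The explicit formula in the half-plane Re s > 1. -/

namespace DirichletCharacter

variable {q : ℕ} [NeZero q] {χ : DirichletCharacter ℂ q}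

theorem IsPrimitive.one_le_order (hχ : χ.IsPrimitive) (hq : 1 < q) (ρ : χ.zeros) :
    1 ≤ analyticOrderNatAt (LFunction χ) ρ :=
  one_le_analyticOrderNatAt (differentiable_LFunction (hχ.ne_one hq))
    (LFunction_two_ne_zero χ) ρ.2

theorem IsPrimitive.countable_zeros (hχ : χ.IsPrimitive) (hq : 1 < q) : Countable χ.zeros := by
  have h := (hχ.summable_zeros hq).countable_support
  have e : Function.support (fun ρ : χ.zeros => (analyticOrderNatAt (LFunction χ) ρ : ℝ) *
      (1 / (1 + ‖(ρ : ℂ)‖) ^ 2)) = univ := by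
    refine eq_univ_of_forall fun ρ => ?_
    have : (0 : ℝ) < analyticOrderNatAt (LFunction χ) ρ := by
      exact_mod_cast hχ.one_le_order hq ρ
    rw [Function.mem_support]
    positivity
  rw [e] at h
  exact countable_univ_iff.1 h

theorem IsPrimitive.finite_zeros_norm_le (hχ : χ.IsPrimitive) (hq : 1 < q) (R : ℝ) :
    {ρ : χ.zeros | ‖(ρ : ℂ)‖ ≤ R}.Finite := by
  by_cases hR : 0 ≤ R
  · have h := (hχ.summable_zeros hq).tendsto_cofinite_zero.eventually
      (gt_mem_nhds (show (0 : ℝ) < 1 / (1 + R) ^ 2 by positivity))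
    rw [eventually_cofinite] at h
    refine h.subset fun ρ hρ => ?_
    rw [mem_ofPred_eq] at hρ ⊢
    rw [not_lt]
    have h1 : (1 : ℝ) ≤ analyticOrderNatAt (LFunction χ) ρ := by
      exact_mod_cast hχ.one_le_order hq ρ
    calc 1 / (1 + R) ^ 2 ≤ 1 / (1 + ‖(ρ : ℂ)‖) ^ 2 := by gcongr
      _ ≤ _ := le_mul_of_one_le_left (by positivity) h1
  · convert! finite_empty
    refine eq_empty_of_forall_notMem fun ρ hρ => hR ((norm_nonneg _).trans hρ)

variable {X a : ℝ} {u : ℝ → ℝ}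

/-- The explicit formula with the smooth cutoff, in the half-plane of absolute convergence. -/
theorem IsPrimitive.hasSum_smoothedE1 (hχ : χ.IsPrimitive) (hq : 1 < q) (hu : IsWeight X u)
    (hX : 2 ≤ X) (ha : 0 < a) {s : ℂ} (hs : 1 < s.re) :
    HasSum (fun ρ : χ.zeros =>
      (analyticOrderNatAt (LFunction χ) ρ : ℂ) * smoothedE1 u ((s - ρ) * a))
      (-∑' n : ℕ, χ.mangoldtCoeff n * (n : ℂ) ^ (-s) * (cutoffKernel u a (Real.log n) : ℂ)) := by
  have hχ1 := hχ.ne_one hq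
  have := hχ.countable_zeros hq
  have hl : ∀ ρ : χ.zeros, 0 < (s - ρ).re := fun ρ => by
    have := zeros_re_lt_one hχ1 ρ
    rw [sub_re]; linarith
  have hsL : LFunction χ s ≠ 0 := fun h => by
    have := zeros_re_lt_one hχ1 ⟨s, h⟩
    simp only at this; linarith
  have hm : Summable fun ρ : χ.zeros =>
      ‖(analyticOrderNatAt (LFunction χ) ρ : ℂ)‖ / ‖s - ρ‖ ^ 2 := by
    obtain ⟨C, hC, hCρ⟩ := exists_one_add_norm_le_mul_norm_sub
      (differentiable_LFunction hχ1) hsL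
    refine Summable.of_nonneg_of_le (fun _ => by positivity) (fun ρ => ?_)
      ((hχ.summable_zeros hq).mul_left (C ^ 2))
    have h1 := hCρ ρ ρ.2
    have h0 : 0 < ‖s - ρ‖ := norm_pos_iff.2 (Complex.ne_zero_of_re_pos (hl ρ))
    rw [Complex.norm_natCast, show C ^ 2 * ((analyticOrderNatAt (LFunction χ) ρ : ℝ) *
      (1 / (1 + ‖(ρ : ℂ)‖) ^ 2)) = analyticOrderNatAt (LFunction χ) ρ *
        (C ^ 2 / (1 + ‖(ρ : ℂ)‖) ^ 2) by ring, div_eq_mul_one_div]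
    refine mul_le_mul_of_nonneg_left ?_ (Nat.cast_nonneg _)
    rw [div_le_div_iff₀ (by positivity) (by positivity), one_mul, ← mul_pow]
    gcongr
  have hc : Summable fun n : ℕ =>
      ‖-(χ.mangoldtCoeff n * (n : ℂ) ^ (-s))‖ * Real.log n := by
    simpa only [norm_neg] using summable_mangoldtCoeff_log χ hs
  -- Two expansions of L'/L(s) - L'/L(s+w): over the zeros, and as a Dirichlet series.
  have h : ∀ w : ℂ, 0 < w.re →
      ∑' ρ : χ.zeros, (analyticOrderNatAt (LFunction χ) ρ : ℂ) *
        (1 / (s - ρ) - 1 / (s - ρ + w)) =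
      ∑' n : ℕ, -(χ.mangoldtCoeff n * (n : ℂ) ^ (-s)) *
        (1 - Complex.exp (-w * (Real.log n : ℝ))) := by
    intro w hw
    have hsw : 1 < (s + w).re := by rw [add_re]; linarith
    have h1 := (hχ.hasSum_logDeriv_LFunction_sub hq hs hsw).tsum_eq
    have h2 : ∀ n : ℕ, -(χ.mangoldtCoeff n * (n : ℂ) ^ (-s)) *
        (1 - Complex.exp (-w * (Real.log n : ℝ))) =
        χ.mangoldtCoeff n * (n : ℂ) ^ (-(s + w)) - χ.mangoldtCoeff n * (n : ℂ) ^ (-s) := by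
      intro n
      rcases Nat.eq_zero_or_pos n with rfl | hn
      · simp [mangoldtCoeff_of_le_one]
      have hn0 : (n : ℂ) ≠ 0 := by exact_mod_cast hn.ne'
      rw [neg_add, Complex.cpow_add _ _ hn0, Complex.cpow_def_of_ne_zero hn0 (-w),
        ← Complex.natCast_log, mul_comm (Complex.ofReal _) (-w)]
      ring
    rw [tsum_congr h2, (summable_mangoldtCoeff χ hsw).tsum_sub (summable_mangoldtCoeff χ hs),
      tsum_mangoldtCoeff χ hsw, tsum_mangoldtCoeff χ hs, neg_sub_neg, ← h1]
    refine tsum_congr fun ρ => ?_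
    rw [sub_add_eq_add_sub]
  have hk := contDiff_cutoffKernel hu hX ha
  have hk1 := contDiff_infty_iff_deriv.1 hk
  have hk2 := contDiff_infty_iff_deriv.1 hk1.2
  have hzero : cutoffKernel u a =ᶠ[𝓝 0] fun _ => 0 := by
    filter_upwards [Iio_mem_nhds (show 0 < a / 2 by linarith)] with y hy
    exact cutoffKernel_of_le hu hX ha (le_of_lt hy)
  have hlim : Tendsto (fun y => ((deriv (cutoffKernel u a) y : ℝ) : ℂ)) atTop (𝓝 0) := by
    rw [← ofReal_zero]
    refine (Complex.continuous_ofReal.tendsto 0).comp ?_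
    have : Tendsto (fun y : ℝ => -(y ^ 2)⁻¹) atTop (𝓝 0) := by
      rw [← neg_zero]
      exact (tendsto_inv_atTop_zero.comp (tendsto_pow_atTop two_ne_zero)).neg
    refine this.congr' ?_
    filter_upwards [eventually_gt_atTop a] with y hy
    exact (deriv_cutoffKernel_of_gt hu hX ha hy).symm
  have key := hasSum_integral_mul_exp (m := fun ρ : χ.zeros =>
      (analyticOrderNatAt (LFunction χ) ρ : ℂ)) (l := fun ρ : χ.zeros => s - ρ)
    (c := fun n : ℕ => -(χ.mangoldtCoeff n * (n : ℂ) ^ (-s))) (x := fun n : ℕ => Real.log n)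
    (k := fun y => (cutoffKernel u a y : ℂ)) (k₁ := fun y => ((deriv (cutoffKernel u a) y : ℝ) : ℂ))
    (k₂ := fun y => ((deriv (deriv (cutoffKernel u a)) y : ℝ) : ℂ)) (B := 2 / a)
    hl hm (fun n => Real.log_natCast_nonneg n) hc h
    (fun y => (hk1.1 y).hasDerivAt.ofReal_comp) (fun y => (hk2.1 y).hasDerivAt.ofReal_comp)
    (Complex.continuous_ofReal.comp hk2.2.continuous)
    (integrableOn_deriv_deriv_cutoffKernel hu hX ha).ofReal
    (by simpa using hzero.eq_of_nhds)
    (by rw [hzero.deriv_eq]; simp) hlim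
    (fun y => by rw [Complex.norm_real]; exact norm_cutoffKernel_le hu hX ha y)
  convert key using 1
  · funext ρ
    rw [smoothedE1_mul_eq_integral hu hX ha (hl ρ)]
  · rw [← tsum_neg]
    exact tsum_congr fun n => by ring

end DirichletCharacter

/-! ### The product formula and its continuation to the central point. -/

namespace DirichletCharacter

variable {q : ℕ} [NeZero q] {χ : DirichletCharacter ℂ q} {X : ℝ} {u : ℝ → ℝ}

/-- The logarithm of the smoothed Euler product of length `X`. -/
noncomputable def smoothedPrimeSum (χ : DirichletCharacter ℂ q) (u : ℝ → ℝ) (X : ℝ) (s : ℂ) : ℂ :=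
  ∑ n ∈ Finset.Icc 2 ⌊X⌋₊, χ.mangoldtCoeff n * (n : ℂ) ^ (-s) *
    ((1 - weightCDF u (Real.log n / Real.log X)) / Real.log n : ℝ)

theorem norm_inv_log_natCast_le (n : ℕ) : ‖((Real.log n)⁻¹ : ℝ)‖ ≤ 2 := by
  rcases Nat.lt_or_ge n 2 with hn | hn
  · interval_cases n <;> simp
  · have h2 : (1 : ℝ) / 2 ≤ Real.log n := by
      have := Real.log_two_gt_d9
      have := Real.log_le_log (by norm_num) (show (2 : ℝ) ≤ n by exact_mod_cast hn)
      linarith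
    rw [norm_inv, Real.norm_of_nonneg (by linarith)]
    rw [inv_le_comm₀ (by linarith) (by norm_num)]
    linarith

theorem LFunction_eq_exp_tsum (χ : DirichletCharacter ℂ q) {s : ℂ} (hs : 1 < s.re) :
    LFunction χ s = Complex.exp
      (∑' n : ℕ, χ.mangoldtCoeff n * (n : ℂ) ^ (-s) * ((Real.log n)⁻¹ : ℝ)) := by
  rw [LFunction_eq_LSeries χ hs, ← LSeries_eq_exp_LSeries χ hs, LSeries]
  congr 1
  refine tsum_congr fun n => ?_
  rcases Nat.eq_zero_or_pos n with rfl | hn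
  · simp [mangoldtCoeff_of_le_one]
  rw [LSeries.term_of_ne_zero hn.ne', mangoldtCoeff, Complex.cpow_neg]
  push_cast
  ring

theorem summable_mangoldtCoeff_mul {N : ℕ} (χ : DirichletCharacter ℂ N) {s : ℂ} (hs : 1 < s.re)
    {b : ℕ → ℝ} {B : ℝ} (hb : ∀ n, ‖b n‖ ≤ B) :
    Summable fun n : ℕ => χ.mangoldtCoeff n * (n : ℂ) ^ (-s) * (b n : ℂ) := by
  refine Summable.of_norm_bounded ((summable_mangoldtCoeff χ hs).norm.mul_right B) fun n => ?_
  rw [norm_mul, Complex.norm_real]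
  exact mul_le_mul_of_nonneg_left (hb n) (norm_nonneg _)

/-- Subtracting the explicit formula from the Dirichlet series of log L leaves coefficients with the
factor 1 - F(log n/log X), which vanish for n ≥ X; the prime sum becomes finite. -/
theorem IsPrimitive.LFunction_eq_of_one_lt_re (hχ : χ.IsPrimitive) (hq : 1 < q)
    (hu : IsWeight X u) (hX : 2 ≤ X) {s : ℂ} (hs : 1 < s.re) :
    LFunction χ s = Complex.exp (χ.smoothedPrimeSum u X s) *
      Complex.exp (-∑' ρ : χ.zeros, (analyticOrderNatAt (LFunction χ) ρ : ℂ) *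
        smoothedE1 u ((s - ρ) * (Real.log X : ℂ))) := by
  have ha : 0 < Real.log X := Real.log_pos (by linarith)
  rw [(hχ.hasSum_smoothedE1 hq hu hX ha hs).tsum_eq, neg_neg, ← Complex.exp_add,
    LFunction_eq_exp_tsum χ hs]
  congr 1
  have h1 := summable_mangoldtCoeff_mul χ hs norm_inv_log_natCast_le
  have h2 := summable_mangoldtCoeff_mul χ hs
    fun n => norm_cutoffKernel_le hu hX ha (Real.log (n : ℕ))
  rw [← sub_eq_iff_eq_add, ← h1.tsum_sub h2, smoothedPrimeSum]
  rw [tsum_eq_sum (s := Finset.Icc 2 ⌊X⌋₊)]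
  · refine Finset.sum_congr rfl fun n _ => ?_
    rw [cutoffKernel]
    push_cast
    ring
  · intro n hn
    rw [Finset.mem_Icc, not_and_or, not_le, not_le] at hn
    rcases hn with hn | hn
    · have hn1 : n ≤ 1 := by omega
      rw [mangoldtCoeff_of_le_one χ hn1]; ring
    · rw [cutoffKernel_of_ge hu hX ha, sub_self]
      exact Real.log_le_log (by linarith) (Nat.lt_of_floor_lt hn).le

/-- The entire function which agrees with `exp (-U)` away from the origin. -/
noncomputable def expNegSmoothedE1 (u : ℝ → ℝ) (z : ℂ) : ℂ :=
  z * Complex.exp (-smoothedConst u - smoothedEin u z)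

theorem differentiable_expNegSmoothedE1 (hu : IsWeight X u) :
    Differentiable ℂ (expNegSmoothedE1 u) := by
  have := differentiable_smoothedEin hu
  unfold expNegSmoothedE1
  fun_prop

theorem differentiable_smoothedPrimeSum {N : ℕ} (χ : DirichletCharacter ℂ N) (u : ℝ → ℝ) (X : ℝ) :
    Differentiable ℂ (χ.smoothedPrimeSum u X) := by
  unfold smoothedPrimeSum
  refine Differentiable.fun_sum fun n hn => ?_
  have hn0 : (n : ℂ) ≠ 0 := by
    have := (Finset.mem_Icc.1 hn).1
    exact_mod_cast (by omega : n ≠ 0)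
  refine Differentiable.mul_const (Differentiable.const_mul ?_ _) _
  exact fun s => (differentiableAt_id.neg).const_cpow (Or.inl hn0)

/-- A rectangle containing both the central point and points of absolute convergence. -/
def centralBox : Set ℂ := {s | 1 / 4 < s.re ∧ s.re < 3 ∧ -1 < s.im ∧ s.im < 1}

theorem isOpen_centralBox : IsOpen centralBox :=
  ((isOpen_lt continuous_const continuous_re).inter
    ((isOpen_lt continuous_re continuous_const).inter
    ((isOpen_lt continuous_const continuous_im).inter (isOpen_lt continuous_im continuous_const))))

theorem convex_centralBox : Convex ℝ centralBox :=
  (convex_halfSpace_re_gt _).inter ((convex_halfSpace_re_lt _).inter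
    ((convex_halfSpace_im_gt _).inter (convex_halfSpace_im_lt _)))

/-- For a trivial zero -n the real part is at least (1/4 + n)a, which is why the box stays in Re s >
1/4. A non-trivial zero has |Im ρ| ≥ |ρ| - 1, hence |Im(s - ρ)| ≥ |ρ| - 2, and this is at least (1 +
|ρ|)/4 once |ρ| ≥ 3. -/
theorem IsPrimitive.le_norm_ray (hχ : χ.IsPrimitive) (hq : 1 < q) {ρ : χ.zeros}
    (hρ : 3 < ‖(ρ : ℂ)‖) {s : ℂ} (hs : s ∈ centralBox) {a t : ℝ} (ha : 0 < a) (ht : 0 ≤ t) :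
    a * (1 + ‖(ρ : ℂ)‖) / 4 ≤ ‖(s - ρ) * a + t‖ := by
  obtain ⟨h1, h2, h3, h4⟩ := hs
  rcases le_or_gt (ρ : ℂ).re 0 with hre | hre
  · obtain ⟨⟨n, hn⟩, -⟩ := hχ.trivial_zero hq ρ.2 hre
    refine le_trans ?_ ((le_abs_self _).trans (abs_re_le_norm _))
    have hn0 : (0 : ℝ) ≤ n := Nat.cast_nonneg n
    simp [hn]
    nlinarith [mul_nonneg ha.le hn0, mul_pos ha (sub_pos.2 h1)]
  · have hlt := zeros_re_lt_one (hχ.ne_one hq) ρ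
    refine le_trans ?_ (abs_im_le_norm _)
    have h5 := norm_le_abs_re_add_abs_im (ρ : ℂ)
    rw [abs_of_pos hre] at h5
    have h6 : ‖(ρ : ℂ)‖ - 2 ≤ |s.im - (ρ : ℂ).im| := by
      have h7 : |(ρ : ℂ).im| - |s.im| ≤ |(ρ : ℂ).im - s.im| := abs_sub_abs_le_abs_sub _ _
      rw [abs_sub_comm] at h7
      have := abs_lt.2 ⟨h3, h4⟩
      linarith
    have e : ((s - ρ) * a + t).im = (s.im - (ρ : ℂ).im) * a := by simp
    rw [e, abs_mul, abs_of_pos ha]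
    nlinarith

theorem IsPrimitive.exists_norm_smoothedE1_le (hχ : χ.IsPrimitive) (hq : 1 < q)
    (hu : IsWeight X u) (hX : 2 ≤ X) {a : ℝ} (ha : 0 < a) :
    ∃ C, ∀ ρ : χ.zeros, 3 < ‖(ρ : ℂ)‖ → ∀ s ∈ centralBox,
      ‖(analyticOrderNatAt (LFunction χ) ρ : ℂ) * smoothedE1 u ((s - ρ) * a)‖ ≤
        C * ((analyticOrderNatAt (LFunction χ) ρ : ℝ) * (1 / (1 + ‖(ρ : ℂ)‖) ^ 2)) := by
  -- B = a suffices because Re ρ < 1 and Re s > 0 give Re((s - ρ)a) ≥ -a.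
  obtain ⟨C, hC, hCz⟩ := _root_.exists_norm_smoothedE1_le hu hX ha.le
  refine ⟨C * (16 / a ^ 2), fun ρ hρ s hs => ?_⟩
  have h := hCz ((s - ρ) * a) (a * (1 + ‖(ρ : ℂ)‖) / 4) (by positivity) ?_
    fun t ht => hχ.le_norm_ray hq hρ hs ha ht
  · rw [norm_mul, Complex.norm_natCast]
    refine (mul_le_mul_of_nonneg_left h (Nat.cast_nonneg _)).trans (le_of_eq ?_)
    have : 1 + ‖(ρ : ℂ)‖ ≠ 0 := by positivity
    field_simp
    ring
  · have hlt := zeros_re_lt_one (hχ.ne_one hq) ρ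
    have : ((s - ρ) * (a : ℂ)).re = (s.re - (ρ : ℂ).re) * a := by simp
    rw [this]
    nlinarith [hs.1]

theorem mem_slitPlane_of_forall_add_ne_zero {z : ℂ} (hz : ∀ t : ℝ, 0 ≤ t → z + t ≠ 0) :
    z ∈ slitPlane := by
  rw [mem_slitPlane_iff]
  by_contra! h
  exact hz (-z.re) (by linarith) (Complex.ext (by simp) (by simp [h.2]))

theorem IsPrimitive.differentiableOn_smoothedE1 (hχ : χ.IsPrimitive) (hq : 1 < q)
    (hu : IsWeight X u) (hX : 2 ≤ X) {a : ℝ} (ha : 0 < a) {ρ : χ.zeros}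
    (hρ : 3 < ‖(ρ : ℂ)‖) :
    DifferentiableOn ℂ (fun s => (analyticOrderNatAt (LFunction χ) ρ : ℂ) *
      smoothedE1 u ((s - ρ) * a)) centralBox := by
  intro s hs
  have hz : (s - ρ) * a ∈ slitPlane := mem_slitPlane_of_forall_add_ne_zero fun t ht h => by
    have := hχ.le_norm_ray hq hρ hs ha ht
    rw [h, norm_zero] at this
    have : 0 < a * (1 + ‖(ρ : ℂ)‖) / 4 := by positivity
    linarith
  have h1 := (hasDerivAt_smoothedE1 hu hX hz).differentiableAt
  have h2 : DifferentiableAt ℂ (fun s : ℂ => (s - ρ) * (a : ℂ)) s := by fun_prop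
  exact ((DifferentiableAt.comp (g := smoothedE1 u) s h1 h2).const_mul _).differentiableWithinAt

theorem IsPrimitive.summable_smoothedE1 (hχ : χ.IsPrimitive) (hq : 1 < q)
    (hu : IsWeight X u) (hX : 2 ≤ X) {a : ℝ} (ha : 0 < a) {s : ℂ} (hs : s ∈ centralBox) :
    Summable fun ρ : χ.zeros =>
      (analyticOrderNatAt (LFunction χ) ρ : ℂ) * smoothedE1 u ((s - ρ) * a) := by
  obtain ⟨C, hC⟩ := hχ.exists_norm_smoothedE1_le hq hu hX ha
  refine Summable.of_norm_bounded_eventually ((hχ.summable_zeros hq).mul_left C) ?_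
  rw [Filter.eventually_cofinite]
  refine (hχ.finite_zeros_norm_le hq 3).subset fun ρ hρ => ?_
  by_contra h
  exact hρ (hC ρ (not_le.1 h) s hs)

/-- The hybrid Euler–Hadamard product at points where `L` does not vanish. -/
theorem IsPrimitive.LFunction_eq_of_mem_centralBox (hχ : χ.IsPrimitive) (hq : 1 < q)
    (hu : IsWeight X u) (hX : 2 ≤ X) {s : ℂ} (hs : s ∈ centralBox) (hLs : LFunction χ s ≠ 0) :
    LFunction χ s = Complex.exp (χ.smoothedPrimeSum u X s) *
      Complex.exp (-∑' ρ : χ.zeros, (analyticOrderNatAt (LFunction χ) ρ : ℂ) *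
        smoothedE1 u ((s - ρ) * (Real.log X : ℂ))) := by
  classical
  have ha : 0 < Real.log X := Real.log_pos (by linarith)
  set a := Real.log X with ha_def
  -- Near zeros go into a finite product of entire functions; only far zeros, whose U-terms are
  -- holomorphic on the box, are kept as a sum.
  set S := (hχ.finite_zeros_norm_le hq 3).toFinset with hS
  have hmem : ∀ ρ : χ.zeros, ρ ∈ (↑S : Set χ.zeros)ᶜ → 3 < ‖(ρ : ℂ)‖ := fun ρ hρ => by
    simpa [hS] using hρ
  set far : ℂ → ℂ := fun s => ∑' ρ : ↥((↑S : Set χ.zeros)ᶜ),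
    (analyticOrderNatAt (LFunction χ) (ρ : χ.zeros) : ℂ) *
      smoothedE1 u ((s - (ρ : χ.zeros)) * a) with hfar
  set near : ℂ → ℂ := fun s => ∏ ρ ∈ S,
    expNegSmoothedE1 u ((s - ρ) * a) ^ analyticOrderNatAt (LFunction χ) ρ with hnear
  have hfarD : DifferentiableOn ℂ far centralBox := by
    obtain ⟨C, hC⟩ := hχ.exists_norm_smoothedE1_le hq hu hX ha
    refine differentiableOn_tsum_of_summable_norm
      (((hχ.summable_zeros hq).mul_left C).subtype (↑S : Set χ.zeros)ᶜ)
      (fun ρ => hχ.differentiableOn_smoothedE1 hq hu hX ha (hmem ρ ρ.2)) isOpen_centralBox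
      fun ρ s hs => hC ρ (hmem ρ ρ.2) s hs
  have hnearD : Differentiable ℂ near := by
    have := differentiable_expNegSmoothedE1 hu
    refine Differentiable.fun_finsetProd fun ρ _ => ?_
    refine Differentiable.pow (Differentiable.comp this ?_) _
    fun_prop
  have hsplit : ∀ s ∈ centralBox, LFunction χ s ≠ 0 → near s * Complex.exp (-far s) =
      Complex.exp (-∑' ρ : χ.zeros, (analyticOrderNatAt (LFunction χ) ρ : ℂ) *
        smoothedE1 u ((s - ρ) * (a : ℂ))) := by
    intro s hs hL
    rw [← (hχ.summable_smoothedE1 hq hu hX ha hs).sum_add_tsum_compl (s := S), neg_add,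
      Complex.exp_add, ← Finset.sum_neg_distrib, Complex.exp_sum]
    congr 1
    refine Finset.prod_congr rfl fun ρ _ => ?_
    have hz : (s - ρ) * (a : ℂ) ≠ 0 := by
      refine mul_ne_zero (sub_ne_zero.2 fun h => hL ?_) (ofReal_ne_zero.2 ha.ne')
      rw [h]; exact ρ.2
    rw [expNegSmoothedE1, ← exp_neg_smoothedE1 hu hX hz, ← Complex.exp_nat_mul]
    congr 1
    ring
  have hL := differentiable_LFunction (hχ.ne_one hq)
  have hP := differentiable_smoothedPrimeSum χ u X
  have hR : DifferentiableOn ℂ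
      (fun s => Complex.exp (χ.smoothedPrimeSum u X s) * (near s * Complex.exp (-far s)))
      centralBox :=
    hP.cexp.differentiableOn.mul (hnearD.differentiableOn.mul hfarD.neg.cexp)
  have h2 : (2 : ℂ) ∈ centralBox := by norm_num [centralBox]
  -- The identity theorem starts from a neighbourhood of 2, where L is non-zero and the formula is
  -- known.
  have heq := AnalyticOnNhd.eqOn_of_preconnected_of_eventuallyEq
    (hL.differentiableOn.analyticOnNhd isOpen_centralBox) (hR.analyticOnNhd isOpen_centralBox)
    convex_centralBox.isPreconnected h2 (by
      have hre : {s : ℂ | 1 < s.re} ∈ 𝓝 (2 : ℂ) :=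
        (isOpen_lt continuous_const continuous_re).mem_nhds (by norm_num)
      filter_upwards [hre, isOpen_centralBox.mem_nhds h2] with s hs1 hs
      rw [hsplit s hs, ← hχ.LFunction_eq_of_one_lt_re hq hu hX hs1]
      exact LFunction_ne_zero_of_one_le_re χ (Or.inl (hχ.ne_one hq)) (le_of_lt hs1))
  rw [← hsplit s hs hLs]
  exact heq hs

end DirichletCharacter

/-! ### Bounds at s = 1/2: trivial zeros and prime powers close to X. -/

namespace DirichletCharacter

variable {q : ℕ} [NeZero q] {χ : DirichletCharacter ℂ q} {X : ℝ} {u : ℝ → ℝ}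

theorem half_mem_centralBox : (1 / 2 : ℂ) ∈ centralBox := by norm_num [centralBox]

theorem half_le_log_of_two_le (hX : 2 ≤ X) : 1 / 2 ≤ Real.log X := by
  have := Real.log_two_gt_d9
  have := Real.log_le_log (by norm_num) hX
  linarith

theorem nontrivialZeros_subset_zeros (χ : DirichletCharacter ℂ q) :
    χ.nontrivialZeros ⊆ χ.zeros := fun _ h => h.1

theorem IsPrimitive.summable_zeroTerm_zeros (hχ : χ.IsPrimitive) (hq : 1 < q)
    (hu : IsWeight X u) (hX : 2 ≤ X) : Summable fun ρ : χ.zeros => χ.zeroTerm u X ρ := by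
  simp only [zeroTerm]
  exact hχ.summable_smoothedE1 hq hu hX (Real.log_pos (by linarith)) half_mem_centralBox

theorem IsPrimitive.summable_zeroTerm (hχ : χ.IsPrimitive) (hq : 1 < q) (hu : IsWeight X u)
    (hX : 2 ≤ X) {S : Set ℂ} (hS : S ⊆ χ.zeros) :
    Summable fun ρ : S => χ.zeroTerm u X ρ := by
  have h := (hχ.summable_zeroTerm_zeros hq hu hX).comp_injective (inclusion_injective hS)
  exact h

theorem IsPrimitive.norm_zeroTerm_le (hχ : χ.IsPrimitive) (hq : 1 < q) (hu : IsWeight X u)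
    (hX : 2 ≤ X) {ρ : ℂ} (hρ : ρ ∈ χ.zeros \ χ.nontrivialZeros) {n : ℕ} (hn : ρ = -n) :
    ‖χ.zeroTerm u X ρ‖ ≤
      4 / Real.log X * Real.exp (-Real.log X / 4) * Real.exp (-Real.log X / 2) ^ n := by
  have ha : 0 < Real.log X := Real.log_pos (by linarith)
  set a := Real.log X
  have hn0 : (0 : ℝ) ≤ n := Nat.cast_nonneg n
  have hord := (hχ.trivial_zero hq hρ.1 (by simp [hn])).2
  have hre : ((1 / 2 - ρ) * (a : ℂ)).re = (1 / 2 + n) * a := by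
    simp [hn]
  rw [zeroTerm, hord, Nat.cast_one, one_mul]
  refine (norm_smoothedE1_le hu hX (by rw [hre]; positivity)).trans ?_
  rw [hre, ← Real.exp_nat_mul, mul_assoc, ← Real.exp_add, div_eq_mul_inv, mul_comm]
  have e : -((1 / 2 + n) * a) / 2 = -a / 4 + n * (-a / 2) := by ring
  rw [e]
  refine mul_le_mul_of_nonneg_right ?_ (Real.exp_pos _).le
  rw [inv_eq_one_div, div_le_div_iff₀ (by positivity) ha]
  nlinarith

/-- Trivial zeros are simple and lie at distinct points -n, so their sum is dominated by a geometric
series whose constants do not involve q. -/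
theorem IsPrimitive.norm_tsum_trivial_le (hχ : χ.IsPrimitive) (hq : 1 < q) (hu : IsWeight X u)
    (hX : 2 ≤ X) :
    ‖∑' ρ : ↥(χ.zeros \ χ.nontrivialZeros), χ.zeroTerm u X ρ‖ ≤ 64 / Real.log X ^ 2 := by
  have ha2 := half_le_log_of_two_le hX
  -- The square of this number is 1/X ≤ 1/2 < 9/16.
  have hexp : Real.exp (-Real.log X / 2) ≤ 3 / 4 := by
    have h1 : Real.exp (-Real.log X / 2) ^ 2 = X⁻¹ := by
      rw [← Real.exp_nat_mul, show ((2 : ℕ) : ℝ) * (-Real.log X / 2) = -Real.log X by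
        push_cast; ring, Real.exp_neg, Real.exp_log (by linarith)]
    have h2 : X⁻¹ ≤ 2⁻¹ := inv_anti₀ (by norm_num) hX
    refine abs_le_of_sq_le_sq' (b := 3 / 4) ?_ (by norm_num) |>.2
    rw [h1]; norm_num at h2 ⊢; linarith
  set a := Real.log X
  have ha : 0 < a := by linarith
  have hr : ∀ ρ : ↥(χ.zeros \ χ.nontrivialZeros), ∃ n : ℕ, (ρ : ℂ) = -n := fun ρ => by
    refine (hχ.trivial_zero hq ρ.2.1 ?_).1
    by_contra h
    exact ρ.2.2 ⟨ρ.2.1, not_le.1 h, zeros_re_lt_one (hχ.ne_one hq) ⟨ρ, ρ.2.1⟩⟩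
  choose e he using hr
  have hinj : Function.Injective e := fun x y h => by
    ext; rw [he x, he y, h]
  have hs := (hχ.summable_zeroTerm hq hu hX
    (sdiff_subset : χ.zeros \ χ.nontrivialZeros ⊆ χ.zeros)).norm
  have hg : Summable fun n : ℕ => 4 / a * Real.exp (-a / 4) * Real.exp (-a / 2) ^ n :=
    (summable_geometric_of_lt_one (Real.exp_pos _).le (by linarith)).mul_left _
  refine (norm_tsum_le_tsum_norm hs).trans ((hs.tsum_le_tsum_of_inj e hinj
    (fun _ _ => by positivity) (fun ρ => hχ.norm_zeroTerm_le hq hu hX ρ.2 (he ρ)) hg).trans ?_)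
  rw [tsum_mul_left, tsum_geometric_of_lt_one (Real.exp_pos _).le (by linarith)]
  have h3 : (1 - Real.exp (-a / 2))⁻¹ ≤ 4 := by
    rw [inv_le_comm₀ (by linarith) (by norm_num)]
    linarith
  -- Some of the exponential decay is spent on the second factor 1/a.
  have h4 : Real.exp (-a / 4) ≤ 4 / a := by
    rw [neg_div, Real.exp_neg, ← inv_div a 4]
    refine inv_anti₀ (by positivity) ?_
    linarith [Real.add_one_le_exp (a / 4)]
  have h5 : 0 ≤ (1 - Real.exp (-a / 2))⁻¹ := inv_nonneg.2 (by linarith)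
  calc 4 / a * Real.exp (-a / 4) * (1 - Real.exp (-a / 2))⁻¹ ≤ 4 / a * (4 / a) * 4 := by gcongr
    _ = 64 / a ^ 2 := by field_simp; norm_num

/-- F vanishes up to 1 - 1/X, so n > X^{1-1/X} = X e^{-(log X)/X}, and e^{-y} ≥ 1 - y. The narrow
support of u is needed here. -/
theorem sub_log_le_of_weightCDF_ne_zero (hu : IsWeight X u) (hX : 2 ≤ X) {n : ℕ} (hn : 2 ≤ n)
    (h : weightCDF u (Real.log n / Real.log X) ≠ 0) : X - Real.log X ≤ n := by
  have ha : 0 < Real.log X := Real.log_pos (by linarith)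
  have hX0 : 0 < X := by linarith
  have hn0 : (0 : ℝ) < n := by exact_mod_cast (by omega : 0 < n)
  have h1 : 1 - 1 / X < Real.log n / Real.log X := by
    by_contra hc
    exact h (weightCDF_of_le hu (not_lt.1 hc))
  rw [lt_div_iff₀ ha] at h1
  have h2 : X * Real.exp (-(Real.log X / X)) ≤ n := by
    rw [← Real.exp_log hn0]
    nth_rw 1 [← Real.exp_log hX0]
    rw [← Real.exp_add, Real.exp_le_exp]
    refine le_trans (le_of_eq ?_) h1.le
    field_simp
    ring
  refine le_trans ?_ h2
  have h3 := mul_le_mul_of_nonneg_left (Real.add_one_le_exp (-(Real.log X / X))) hX0.le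
  refine le_trans (le_of_eq ?_) h3
  field_simp
  ring

theorem log_le_half_self (hX : 2 ≤ X) : Real.log X ≤ X / 2 := by
  have h1 := Real.log_le_sub_one_of_pos (show 0 < X / 2 by linarith)
  rw [Real.log_div (by linarith) (by norm_num)] at h1
  linarith [Real.log_two_lt_d9]

theorem norm_mangoldtCoeff_mul_weightCDF_le {N : ℕ} (χ : DirichletCharacter ℂ N) (hu : IsWeight X u)
    (hX : 2 ≤ X) {n : ℕ} (hn : 2 ≤ n) :
    ‖χ.mangoldtCoeff n * (n : ℂ) ^ (-(1 / 2) : ℂ) *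
      (weightCDF u (Real.log n / Real.log X) / Real.log n : ℝ)‖ ≤
      if X - Real.log X ≤ n then 2 / Real.sqrt X else 0 := by
  have hn0 : 0 < n := by omega
  have hlog : 0 < Real.log n := Real.log_pos (by exact_mod_cast hn)
  split_ifs with h
  · have h1 : Real.sqrt X ≤ 2 * Real.sqrt n := by
      rw [show (2 : ℝ) = Real.sqrt 4 by
        rw [show (4 : ℝ) = 2 ^ 2 by norm_num, Real.sqrt_sq (by norm_num)], ← Real.sqrt_mul
          (by norm_num)]
      exact Real.sqrt_le_sqrt (by linarith [log_le_half_self hX])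
    have h2 : ‖(n : ℂ) ^ (-(1 / 2) : ℂ)‖ = (Real.sqrt n)⁻¹ := by
      rw [Complex.norm_natCast_cpow_of_pos hn0, Real.sqrt_eq_rpow,
        ← Real.rpow_neg (Nat.cast_nonneg n)]
      norm_num
    have hsX : 0 < Real.sqrt X := Real.sqrt_pos.2 (by linarith)
    have hsn : 0 < Real.sqrt n := Real.sqrt_pos.2 (by exact_mod_cast hn0)
    rw [norm_mul, norm_mul, h2, Complex.norm_real, norm_div,
      Real.norm_of_nonneg (weightCDF_nonneg hu _), Real.norm_of_nonneg hlog.le]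
    calc ‖χ.mangoldtCoeff n‖ * (Real.sqrt n)⁻¹ *
          (weightCDF u (Real.log n / Real.log X) / Real.log n)
        ≤ Real.log n * (Real.sqrt n)⁻¹ * (1 / Real.log n) := by
          have := (χ.norm_mangoldtCoeff_le n).trans ArithmeticFunction.vonMangoldt_le_log
          have := weightCDF_le_one hu hX (Real.log n / Real.log X)
          have := weightCDF_nonneg hu (Real.log n / Real.log X)
          gcongr
      _ = 1 / Real.sqrt n := by field_simp
      _ ≤ 2 / Real.sqrt X := by
          rw [div_le_div_iff₀ hsn hsX]; linarith
  · have h0 : weightCDF u (Real.log n / Real.log X) = 0 := by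
      by_contra hc
      exact h (sub_log_le_of_weightCDF_ne_zero hu hX hn hc)
    simp [h0]

theorem card_filter_sub_log_le (hX : 2 ≤ X) :
    (((Finset.Icc 2 ⌊X⌋₊).filter fun n : ℕ => X - Real.log X ≤ n).card : ℝ) ≤
      Real.log X + 1 := by
  have ha : 0 < Real.log X := Real.log_pos (by linarith)
  have hsub : ((Finset.Icc 2 ⌊X⌋₊).filter fun n : ℕ => X - Real.log X ≤ n) ⊆
      Finset.Icc ⌈X - Real.log X⌉₊ ⌊X⌋₊ := fun n hn => by
    rw [Finset.mem_filter, Finset.mem_Icc] at hn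
    exact Finset.mem_Icc.2 ⟨Nat.ceil_le.2 hn.2, hn.1.2⟩
  have hcard := Finset.card_le_card hsub
  rw [Nat.card_Icc] at hcard
  have h1 := Nat.floor_le (show 0 ≤ X by linarith)
  have h2 := Nat.le_ceil (X - Real.log X)
  rcases le_total ⌈X - Real.log X⌉₊ (⌊X⌋₊ + 1) with h | h
  · have h3 : ((⌊X⌋₊ + 1 - ⌈X - Real.log X⌉₊ : ℕ) : ℝ) = ⌊X⌋₊ + 1 - ⌈X - Real.log X⌉₊ := by
      rw [Nat.cast_sub h]; push_cast; ring
    refine (Nat.cast_le.2 hcard).trans ?_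
    rw [h3]; linarith
  · rw [Nat.sub_eq_zero_of_le h] at hcard
    refine (Nat.cast_le.2 hcard).trans ?_
    rw [Nat.cast_zero]; linarith

theorem norm_sum_mangoldtCoeff_mul_weightCDF_le {N : ℕ} (χ : DirichletCharacter ℂ N)
    (hu : IsWeight X u) (hX : 2 ≤ X) :
    ‖∑ n ∈ Finset.Icc 2 ⌊X⌋₊, χ.mangoldtCoeff n * (n : ℂ) ^ (-(1 / 2) : ℂ) *
      (weightCDF u (Real.log n / Real.log X) / Real.log n : ℝ)‖ ≤ 288 / Real.log X ^ 2 := by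
  refine (norm_sum_le_of_le _ fun n hn =>
    norm_mangoldtCoeff_mul_weightCDF_le χ hu hX (Finset.mem_Icc.1 hn).1).trans ?_
  rw [← Finset.sum_filter, Finset.sum_const, nsmul_eq_mul]
  have hcard := card_filter_sub_log_le hX
  have ha2 := half_le_log_of_two_le hX
  have hsX : 0 < Real.sqrt X := Real.sqrt_pos.2 (by linarith)
  -- The cubic term of the exponential series, 48 = 2^3 · 3!. With log X ≥ 1/2, the factor log X + 1
  -- is at most 3 log X, whence 288 = 3 · 2 · 48.
  have hsqrt : Real.log X ^ 3 / 48 ≤ Real.sqrt X := by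
    have h1 : Real.sqrt X = Real.exp (Real.log X / 2) := by
      rw [Real.sqrt_eq_rpow, Real.rpow_def_of_pos (by linarith)]
      ring_nf
    have h2 := Real.pow_div_factorial_le_exp (Real.log X / 2) (by linarith) 3
    rw [h1]
    refine le_trans (le_of_eq ?_) h2
    norm_num [Nat.factorial]
    ring
  refine (mul_le_mul_of_nonneg_right hcard (by positivity)).trans ?_
  set a := Real.log X
  have ha : 0 < a := by linarith
  have h3 : 2 / Real.sqrt X ≤ 2 / (a ^ 3 / 48) :=
    div_le_div_of_nonneg_left (by norm_num) (by positivity) hsqrt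
  refine (mul_le_mul_of_nonneg_left h3 (by linarith)).trans ?_
  rw [div_div_eq_mul_div, mul_div_assoc', div_le_div_iff₀ (by positivity) (by positivity)]
  nlinarith [pow_pos ha 2, pow_pos ha 3, mul_nonneg (pow_pos ha 2).le (sub_nonneg.2 ha2)]

theorem PX_eq {N : ℕ} (χ : DirichletCharacter ℂ N) (u : ℝ → ℝ) (X : ℝ) :
    χ.PX X = Complex.exp (χ.smoothedPrimeSum u X (1 / 2) +
      ∑ n ∈ Finset.Icc 2 ⌊X⌋₊, χ.mangoldtCoeff n * (n : ℂ) ^ (-(1 / 2) : ℂ) *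
        (weightCDF u (Real.log n / Real.log X) / Real.log n : ℝ)) := by
  rw [PX, smoothedPrimeSum, ← Finset.sum_add_distrib]
  congr 1
  refine Finset.sum_congr rfl fun n _ => ?_
  have h : (n : ℂ) ^ (-(1 / 2) : ℂ) = (Real.sqrt n : ℂ)⁻¹ := by
    rw [Complex.cpow_neg, Real.sqrt_eq_rpow, Complex.ofReal_cpow (Nat.cast_nonneg n)]
    push_cast
    rfl
  rw [h, mangoldtCoeff]
  push_cast
  ring

/-- Completing the smoothed prime sum to the sharp one and dropping the trivial zeros are the only
departures from the exact formula; both are collected in the last exponential. -/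
theorem IsPrimitive.LFunction_half_eq (hχ : χ.IsPrimitive) (hq : 1 < q) (hu : IsWeight X u)
    (hX : 2 ≤ X) (hL : LFunction χ (1 / 2) ≠ 0) :
    LFunction χ (1 / 2) = χ.PX X * χ.ZX u X * Complex.exp
      (-(∑ n ∈ Finset.Icc 2 ⌊X⌋₊, χ.mangoldtCoeff n * (n : ℂ) ^ (-(1 / 2) : ℂ) *
          (weightCDF u (Real.log n / Real.log X) / Real.log n : ℝ)) -
        ∑' ρ : ↥(χ.zeros \ χ.nontrivialZeros), χ.zeroTerm u X ρ) := by
  have hsplit : ∑' ρ : χ.zeros, χ.zeroTerm u X ρ = ∑' ρ : χ.nontrivialZeros, χ.zeroTerm u X ρ +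
      ∑' ρ : ↥(χ.zeros \ χ.nontrivialZeros), χ.zeroTerm u X ρ := by
    rw [← Summable.tsum_union_disjoint (f := χ.zeroTerm u X) disjoint_sdiff_right
      (hχ.summable_zeroTerm hq hu hX χ.nontrivialZeros_subset_zeros)
      (hχ.summable_zeroTerm hq hu hX sdiff_subset)]
    exact tsum_congr_set_coe (χ.zeroTerm u X)
      (union_sdiff_cancel χ.nontrivialZeros_subset_zeros).symm
  have h := hχ.LFunction_eq_of_mem_centralBox hq hu hX half_mem_centralBox hL
  simp only [← zeroTerm.eq_1] at h
  rw [h, hsplit, PX_eq χ u X, ZX, if_neg fun hmem => hL hmem.1, ← Complex.exp_add,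
    ← Complex.exp_add, ← Complex.exp_add]
  congr 1
  ring

end DirichletCharacter

/-! ### Conclusion. -/

theorem norm_exp_sub_one_le_mul_exp (w : ℂ) : ‖Complex.exp w - 1‖ ≤ ‖w‖ * Real.exp ‖w‖ := by
  simpa using Complex.norm_exp_sub_sum_le_norm_mul_exp w 1

theorem theorem1 :
    ∃ C : ℝ, ∀ (X : ℝ), 2 ≤ X → ∀ (u : ℝ → ℝ), IsWeight X u →
      ∀ (q : ℕ) [NeZero q], 1 < q → ∀ (χ : DirichletCharacter ℂ q), χ.IsPrimitive →
        Summable (fun ρ : χ.nontrivialZeros => χ.zeroTerm u X ρ) ∧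
        ∃ θ : ℂ, ‖θ‖ ≤ C * (Real.log X) ^ (-2 : ℤ) ∧
          χ.LFunction (1 / 2) = χ.PX X * χ.ZX u X * (1 + θ) := by
  -- 352 = 288 + 64 adds the prime and trivial-zero bounds. Since log X ≥ 1/2, the exponent has norm
  -- at most 4 · 352 = 1408.
  refine ⟨352 * Real.exp 1408, fun X hX u hu q _ hq χ hχ =>
    ⟨hχ.summable_zeroTerm hq hu hX χ.nontrivialZeros_subset_zeros, ?_⟩⟩
  have ha2 := DirichletCharacter.half_le_log_of_two_le hX
  by_cases hL : χ.LFunction (1 / 2) = 0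
  · refine ⟨0, by rw [norm_zero]; positivity, ?_⟩
    have hmem : (1 / 2 : ℂ) ∈ χ.nontrivialZeros := ⟨hL, by norm_num, by norm_num⟩
    rw [hL, DirichletCharacter.ZX, if_pos hmem]
    ring
  have hP := DirichletCharacter.norm_sum_mangoldtCoeff_mul_weightCDF_le χ hu hX
  have hT := hχ.norm_tsum_trivial_le hq hu hX
  have h := hχ.LFunction_half_eq hq hu hX hL
  set δ := ∑ n ∈ Finset.Icc 2 ⌊X⌋₊, χ.mangoldtCoeff n * (n : ℂ) ^ (-(1 / 2) : ℂ) *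
    (weightCDF u (Real.log n / Real.log X) / Real.log n : ℝ)
  set T := ∑' ρ : ↥(χ.zeros \ χ.nontrivialZeros), χ.zeroTerm u X ρ
  refine ⟨Complex.exp (-δ - T) - 1, ?_, by rw [h]; ring⟩
  have hw : ‖-δ - T‖ ≤ 352 / Real.log X ^ 2 := by
    refine (norm_sub_le _ _).trans ?_
    rw [norm_neg, show 352 / Real.log X ^ 2 = 288 / Real.log X ^ 2 + 64 / Real.log X ^ 2 by ring]
    exact add_le_add hP hT
  have hw' : ‖-δ - T‖ ≤ 1408 := by
    refine hw.trans ?_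
    rw [div_le_iff₀ (by positivity)]
    nlinarith
  refine (norm_exp_sub_one_le_mul_exp _).trans ?_
  calc ‖-δ - T‖ * Real.exp ‖-δ - T‖ ≤ 352 / Real.log X ^ 2 * Real.exp 1408 := by gcongr
    _ = 352 * Real.exp 1408 * Real.log X ^ (-2 : ℤ) := by
      rw [zpow_neg, zpow_ofNat]
      ring
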